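/- Let $d\ge 3$, let $\mathbb B^d$ be the set of nonoriented nearest-neighbour bonds of $\mathbb Z^d$, and let $\Omega=(0,\infty)^{\mathbb B^d}$ carry the product $\sigma$-algebra $\mathcal F$. Write $\omega(x,y)=\omega(\{x,y\})$ if $\{x,y\}\in\mathbb B^d$ and $\omega(x,y)=0$ otherwise, and $\tau_x\omega(e)=\omega(e+x)$ for $x\in\mathbb Z^d$. Let $\mathbb P$ be a probability measure on $(\Omega,\mathcal F)$ such that (i) $\mathbb P\circ\tau_x^{-1}=\mathbb P$ for all $x\in\mathbb Z^d$; (ii) $\mathbb P[A]\in\{0,1\}$ for every $A\in\mathcal F$ with $\tau_x(A)=A$ for all $x\in\mathbb Z^d$; (iii) there are $p,q\in(1,\infty]$ with $\frac1p+\frac1q<\frac2{d-1}$ such that $\omega(e)\in L^p(\mathbb P)$ and $\omega(e)^{-1}\in L^q(\mathbb P)$ for every $e\in\mathbb B^d$. Let $L^2_{\rm cov}$ be the space of random fields $\Psi:\Omega\times\mathbb Z^d\to\mathbb R$ (each $\Psi(\cdot,x)$ measurable) that satisfy, for $\mathbb P$-a.e. $\omega$, the cocycle property $\Psi(\tau_x\omega,y-x)=\Psi(\omega,y)-\Psi(\omega,x)$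 for all $x,y\in\mathbb Z^d$, and have finite norm $\|\Psi\|_{L^2_{\rm cov}}^2=\mathbb E\big[\sum_{x}\omega(0,x)\Psi(\omega,x)^2\big]<\infty$, with the corresponding scalar product. Let $L^2_{\rm pot}$ be the closure in $L^2_{\rm cov}$ of the set of those fields $D\varphi(\omega,x)=\varphi(\tau_x\omega)-\varphi(\omega)$ that lie in $L^2_{\rm cov}$, where $\varphi:\Omega\to\mathbb R$ is measurable and local (it depends on the conductances of finitely many bonds only), and let $L^2_{\rm sol}$ be the orthogonal complement of $L^2_{\rm pot}$ in $L^2_{\rm cov}$. Then, for every $j\in\{1,\dots,d\}$, the position field $\Pi_j(\omega,x)=x_j$ has a decomposition $\Pi_j=\chi_j+\Phi_j$ with $\chi_j\in L^2_{\rm pot}$ and $\Phi_j\in L^2_{\rm sol}$, and for every (version of the) corrector component $\chi_j$ arising in this way and every $L\in\mathbb N$, $$\lim_{n\to\infty}\frac1n\max_{x\in B(Ln)}|\chi_j(\omega,x)|=0\qquad\text{for }\mathbb P\text{-a.e. }\omega,$$ where $B(m)=([-m,m]\cap\mathbb Z)^d$. -/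

import Mathlib

open MeasureTheory Filter Topology
open scoped ENNReal

namespace RandomConductance

/-- The nearest neighbour graph on `ℤ^d`: `x ∼ y` iff the Euclidean distance `|x - y|` is `1`. -/
def lattice (d : ℕ) : SimpleGraph (Fin d → ℤ) where
  Adj x y := ∑ i, (x i - y i) ^ 2 = 1
  symm := by
    constructor
    intro x y h
    rw [← h]
    exact Finset.sum_congr rfl fun i _ => by ring
  loopless := by
    constructor
    intro x h
    simp at h

/-- The set `𝔹^d` of nonoriented nearest neighbour bonds. -/
abbrev Bond (d : ℕ) : Type := (lattice d).edgeSet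

/-- The space `Ω = (0,∞)^{𝔹^d}` of environments; as a product type it carries the product of the
Borel `σ`-algebras. -/
abbrev Env (d : ℕ) : Type := Bond d → Set.Ioi (0 : ℝ)

/-- `ω(x,y)`: the conductance of the bond `{x,y}`, and `0` if `{x,y}` is not a bond. -/
noncomputable def conductance {d : ℕ} (ω : Env d) (x y : Fin d → ℤ) : ℝ :=
  open Classical in
  if h : (lattice d).Adj x y then (ω ⟨s(x, y), h⟩ : ℝ) else 0

theorem lattice_adj_add {d : ℕ} (z x y : Fin d → ℤ) (h : (lattice d).Adj x y) :
    (lattice d).Adj (x + z) (y + z) := by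
  simpa [lattice] using h

theorem map_add_mem_edgeSet {d : ℕ} (z : Fin d → ℤ) (e : Sym2 (Fin d → ℤ))
    (h : e ∈ (lattice d).edgeSet) : e.map (fun x => x + z) ∈ (lattice d).edgeSet := by
  induction e using Sym2.ind with
  | _ x y => exact lattice_adj_add z x y h

/-- The translated bond `e + z`. -/
def Bond.shift {d : ℕ} (z : Fin d → ℤ) (e : Bond d) : Bond d :=
  ⟨e.1.map (fun x => x + z), map_add_mem_edgeSet z e.1 e.2⟩

/-- The space shift `τ_z`, given by `(τ_z ω)(e) = ω(e + z)`. -/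
def shift {d : ℕ} (z : Fin d → ℤ) (ω : Env d) : Env d := fun e => ω (Bond.shift z e)

/-- The law `P` is stationary: every space shift preserves `P`. -/
def IsStationary {d : ℕ} (P : Measure (Env d)) : Prop :=
  ∀ z : Fin d → ℤ, MeasurePreserving (shift z) P P

/-- The law `P` is ergodic: shift invariant events have probability `0` or `1`. -/
def IsErgodic {d : ℕ} (P : Measure (Env d)) : Prop :=
  ∀ A : Set (Env d), MeasurableSet A → (∀ z : Fin d → ℤ, shift z '' A = A) → P A = 0 ∨ P A = 1

/-- The cocycle property, for `P`-almost every environment. -/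
def IsCocycle {d : ℕ} (P : Measure (Env d)) (Ψ : Env d → (Fin d → ℤ) → ℝ) : Prop :=
  ∀ᵐ ω ∂P, ∀ x y : Fin d → ℤ, Ψ (shift x ω) (y - x) = Ψ ω y - Ψ ω x

/-- `‖Ψ‖² = 𝔼[∑ₓ ω(0,x) Ψ(ω,x)²]`, with values in `[0,∞]`. -/
noncomputable def covNormSq {d : ℕ} (P : Measure (Env d)) (Ψ : Env d → (Fin d → ℤ) → ℝ) : ℝ≥0∞ :=
  ∫⁻ ω, ∑' x : Fin d → ℤ, ENNReal.ofReal (conductance ω 0 x * Ψ ω x ^ 2) ∂P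

/-- The scalar product `𝔼[∑ₓ ω(0,x) Ψ(ω,x) Θ(ω,x)]` of `L²_cov`. Only the `2d` neighbours `x` of
the origin contribute, and the integrand is integrable if both fields have finite norm. -/
noncomputable def covInner {d : ℕ} (P : Measure (Env d)) (Ψ Θ : Env d → (Fin d → ℤ) → ℝ) : ℝ :=
  ∫ ω, ∑' x : Fin d → ℤ, conductance ω 0 x * Ψ ω x * Θ ω x ∂P

/-- The space `L²_cov` of (measurable) random fields with the cocycle property and finite norm. -/
structure MemL2cov {d : ℕ} (P : Measure (Env d)) (Ψ : Env d → (Fin d → ℤ) → ℝ) : Prop where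
  measurable : ∀ x, Measurable fun ω => Ψ ω x
  cocycle : IsCocycle P Ψ
  norm_lt_top : covNormSq P Ψ < ∞

/-- Local (measurable) functions: they depend on the conductances of finitely many bonds only. -/
def IsLocal {d : ℕ} (φ : Env d → ℝ) : Prop :=
  Measurable φ ∧ ∃ S : Finset (Bond d), DependsOn φ (S : Set (Bond d))

/-- The horizontal derivative `Dφ(ω,x) = φ(τ_x ω) - φ(ω)`. -/
def horizDeriv {d : ℕ} (φ : Env d → ℝ) : Env d → (Fin d → ℤ) → ℝ :=
  fun ω x => φ (shift x ω) - φ ω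

/-- The space `L²_pot`: the closure in `L²_cov` of the set of those `Dφ`, `φ` local, that belong
to `L²_cov`. -/
def MemL2pot {d : ℕ} (P : Measure (Env d)) (Ψ : Env d → (Fin d → ℤ) → ℝ) : Prop :=
  MemL2cov P Ψ ∧ ∀ ε : ℝ≥0∞, 0 < ε → ∃ φ : Env d → ℝ, IsLocal φ ∧ MemL2cov P (horizDeriv φ) ∧
    covNormSq P (fun ω x => Ψ ω x - horizDeriv φ ω x) < ε

/-- The space `L²_sol`: the orthogonal complement of `L²_pot` in `L²_cov`. -/
def MemL2sol {d : ℕ} (P : Measure (Env d)) (Ψ : Env d → (Fin d → ℤ) → ℝ) : Prop :=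
  MemL2cov P Ψ ∧ ∀ Θ : Env d → (Fin d → ℤ) → ℝ, MemL2pot P Θ → covInner P Ψ Θ = 0

/-- `χ` is (a version of) the `j`-th component of the corrector: `Π_j = χ + Φ` with `χ ∈ L²_pot`
and `Φ ∈ L²_sol`, where `Π_j(ω,x) = x_j` is the position field. -/
def IsCorrector {d : ℕ} (P : Measure (Env d)) (j : Fin d) (χ : Env d → (Fin d → ℤ) → ℝ) : Prop :=
  MemL2pot P χ ∧ MemL2sol P (fun ω x => (x j : ℝ) - χ ω x)

/-- The box `B(n) = ([-n,n] ∩ ℤ)^d`. -/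
noncomputable def box (d n : ℕ) : Finset (Fin d → ℤ) := Finset.Icc (fun _ => -(n : ℤ)) (fun _ => (n : ℤ))

theorem box_nonempty (d n : ℕ) : (box d n).Nonempty := by
  refine ⟨0, ?_⟩
  simp only [box, Finset.mem_Icc, Pi.le_def, Pi.zero_apply]
  exact ⟨fun _ => by omega, fun _ => by omega⟩

/-- `max_{x ∈ B(n)} |f(x)|`. -/
noncomputable def boxMax {d : ℕ} (n : ℕ) (f : (Fin d → ℤ) → ℝ) : ℝ :=
  (box d n).sup' (box_nonempty d n) fun x => |f x|

end RandomConductance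

namespace RandomConductance

/-! Harmonicity. The field `Φ = Π_j - χ_j` is orthogonal to the gradients of bounded local
functions. By stationarity its divergence at the origin then has integral zero over every cylinder
event, so it vanishes almost surely and `Φ` is harmonic for almost every environment
(`ae_harmonicAt`). Existence of `χ_j` is orthogonal projection in the `L²` space of edges. The only
point is that a limit of gradients, known a priori on the bonds at the origin, comes from a cocycle
on all of `ℤ^d` (`exists_memL2cov_of_mem_closure`).

Pointwise bound. `local_bound` is a De Giorgi iteration. Caccioppoli's inequality bounds the energy
of the truncations `(u - k)₊` by the flux through the bonds across which the cutoff varies. The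
cutoff is made to drop only between hyperplane layers that carry no more than a multiple of the
average mass; by Markov's inequality there are enough of them. On such a layer the Sobolev
inequality of dimension `D = d - 1` is available instead of that of dimension `d`. Together with
Hölder's inequality against `ω^p` and `ω^(-q)`, one step of the iteration raises the energy to a
power `χ`, which exceeds `1` exactly when `1/p + 1/q < 2/(d-1)`. (This exponent `χ` is unrelated to
the corrector.)

Two scales. Fix `m` and cover `B(Ln)` by cubes of radius `R ≈ n/m`. The corrector is an `L²` limit
of gradients of bounded functions. These have bounded oscillation, and the remainder has small
energy, so by Poincaré's inequality the mean `L^s` oscillation of the corrector on the large box is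
at most any prescribed small multiple of `n`. If that multiple is small depending on `m`, the
corrector is of order `R` in mean on each small cube, up to one common constant. `local_bound` turns
this into a pointwise bound `K R` on every small cube (`exists_abs_le_mul`). Since `K` does not
depend on `m`, the maximum is of order `n/m`, and `m` is arbitrary.

Ergodic input. For `K` to be independent of `m`, averages over cubes centred at `R z` must be
bounded by a constant independent of `z` (`eventually_cubeSum_offcentre_le`). A full pointwise
ergodic theorem is not needed: Vitali's lemma gives a maximal inequality, ergodicity turns it into
an almost sure bound by a multiple of the mean, and a truncation argument removes the dependence on
`z`. -/

/-! ### Cubes of the lattice -/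

/-- The cube `[-n,n]^ι ∩ ℤ^ι`. -/
noncomputable def cube (ι : Type*) [Fintype ι] [DecidableEq ι] (n : ℕ) : Finset (ι → ℤ) :=
  Fintype.piFinset fun _ => Finset.Icc (-(n : ℤ)) n

theorem mem_cube {ι : Type*} [Fintype ι] [DecidableEq ι] {n : ℕ} {x : ι → ℤ} :
    x ∈ cube ι n ↔ ∀ i, -(n : ℤ) ≤ x i ∧ x i ≤ n := by
  simp [cube]

theorem box_eq_cube (d n : ℕ) : box d n = cube (Fin d) n := by
  ext x
  simp [box, mem_cube, Pi.le_def, forall_and]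

theorem card_cube (ι : Type*) [Fintype ι] [DecidableEq ι] (n : ℕ) :
    (cube ι n).card = (2 * n + 1) ^ Fintype.card ι := by
  simp only [cube, Fintype.card_piFinset, Int.card_Icc, Finset.prod_const, Finset.card_univ]
  congr 1
  omega

theorem cube_mono {ι : Type*} [Fintype ι] [DecidableEq ι] {m n : ℕ} (h : m ≤ n) :
    cube ι m ⊆ cube ι n := by
  intro x hx
  rw [mem_cube] at hx ⊢
  intro i
  have := hx i
  omega

theorem update_mem_cube {ι : Type*} [Fintype ι] [DecidableEq ι] {n : ℕ} {x : ι → ℤ}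
    (hx : x ∈ cube ι n) (i : ι) {t : ℤ} (ht : t ∈ Finset.Icc (-(n : ℤ)) n) :
    Function.update x i t ∈ cube ι n := by
  rw [mem_cube] at hx ⊢
  intro k
  rw [Finset.mem_Icc] at ht
  by_cases h : k = i
  · subst h; simpa using ht
  · simpa [Function.update_of_ne h] using hx k

/-! ### Variation along lines; Sobolev and Friedrichs inequalities on cubes -/

/-- The increment of `v` along the bond `{x, x + eᵢ}` if this bond starts in the layers
`{x i < n}`, and `0` otherwise. -/
def cubeGrad {ι : Type*} [DecidableEq ι] (n : ℕ) (v : (ι → ℤ) → ℝ) (i : ι) (x : ι → ℤ) : ℝ :=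
  if x i < n then v (Function.update x i (x i + 1)) - v x else 0

/-- The increments between two points of an interval are bounded by the total variation. -/
theorem abs_sub_le_sum_Ico (n : ℕ) (g : ℤ → ℝ) {a b : ℤ} (ha : a ∈ Finset.Icc (-(n : ℤ)) n)
    (hb : b ∈ Finset.Icc (-(n : ℤ)) n) :
    |g a - g b| ≤ ∑ t ∈ Finset.Ico (-(n : ℤ)) n, |g (t + 1) - g t| := by
  wlog hab : a ≤ b generalizing a b
  · rw [abs_sub_comm]
    exact this hb ha (by omega)
  rw [Finset.mem_Icc] at ha hb
  have key : ∀ b, a ≤ b → |g a - g b| ≤ ∑ t ∈ Finset.Ico a b, |g (t + 1) - g t| := by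
    intro b hb
    induction b, hb using Int.leInduction with
    | base => simp
    | succ m hm ih =>
      have : Finset.Ico a (m + 1) = insert m (Finset.Ico a m) := by
        ext x; simp only [Finset.mem_Ico, Finset.mem_insert]; omega
      rw [this, Finset.sum_insert (by simp)]
      have h1 : |g a - g (m + 1)| ≤ |g a - g m| + |g (m + 1) - g m| := by
        rw [abs_sub_comm (g (m + 1))]
        exact abs_sub_le _ _ _
      linarith
  refine (key b hab).trans (Finset.sum_le_sum_of_subset_of_nonneg ?_ fun _ _ _ => abs_nonneg _)
  intro x
  simp only [Finset.mem_Ico]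
  omega

theorem abs_sub_update_le_sum_cubeGrad {ι : Type*} [Fintype ι] [DecidableEq ι] (n : ℕ)
    (v : (ι → ℤ) → ℝ) {x : ι → ℤ} (hx : x ∈ cube ι n) (i : ι) {b : ℤ}
    (hb : b ∈ Finset.Icc (-(n : ℤ)) n) :
    |v x - v (Function.update x i b)| ≤
      ∑ t ∈ Finset.Icc (-(n : ℤ)) n, |cubeGrad n v i (Function.update x i t)| := by
  have h := abs_sub_le_sum_Ico n (fun t => v (Function.update x i t)) (a := x i) (b := b)
    (Finset.mem_Icc.2 (mem_cube.1 hx i)) hb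
  simp only [Function.update_eq_self] at h
  refine h.trans ?_
  -- `cubeGrad` is zero at the last point `t = n` of the line, so the half-open sum can be written
  -- over the whole line.
  rw [← Finset.sum_subset (s₁ := Finset.Ico (-(n : ℤ)) n)
    (fun t ht => Finset.mem_Icc.2 ⟨(Finset.mem_Ico.1 ht).1, (Finset.mem_Ico.1 ht).2.le⟩)]
  · refine Finset.sum_le_sum fun t ht => ?_
    simp [cubeGrad, (Finset.mem_Ico.1 ht).2]
  · intro t ht ht'
    rw [Finset.mem_Icc] at ht
    rw [Finset.mem_Ico] at ht'
    have : ¬ t < n := by omega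
    simp [cubeGrad, this]

/-- For every point `b` of the line, `v x` is at most the variation along the line plus the value at
`b`; average over `b`. This puts the hypothesis of the grid-lines lemma in the form of a sum over
each line through `x`. -/
theorem le_sum_line {ι : Type*} [Fintype ι] [DecidableEq ι] (n : ℕ) (v : (ι → ℤ) → ℝ)
    {x : ι → ℤ} (hx : x ∈ cube ι n) (i : ι) :
    v x ≤ ∑ t ∈ Finset.Icc (-(n : ℤ)) n, (|cubeGrad n v i (Function.update x i t)| +
      v (Function.update x i t) / (2 * n + 1)) := by
  set S := ∑ t ∈ Finset.Icc (-(n : ℤ)) n, |cubeGrad n v i (Function.update x i t)| with hS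
  have h : ∀ b ∈ Finset.Icc (-(n : ℤ)) n, v x ≤ S + v (Function.update x i b) := fun b hb => by
    have := (le_abs_self _).trans (abs_sub_update_le_sum_cubeGrad n v hx i hb)
    linarith
  have hc : (Finset.Icc (-(n : ℤ)) n).card = 2 * n + 1 := by
    simp only [Int.card_Icc]; omega
  have h2 := Finset.sum_le_sum h
  rw [Finset.sum_const, Finset.sum_add_distrib, Finset.sum_const, hc] at h2
  simp only [nsmul_eq_mul] at h2
  push_cast at h2
  rw [Finset.sum_add_distrib, ← Finset.sum_div, ← hS]
  have hpos : (0 : ℝ) < 2 * n + 1 := by positivity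
  rw [← sub_le_iff_le_add', le_div_iff₀ hpos]
  nlinarith

theorem lintegral_pi_count {ι : Type*} [Fintype ι] (f : (ι → ℤ) → ℝ≥0∞) :
    ∫⁻ x, f x ∂(Measure.pi fun _ : ι => (Measure.count : Measure ℤ)) = ∑' x, f x := by
  rw [lintegral_countable']
  refine tsum_congr fun x => ?_
  rw [Measure.pi_singleton]
  simp

/-- The discrete Loomis–Whitney inequality in the form of the grid-lines lemma. -/
theorem sum_rpow_le_of_le_line {ι : Type*} [Fintype ι] [DecidableEq ι]
    (hι : 2 ≤ Fintype.card ι) (n : ℕ) (v f : (ι → ℤ) → ℝ) (hv : ∀ x, 0 ≤ v x)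
    (hf : ∀ x, 0 ≤ f x)
    (h : ∀ x ∈ cube ι n, ∀ i, v x ≤ ∑ t ∈ Finset.Icc (-(n : ℤ)) n, f (Function.update x i t)) :
    ∑ x ∈ cube ι n, v x ^ ((Fintype.card ι : ℝ) / (Fintype.card ι - 1)) ≤
      (∑ x ∈ cube ι n, f x) ^ ((Fintype.card ι : ℝ) / (Fintype.card ι - 1)) := by
  set D : ℝ := (Fintype.card ι : ℝ) with hD
  have hD2 : (2 : ℝ) ≤ D := by rw [hD]; exact_mod_cast hι
  have hp : Real.HolderConjugate (Fintype.card ι : ℝ) (D / (D - 1)) :=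
    Real.HolderConjugate.conjExponent (by rw [← hD]; linarith)
  set F : (ι → ℤ) → ℝ≥0∞ := fun x => if x ∈ cube ι n then ENNReal.ofReal (f x) else 0 with hF
  -- The measure-theoretic grid-lines inequality, used for counting measure. Cutting `F` off outside
  -- the cube turns the line integrals into the sums in `h`.
  have key := lintegral_prod_lintegral_pow_le (fun _ : ι => (Measure.count : Measure ℤ)) hp
    (f := F) (measurable_of_countable _)
  rw [lintegral_pi_count, lintegral_pi_count] at key
  simp only [lintegral_count] at key
  have hFsum : ∑' x, F x = ENNReal.ofReal (∑ x ∈ cube ι n, f x) := by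
    rw [tsum_eq_sum (s := cube ι n) (fun x hx => by simp [hF, hx]),
      ENNReal.ofReal_sum_of_nonneg fun x _ => hf x]
    exact Finset.sum_congr rfl fun x hx => by simp [hF, hx]
  have hleft : ENNReal.ofReal (∑ x ∈ cube ι n, v x ^ (D / (D - 1))) ≤
      ∑' x, ∏ i, (∑' t, F (Function.update x i t)) ^ ((1 : ℝ) / (D - 1)) := by
    rw [ENNReal.ofReal_sum_of_nonneg fun x _ => Real.rpow_nonneg (hv x) _]
    refine le_trans (Finset.sum_le_sum fun x hx => ?_) (ENNReal.sum_le_tsum (cube ι n))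
    have h1 : ∀ i, ENNReal.ofReal (v x) ≤ ∑' t, F (Function.update x i t) := fun i => by
      refine le_trans (ENNReal.ofReal_le_ofReal (h x hx i)) ?_
      rw [ENNReal.ofReal_sum_of_nonneg fun t _ => hf _]
      refine le_trans (Finset.sum_le_sum fun t ht => ?_)
        (ENNReal.sum_le_tsum (Finset.Icc (-(n : ℤ)) n))
      simp [hF, update_mem_cube hx i ht]
    calc ENNReal.ofReal (v x ^ (D / (D - 1)))
        = ∏ _i : ι, ENNReal.ofReal (v x) ^ ((1 : ℝ) / (D - 1)) := by
          have he : (1 : ℝ) / (D - 1) * (Fintype.card ι : ℝ) = D / (D - 1) := by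
            rw [← hD]; ring
          rw [Finset.prod_const, Finset.card_univ, ← ENNReal.rpow_mul_natCast, he,
            ENNReal.ofReal_rpow_of_nonneg (hv x) (by apply div_nonneg <;> linarith)]
      _ ≤ _ := Finset.prod_le_prod' fun i _ => ENNReal.rpow_le_rpow (h1 i) (by
          apply div_nonneg <;> linarith)
  have := hleft.trans (key.trans_eq (by rw [hFsum]))
  rw [ENNReal.ofReal_rpow_of_nonneg (Finset.sum_nonneg fun x _ => hf x)
    (by apply div_nonneg <;> linarith)] at this
  exact (ENNReal.ofReal_le_ofReal_iff
    (Real.rpow_nonneg (Finset.sum_nonneg fun x _ => hf x) _)).1 this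

/-- The Sobolev inequality `W^{1,1} ⊂ ℓ^{D/(D-1)}` on a discrete cube. -/
theorem sobolev_one {ι : Type*} [Fintype ι] [DecidableEq ι] (hι : 2 ≤ Fintype.card ι) (n : ℕ)
    (v : (ι → ℤ) → ℝ) (hv : ∀ x, 0 ≤ v x) :
    ∑ x ∈ cube ι n, v x ^ ((Fintype.card ι : ℝ) / (Fintype.card ι - 1)) ≤
      (∑ x ∈ cube ι n, (∑ i, |cubeGrad n v i x| + v x / (2 * n + 1))) ^
        ((Fintype.card ι : ℝ) / (Fintype.card ι - 1)) := by
  refine sum_rpow_le_of_le_line hι n v _ hv (fun x => ?_) fun x hx i => ?_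
  · have := hv x
    positivity
  · refine (le_sum_line n v hx i).trans (Finset.sum_le_sum fun t _ => ?_)
    gcongr
    exact Finset.single_le_sum (f := fun i => |cubeGrad n v i (Function.update x _ t)|)
      (fun _ _ => abs_nonneg _) (Finset.mem_univ i)

/-- A discrete chain rule for the power `γ`, obtained from Bernoulli's inequality for the ratio of
the smaller to the larger number. -/
theorem abs_rpow_sub_rpow_le {a b γ : ℝ} (ha : 0 ≤ a) (hb : 0 ≤ b) (hγ : 1 ≤ γ) :
    |a ^ γ - b ^ γ| ≤ γ * |a - b| * (a ^ (γ - 1) + b ^ (γ - 1)) := by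
  wlog hab : a ≤ b generalizing a b
  · rw [abs_sub_comm, abs_sub_comm a, add_comm]
    exact this hb ha (by linarith)
  rcases hb.eq_or_lt with rfl | hb'
  · have : a = 0 := le_antisymm hab ha
    subst this
    simp
  have h1 := one_add_mul_self_le_rpow_one_add (s := a / b - 1)
    (by linarith [div_nonneg ha hb]) hγ
  rw [add_sub_cancel, Real.div_rpow ha hb, le_div_iff₀ (Real.rpow_pos_of_pos hb' _)] at h1
  have h2 : b ^ γ = b * b ^ (γ - 1) := by
    rw [← Real.rpow_one_add' hb (by linarith)]
    congr 1; ring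
  have h3 : (1 + γ * (a / b - 1)) * b ^ γ = b ^ γ - γ * (b - a) * b ^ (γ - 1) := by
    rw [h2]; field_simp; ring
  rw [abs_sub_comm, abs_of_nonneg (sub_nonneg.2 (Real.rpow_le_rpow ha hab (by linarith))),
    abs_sub_comm, abs_of_nonneg (sub_nonneg.2 hab)]
  have h4 : 0 ≤ γ * (b - a) * a ^ (γ - 1) := by
    have := Real.rpow_nonneg ha (γ - 1)
    have : 0 ≤ b - a := by linarith
    positivity
  linarith

/-- The integrand of the (scaled) `W^{1,s}` norm on a cube. -/
noncomputable def sobolevDensity {ι : Type*} [Fintype ι] [DecidableEq ι] (s : ℝ) (n : ℕ)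
    (ℓ : ℝ) (v : (ι → ℤ) → ℝ) (x : ι → ℤ) : ℝ :=
  ∑ i, |cubeGrad n v i x| ^ s + (v x / ℓ) ^ s

theorem sobolevDensity_nonneg {ι : Type*} [Fintype ι] [DecidableEq ι] {s : ℝ} {n : ℕ}
    {ℓ : ℝ} (hℓ : 0 ≤ ℓ) {v : (ι → ℤ) → ℝ} (hv : ∀ x, 0 ≤ v x) (x : ι → ℤ) :
    0 ≤ sobolevDensity s n ℓ v x :=
  add_nonneg (Finset.sum_nonneg fun _ _ => Real.rpow_nonneg (abs_nonneg _) _)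
    (Real.rpow_nonneg (div_nonneg (hv x) hℓ) _)

/-- Hölder's inequality with exponents `s` and its conjugate `s'`, where the power of `w` is `t/s'`
so that only the sum of `w ^ t` appears. It serves for the gradient of powers, for the flux through
layers and for the degenerate weights. -/
theorem sum_abs_mul_rpow_le {ι : Type*} (S : Finset ι) (g w : ι → ℝ) (hg : ∀ x ∈ S, 0 ≤ g x)
    (hw : ∀ x ∈ S, 0 ≤ w x) {s t E T : ℝ} (hs : 1 < s) (ht : 0 < t)
    (hE : ∑ x ∈ S, g x ^ s ≤ E) (hT : ∑ x ∈ S, w x ^ t ≤ T) :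
    ∑ x ∈ S, g x * w x ^ (t * (1 - 1 / s)) ≤ E ^ (1 / s) * T ^ (1 - 1 / s) := by
  have hc : s.HolderConjugate (s.conjExponent) := Real.HolderConjugate.conjExponent hs
  have hc' : 1 / s.conjExponent = 1 - 1 / s := by
    have := hc.inv_add_inv_eq_one
    simp only [one_div]
    linarith
  have h := Real.inner_le_Lp_mul_Lq_of_nonneg S hc (f := g)
    (g := fun x => w x ^ (t * (1 - 1 / s))) hg (fun x hx => Real.rpow_nonneg (hw x hx) _)
  have h2 : ∀ x ∈ S, (w x ^ (t * (1 - 1 / s))) ^ s.conjExponent = w x ^ t := fun x hx => by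
    rw [← Real.rpow_mul (hw x hx), ← hc']
    congr 1
    have := hc.symm.pos
    field_simp
  rw [Finset.sum_congr rfl h2, hc'] at h
  refine h.trans ?_
  have : 0 ≤ 1 - 1 / s := by rw [← hc']; exact one_div_nonneg.2 hc.symm.pos.le
  have h3 : 0 ≤ ∑ x ∈ S, w x ^ t := Finset.sum_nonneg fun x hx => Real.rpow_nonneg (hw x hx) _
  have h4 : 0 ≤ ∑ x ∈ S, g x ^ s := Finset.sum_nonneg fun x hx => Real.rpow_nonneg (hg x hx) _
  have h5 : 0 ≤ E ^ (1 / s) := Real.rpow_nonneg (h4.trans hE) _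
  gcongr

/-- The chain rule produces `γ - 1` powers of `v` at both ends of a bond, and Hölder's inequality is
applied at each end; this is the origin of the factor `2`. -/
theorem sum_cubeGrad_rpow_le {ι : Type*} [Fintype ι] [DecidableEq ι]
    (n : ℕ) (v : (ι → ℤ) → ℝ) (hv : ∀ x, 0 ≤ v x) {s t γ E : ℝ} (hs : 1 < s) (ht : 0 < t)
    (hγ1 : γ - 1 = t * (1 - 1 / s)) (hγ : 1 ≤ γ) (i : ι)
    (hE : ∑ x ∈ cube ι n, |cubeGrad n v i x| ^ s ≤ E) :
    ∑ x ∈ cube ι n, |cubeGrad n (fun x => v x ^ γ) i x| ≤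
      2 * γ * (E ^ (1 / s) * (∑ x ∈ cube ι n, v x ^ t) ^ (1 - 1 / s)) := by
  set T := ∑ x ∈ cube ι n, v x ^ t with hT
  -- `v` at the far end of the bond. Setting it to zero on the last layer keeps the shifted points
  -- inside the cube, so `w` has no larger `t`-sum than `v`.
  set w : (ι → ℤ) → ℝ := fun x => if x i < n then v (Function.update x i (x i + 1)) else 0 with hw
  have hw0 : ∀ x, 0 ≤ w x := fun x => by
    simp only [hw]; split_ifs
    · exact hv _
    · exact le_rfl
  have hwT : ∑ x ∈ cube ι n, w x ^ t ≤ T := by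
    have h1 : ∑ x ∈ cube ι n, w x ^ t =
        ∑ x ∈ (cube ι n).filter (fun x => x i < (n : ℤ)), v (Function.update x i (x i + 1)) ^ t := by
      rw [Finset.sum_filter]
      refine Finset.sum_congr rfl fun x _ => ?_
      simp only [hw]
      split_ifs
      · rfl
      · exact Real.zero_rpow ht.ne'
    rw [h1, hT, ← Finset.sum_image (g := fun x : ι → ℤ => Function.update x i (x i + 1))
      (f := fun y => v y ^ t)]
    · refine Finset.sum_le_sum_of_subset_of_nonneg ?_ fun x _ _ => Real.rpow_nonneg (hv x) _
      intro y hy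
      obtain ⟨x, hx, rfl⟩ := Finset.mem_image.1 hy
      rw [Finset.mem_filter] at hx
      refine update_mem_cube hx.1 i (Finset.mem_Icc.2 ?_)
      have := mem_cube.1 hx.1 i
      have := hx.2
      omega
    · intro x _ y _ hxy
      have h0 : x i = y i := by
        have := congrFun hxy i
        simpa using this
      funext k
      by_cases hk : k = i
      · rw [hk, h0]
      · have := congrFun hxy k
        simpa [Function.update_of_ne hk] using this
  have h1 := sum_abs_mul_rpow_le (cube ι n) (fun x => |cubeGrad n v i x|) v
    (fun _ _ => abs_nonneg _) (fun x _ => hv x) hs ht hE hT.symm.le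
  have h2 := sum_abs_mul_rpow_le (cube ι n) (fun x => |cubeGrad n v i x|) w
    (fun _ _ => abs_nonneg _) (fun x _ => hw0 x) hs ht hE hwT
  calc ∑ x ∈ cube ι n, |cubeGrad n (fun x => v x ^ γ) i x|
      ≤ ∑ x ∈ cube ι n, γ * (|cubeGrad n v i x| * v x ^ (t * (1 - 1 / s)) +
          |cubeGrad n v i x| * w x ^ (t * (1 - 1 / s))) := by
        refine Finset.sum_le_sum fun x _ => ?_
        by_cases hx : x i < n
        · simp only [cubeGrad, hw, hx, if_true]
          rw [← hγ1]
          refine (abs_rpow_sub_rpow_le (hv _) (hv x) hγ).trans_eq ?_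
          ring
        · simp [cubeGrad, hx]
    _ ≤ _ := by
        rw [← Finset.mul_sum, Finset.sum_add_distrib]
        have : (0 : ℝ) ≤ γ := by linarith
        nlinarith

/-- The Sobolev inequality `W^{1,s} ⊂ ℓ^t`, `1/t = 1/s - 1/D`, on a discrete cube of dimension
`D`. -/
theorem sobolev {ι : Type*} [Fintype ι] [DecidableEq ι] (hι : 2 ≤ Fintype.card ι) {s t : ℝ}
    (hs : 1 < s) (ht : 0 < t) (hst : 1 / t = 1 / s - 1 / Fintype.card ι) :
    ∃ C : ℝ, 0 < C ∧ ∀ (n : ℕ) (v : (ι → ℤ) → ℝ), (∀ x, 0 ≤ v x) →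
      ∑ x ∈ cube ι n, v x ^ t ≤
        C * (∑ x ∈ cube ι n, sobolevDensity s n (2 * n + 1) v x) ^ (t / s) := by
  set D : ℝ := (Fintype.card ι : ℝ) with hD
  have hD2 : (2 : ℝ) ≤ D := by rw [hD]; exact_mod_cast hι
  -- With this `γ`, the `W^{1,1}` inequality for `v ^ γ` has left side `∑ v ^ t`, and `γ - 1 = t (1
  -- - 1/s)` is the power that Hölder's inequality returns to `∑ v ^ t`.
  set γ : ℝ := t * ((D - 1) / D) with hγ
  have hs0 : 0 < s := by linarith
  have hs1 : 1 / s < 1 := by rw [div_lt_one hs0]; exact hs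
  have hγ1 : γ - 1 = t * (1 - 1 / s) := by
    have : 1 / s = 1 / t + 1 / D := by linarith
    rw [hγ, this]; field_simp; ring
  have hγ' : 1 ≤ γ := by
    have : 0 ≤ t * (1 - 1 / s) := mul_nonneg ht.le (by linarith)
    linarith
  -- A term `2 γ` for each of the `D` directions and `1` for the zeroth-order term.
  set C₀ : ℝ := 2 * γ * D + 1 with hC₀
  have hC₀pos : 0 < C₀ := by positivity
  refine ⟨C₀ ^ t, by positivity, fun n v hv => ?_⟩
  set E := ∑ x ∈ cube ι n, sobolevDensity s n (2 * n + 1) v x with hE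
  set S := ∑ x ∈ cube ι n, v x ^ t with hS
  have hS0 : 0 ≤ S := Finset.sum_nonneg fun x _ => Real.rpow_nonneg (hv x) _
  have hE0 : 0 ≤ E := Finset.sum_nonneg fun x _ =>
    sobolevDensity_nonneg (by positivity) hv x
  rcases hS0.eq_or_lt with hS00 | hSpos
  · rw [← hS00]; positivity
  have hEi : ∀ i, ∑ x ∈ cube ι n, |cubeGrad n v i x| ^ s ≤ E := fun i => by
    refine Finset.sum_le_sum fun x _ => ?_
    have h1 : 0 ≤ (v x / (2 * n + 1)) ^ s := Real.rpow_nonneg (div_nonneg (hv x) (by positivity)) _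
    have h2 := Finset.single_le_sum (f := fun i => |cubeGrad n v i x| ^ s)
      (fun i _ => Real.rpow_nonneg (abs_nonneg _) _) (Finset.mem_univ i)
    simp only [sobolevDensity]
    linarith
  have hEv : ∑ x ∈ cube ι n, (v x / (2 * n + 1)) ^ s ≤ E := by
    refine Finset.sum_le_sum fun x _ => ?_
    have h2 : 0 ≤ ∑ i, |cubeGrad n v i x| ^ s :=
      Finset.sum_nonneg fun i _ => Real.rpow_nonneg (abs_nonneg _) _
    simp only [sobolevDensity]
    linarith
  set X := E ^ (1 / s) * S ^ (1 - 1 / s) with hX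
  have hgrad := fun i => sum_cubeGrad_rpow_le n v hv hs ht hγ1 hγ' i (hEi i)
  have hlow : ∑ x ∈ cube ι n, v x ^ γ / (2 * n + 1) ≤ X := by
    refine le_trans (Finset.sum_le_sum fun x _ => ?_) (sum_abs_mul_rpow_le (cube ι n)
      (fun x => v x / (2 * n + 1)) v (fun x _ => div_nonneg (hv x) (by positivity))
      (fun x _ => hv x) hs ht hEv hS.symm.le)
    rw [← hγ1, div_mul_eq_mul_div, ← Real.rpow_one_add' (hv x) (by linarith), add_sub_cancel]
  have hone := sobolev_one hι n (fun x => v x ^ γ) (fun x => Real.rpow_nonneg (hv x) _)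
  have hpow : ∀ x ∈ cube ι n, (v x ^ γ) ^ (D / (D - 1)) = v x ^ t := fun x _ => by
    rw [← Real.rpow_mul (hv x)]
    congr 1
    rw [hγ]
    have : D - 1 ≠ 0 := by linarith
    field_simp
  rw [Finset.sum_congr rfl hpow, ← hS, Finset.sum_add_distrib, Finset.sum_comm] at hone
  have hY : ∑ i : ι, ∑ x ∈ cube ι n, |cubeGrad n (fun x => v x ^ γ) i x| +
      ∑ x ∈ cube ι n, v x ^ γ / (2 * n + 1) ≤ C₀ * X := by
    have := Finset.sum_le_sum fun i (_ : i ∈ Finset.univ) => hgrad i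
    rw [Finset.sum_const, Finset.card_univ, nsmul_eq_mul, ← hD, ← hX] at this
    rw [hC₀]
    linarith
  have hX0 : 0 ≤ X := by positivity
  have hSle : S ≤ (C₀ * X) ^ (D / (D - 1)) := hone.trans (Real.rpow_le_rpow
    (add_nonneg (Finset.sum_nonneg fun i _ => Finset.sum_nonneg fun x _ => abs_nonneg _)
      (Finset.sum_nonneg fun x _ => div_nonneg (Real.rpow_nonneg (hv x) _) (by positivity))) hY
    (by apply div_nonneg <;> linarith))
  have h5 : S ^ ((D - 1) / D) ≤ C₀ * X := by
    have := Real.rpow_le_rpow hS0 hSle (z := (D - 1) / D) (by apply div_nonneg <;> linarith)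
    rwa [← Real.rpow_mul (by positivity), div_mul_div_cancel₀ (by linarith), div_self (by linarith),
      Real.rpow_one] at this
  -- Absorption: a power of `S` on the right is divided out, which needs `S > 0`; what remains on
  -- the left is `(D-1)/D - (1 - 1/s) = 1/t`.
  have h6 : S ^ (1 / t) ≤ C₀ * E ^ (1 / s) := by
    have he : 1 / t = (D - 1) / D - (1 - 1 / s) := by rw [hst]; field_simp; ring
    rw [he, Real.rpow_sub hSpos, div_le_iff₀ (by positivity), mul_assoc]
    exact h5
  have h7 := Real.rpow_le_rpow (by positivity) h6 ht.le
  rw [← Real.rpow_mul hS0, one_div_mul_cancel ht.ne', Real.rpow_one,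
    Real.mul_rpow hC₀pos.le (by positivity), ← Real.rpow_mul hE0] at h7
  rwa [show 1 / s * t = t / s by ring] at h7

theorem sum_cube_sum_update {ι : Type*} [Fintype ι] [DecidableEq ι] (n : ℕ) (i : ι)
    (g : (ι → ℤ) → ℝ) :
    ∑ x ∈ cube ι n, ∑ t ∈ Finset.Icc (-(n : ℤ)) n, g (Function.update x i t) =
      (2 * n + 1) * ∑ x ∈ cube ι n, g x := by
  have hc : (Finset.Icc (-(n : ℤ)) n).card = 2 * n + 1 := by
    simp only [Int.card_Icc]; omega
  have h : (2 * (n : ℝ) + 1) * ∑ x ∈ cube ι n, g x =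
      ∑ x ∈ cube ι n, ∑ _t ∈ Finset.Icc (-(n : ℤ)) n, g x := by
    simp only [Finset.sum_const, hc, nsmul_eq_mul, Finset.mul_sum]
    push_cast
    rfl
  rw [h, ← Finset.sum_product', ← Finset.sum_product']
  -- The map `(x, t) ↦ (update x i t, x i)` is an involution of the index set.
  refine Finset.sum_nbij' (fun a => (Function.update a.1 i a.2, a.1 i))
    (fun a => (Function.update a.1 i a.2, a.1 i)) ?_ ?_ ?_ ?_ ?_
  · intro a ha
    rw [Finset.mem_product] at ha ⊢
    exact ⟨update_mem_cube ha.1 i ha.2, Finset.mem_Icc.2 (mem_cube.1 ha.1 i)⟩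
  · intro a ha
    rw [Finset.mem_product] at ha ⊢
    exact ⟨update_mem_cube ha.1 i ha.2, Finset.mem_Icc.2 (mem_cube.1 ha.1 i)⟩
  · intro a _; simp
  · intro a _; simp
  · intro a _; simp

/-- The sum along a line of the `s`-th powers controls the `s`-th power of the sum. -/
theorem sum_Icc_rpow_le (n : ℕ) {s : ℝ} (hs : 1 ≤ s) (g : ℤ → ℝ) (hg : ∀ t, 0 ≤ g t) :
    (∑ t ∈ Finset.Icc (-(n : ℤ)) n, g t) ^ s ≤
      (2 * n + 1) ^ (s - 1) * ∑ t ∈ Finset.Icc (-(n : ℤ)) n, g t ^ s := by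
  have hc : (Finset.Icc (-(n : ℤ)) n).card = 2 * n + 1 := by
    simp only [Int.card_Icc]; omega
  have := Real.rpow_sum_le_const_mul_sum_rpow_of_nonneg (Finset.Icc (-(n : ℤ)) n) hs
    (f := g) (fun t _ => hg t)
  rw [hc] at this
  exact_mod_cast this

/-- The Friedrichs inequality for functions vanishing near the boundary of a cube. -/
theorem friedrichs {ι : Type*} [Fintype ι] [DecidableEq ι] (n : ℕ) {s : ℝ} (hs : 1 ≤ s)
    (w : (ι → ℤ) → ℝ) (i : ι) (hw : ∀ x, x i = (n : ℤ) → w x = 0) :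
    ∑ x ∈ cube ι n, |w x| ^ s ≤
      (2 * n + 1) ^ s * ∑ x ∈ cube ι n, |cubeGrad n w i x| ^ s := by
  have h1 : ∀ x ∈ cube ι n, |w x| ^ s ≤ (2 * n + 1) ^ (s - 1) *
      ∑ t ∈ Finset.Icc (-(n : ℤ)) n, |cubeGrad n w i (Function.update x i t)| ^ s := by
    intro x hx
    -- Compare with the end `x i = n` of the line, where `w` vanishes.
    have h := abs_sub_update_le_sum_cubeGrad n w hx i (b := (n : ℤ)) (by simp)
    rw [hw (Function.update x i (n : ℤ)) (Function.update_self ..), sub_zero] at h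
    exact (Real.rpow_le_rpow (abs_nonneg _) h (by linarith)).trans
      (sum_Icc_rpow_le n hs _ fun _ => abs_nonneg _)
  refine (Finset.sum_le_sum h1).trans_eq ?_
  rw [← Finset.mul_sum, sum_cube_sum_update n i (fun x => |cubeGrad n w i x| ^ s), ← mul_assoc]
  congr 1
  have : (0 : ℝ) < 2 * n + 1 := by positivity
  rw [Real.rpow_sub this, Real.rpow_one]
  field_simp

/-! ### Slicing a cube into hyperplane layers -/

/-- The point of the layer `{x i = τ}` with remaining coordinates `y`. -/
def layerPt {D : ℕ} (i : Fin (D + 1)) (τ : ℤ) (y : Fin D → ℤ) : Fin (D + 1) → ℤ :=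
  i.insertNth (α := fun _ => ℤ) τ y

@[simp] theorem layerPt_same {D : ℕ} (i : Fin (D + 1)) (τ : ℤ) (y : Fin D → ℤ) :
    layerPt i τ y i = τ := by simp [layerPt]

@[simp] theorem layerPt_succAbove {D : ℕ} (i : Fin (D + 1)) (τ : ℤ) (y : Fin D → ℤ) (k : Fin D) :
    layerPt i τ y (i.succAbove k) = y k := by simp [layerPt]

theorem layerPt_update {D : ℕ} (i : Fin (D + 1)) (τ : ℤ) (y : Fin D → ℤ) (k : Fin D) (a : ℤ) :
    layerPt i τ (Function.update y k a) =
      Function.update (layerPt i τ y) (i.succAbove k) a := by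
  funext j
  rcases Fin.eq_self_or_eq_succAbove i j with rfl | ⟨l, rfl⟩
  · rw [Function.update_of_ne (Fin.succAbove_ne _ _).symm]; simp
  · by_cases h : l = k
    · subst h; simp
    · rw [Function.update_of_ne (fun h' => h (Fin.succAbove_right_injective h'))]
      simp [h]

theorem sum_cube_eq_sum_layer {D : ℕ} (n : ℕ) (i : Fin (D + 1)) (g : (Fin (D + 1) → ℤ) → ℝ) :
    ∑ x ∈ cube (Fin (D + 1)) n, g x =
      ∑ τ ∈ Finset.Icc (-(n : ℤ)) n, ∑ y ∈ cube (Fin D) n, g (layerPt i τ y) := by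
  rw [← Finset.sum_product']
  symm
  refine Finset.sum_nbij' (fun a => layerPt i a.1 a.2)
    (fun x => (x i, fun k => x (i.succAbove k))) ?_ ?_ ?_ ?_ ?_
  · intro a ha
    rw [Finset.mem_product] at ha
    rw [mem_cube]
    intro j
    rcases Fin.eq_self_or_eq_succAbove i j with rfl | ⟨l, rfl⟩
    · simpa using Finset.mem_Icc.1 ha.1
    · simpa using mem_cube.1 ha.2 l
  · intro x hx
    rw [mem_cube] at hx
    rw [Finset.mem_product]
    exact ⟨Finset.mem_Icc.2 (hx i), mem_cube.2 fun k => hx _⟩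
  · intro a _; simp
  · intro x _
    funext j
    rcases Fin.eq_self_or_eq_succAbove i j with rfl | ⟨l, rfl⟩ <;> simp
  · intro a _; rfl

/-- The restriction to a layer keeps the tangential increments and drops the normal one. The passage
from `ℓ` to `ℓ'` replaces the fixed scale `R` by the side length that the Sobolev inequality on the
layer uses. -/
theorem sobolevDensity_layer_le {D : ℕ} {s : ℝ} (hs : 0 ≤ s) (n : ℕ) {ℓ ℓ' : ℝ} (hℓ : 0 < ℓ)
    (hℓ' : ℓ ≤ ℓ') (v : (Fin (D + 1) → ℤ) → ℝ) (hv : ∀ x, 0 ≤ v x) (i : Fin (D + 1)) (τ : ℤ)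
    (y : Fin D → ℤ) :
    sobolevDensity s n ℓ' (fun y => v (layerPt i τ y)) y ≤
      sobolevDensity s n ℓ v (layerPt i τ y) := by
  have h1 : ∀ k, cubeGrad n (fun y => v (layerPt i τ y)) k y =
      cubeGrad n v (i.succAbove k) (layerPt i τ y) := fun k => by
    simp [cubeGrad, layerPt_update]
  simp only [sobolevDensity, h1]
  rw [Fin.sum_univ_succAbove (fun j => |cubeGrad n v j (layerPt i τ y)| ^ s) i]
  have h2 : 0 ≤ |cubeGrad n v i (layerPt i τ y)| ^ s := Real.rpow_nonneg (abs_nonneg _) _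
  have h3 : (v (layerPt i τ y) / ℓ') ^ s ≤ (v (layerPt i τ y) / ℓ) ^ s :=
    Real.rpow_le_rpow (div_nonneg (hv _) (by linarith))
      (div_le_div_of_nonneg_left (hv _) hℓ hℓ') hs
  linarith

/-- Hölder's inequality for the flux of `c` through the bonds between two layers. -/
theorem layer_flux_le {ι : Type*} (S : Finset ι) (c a b a' b' : ι → ℝ) (hc : ∀ y, 0 ≤ c y)
    (ha : ∀ y, 0 ≤ a y) (hb : ∀ y, 0 ≤ b y) (ha' : ∀ y, 0 ≤ a' y) (hb' : ∀ y, 0 ≤ b' y)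
    {p t χ A W T : ℝ} (hp : 1 < p) (hA : 0 ≤ A) (ht : 0 < t)
    (hχ : 2 * χ = t * (1 - 1 / p)) (haa : ∀ y, a y ≤ A * a' y ^ χ) (hbb : ∀ y, b y ≤ A * b' y ^ χ)
    (hW : ∑ y ∈ S, c y ^ p ≤ W) (hTa : ∑ y ∈ S, a' y ^ t ≤ T) (hTb : ∑ y ∈ S, b' y ^ t ≤ T) :
    ∑ y ∈ S, c y * (a y * b y) ≤ A ^ 2 * (W ^ (1 / p) * (2 * T) ^ (1 - 1 / p)) := by
  -- Both factors are dominated by `A * m ^ χ`, so a single Hölder inequality with `m ^ (2 χ)`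
  -- suffices; the price is `2 T` in place of `T`.
  set m : ι → ℝ := fun y => max (a' y) (b' y) with hm
  have hm0 : ∀ y, 0 ≤ m y := fun y => (ha' y).trans (le_max_left _ _)
  have h1 := sum_abs_mul_rpow_le S c m (fun y _ => hc y) (fun y _ => hm0 y) hp ht hW
    (T := 2 * T) (by
      calc ∑ y ∈ S, m y ^ t ≤ ∑ y ∈ S, (a' y ^ t + b' y ^ t) := by
            refine Finset.sum_le_sum fun y _ => ?_
            rcases max_choice (a' y) (b' y) with h | h
            · simp only [hm, h]; linarith [Real.rpow_nonneg (hb' y) t]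
            · simp only [hm, h]; linarith [Real.rpow_nonneg (ha' y) t]
        _ ≤ _ := by rw [Finset.sum_add_distrib]; linarith)
  have hχ0 : 0 < χ := by
    have : 1 / p < 1 := by rw [div_lt_one (by linarith)]; exact hp
    nlinarith
  calc ∑ y ∈ S, c y * (a y * b y) ≤ ∑ y ∈ S, A ^ 2 * (c y * m y ^ (t * (1 - 1 / p))) := by
        refine Finset.sum_le_sum fun y _ => ?_
        have h2 : a y ≤ A * m y ^ χ := (haa y).trans (mul_le_mul_of_nonneg_left
          (Real.rpow_le_rpow (ha' y) (le_max_left _ _) hχ0.le) hA)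
        have h3 : b y ≤ A * m y ^ χ := (hbb y).trans (mul_le_mul_of_nonneg_left
          (Real.rpow_le_rpow (hb' y) (le_max_right _ _) hχ0.le) hA)
        have h4 : m y ^ (t * (1 - 1 / p)) = m y ^ χ * m y ^ χ := by
          rw [← Real.rpow_add_of_nonneg (hm0 y) hχ0.le hχ0.le, ← hχ, two_mul]
        rw [h4]
        have h5 := mul_le_mul h2 h3 (hb y) ((ha y).trans h2)
        calc c y * (a y * b y) ≤ c y * (A * m y ^ χ * (A * m y ^ χ)) :=
              mul_le_mul_of_nonneg_left h5 (hc y)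
          _ = _ := by ring
    _ ≤ _ := by
        rw [← Finset.mul_sum]
        exact mul_le_mul_of_nonneg_left h1 (by positivity)

/-! ### Harmonic functions and the Caccioppoli inequality -/

/-- `u` is harmonic at `x` for the conductances `c i x` of the bonds `{x, x + eᵢ}`. -/
def HarmonicAt {ι : Type*} [Fintype ι] [DecidableEq ι] (c : ι → (ι → ℤ) → ℝ) (u : (ι → ℤ) → ℝ)
    (x : ι → ℤ) : Prop :=
  ∑ i, (c i x * (u (x + Pi.single i 1) - u x) +
    c i (x - Pi.single i 1) * (u (x - Pi.single i 1) - u x)) = 0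

theorem sum_shift_eq {ι : Type*} [DecidableEq ι] (S : Finset (ι → ℤ)) (f : (ι → ℤ) → ℝ)
    (e : ι → ℤ) (h : ∀ x, f x ≠ 0 → x ∈ S ∧ x - e ∈ S) :
    ∑ x ∈ S, f (x + e) = ∑ x ∈ S, f x := by
  refine Finset.sum_bij_ne_zero (fun x _ _ => x + e) ?_ ?_ ?_ ?_
  · intro x _ hx
    exact (h _ hx).1
  · intro x _ _ y _ _ hxy
    exact add_right_cancel hxy
  · intro y hy hy0
    exact ⟨y - e, (h y hy0).2, by simpa using hy0, by simp⟩
  · intro x _ _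
    rfl

theorem sub_single_mem_cube {ι : Type*} [Fintype ι] [DecidableEq ι] {n : ℕ} {x : ι → ℤ}
    (hx : ∀ i, |x i| < n) (i : ι) : x ∈ cube ι n ∧ x - Pi.single i 1 ∈ cube ι n := by
  constructor
  · rw [mem_cube]
    intro k
    have := abs_lt.1 (hx k)
    omega
  · rw [mem_cube]
    intro k
    have := abs_lt.1 (hx k)
    by_cases h : k = i
    · subst h; simp; omega
    · simp [h]; omega

/-- Summation by parts against a function supported in the interior of a cube. -/
theorem sum_parts_eq_zero {ι : Type*} [Fintype ι] [DecidableEq ι] (c : ι → (ι → ℤ) → ℝ)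
    (u a : (ι → ℤ) → ℝ) (n : ℕ) (hu : ∀ x, HarmonicAt c u x)
    (ha : ∀ x, a x ≠ 0 → ∀ i, |x i| < n) :
    ∑ i, ∑ x ∈ cube ι n, c i x * (u (x + Pi.single i 1) - u x) *
      (a (x + Pi.single i 1) - a x) = 0 := by
  have h1 : ∀ i, ∑ x ∈ cube ι n, c i x * (u (x + Pi.single i 1) - u x) *
      (a (x + Pi.single i 1) - a x) = - ∑ x ∈ cube ι n,
        (c i x * (u (x + Pi.single i 1) - u x) +
          c i (x - Pi.single i 1) * (u (x - Pi.single i 1) - u x)) * a x := by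
    intro i
    -- The terms with `a (x + eᵢ)` are moved back by one step; the support of `a` stays away from
    -- the boundary, so nothing is lost.
    have h2 := sum_shift_eq (cube ι n)
      (fun x => c i (x - Pi.single i 1) * (u x - u (x - Pi.single i 1)) * a x) (Pi.single i 1)
      (fun x hx => sub_single_mem_cube (ha x (right_ne_zero_of_mul hx)) i)
    simp only [add_sub_cancel_right] at h2
    simp only [mul_sub (c i _ * (_ : ℝ)), Finset.sum_sub_distrib, h2]
    rw [← Finset.sum_sub_distrib, ← Finset.sum_neg_distrib]
    exact Finset.sum_congr rfl fun x _ => by ring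
  rw [Finset.sum_congr rfl fun i _ => h1 i, Finset.sum_neg_distrib, Finset.sum_comm, neg_eq_zero]
  refine Finset.sum_eq_zero fun x _ => ?_
  rw [← Finset.sum_mul]
  exact mul_eq_zero_of_left (hu x) _

/-- The Caccioppoli inequality for the positive part `(u - k)₊` of a harmonic function. -/
theorem caccioppoli {ι : Type*} [Fintype ι] [DecidableEq ι] (c : ι → (ι → ℤ) → ℝ)
    (hc : ∀ i x, 0 ≤ c i x) (u η : (ι → ℤ) → ℝ) (k : ℝ) (n : ℕ) (hu : ∀ x, HarmonicAt c u x)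
    (hη : ∀ x, η x ≠ 0 → ∀ i, |x i| < n) :
    ∑ i, ∑ x ∈ cube ι n, c i x * (η (x + Pi.single i 1) * max (u (x + Pi.single i 1) - k) 0 -
        η x * max (u x - k) 0) ^ 2 ≤
      ∑ i, ∑ x ∈ cube ι n, c i x * (max (u x - k) 0 * max (u (x + Pi.single i 1) - k) 0) *
        (η (x + Pi.single i 1) - η x) ^ 2 := by
  -- Harmonicity tested with `η² (u - k)₊`.
  have h0 := sum_parts_eq_zero c u (fun x => η x ^ 2 * max (u x - k) 0) n hu (fun x hx =>
    hη x (by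
      intro h; simp [h] at hx))
  refine le_of_le_of_eq ?_ ((congrArg (_ + ·) h0).trans (add_zero _))
  rw [← Finset.sum_add_distrib]
  refine Finset.sum_le_sum fun i _ => ?_
  rw [← Finset.sum_add_distrib]
  refine Finset.sum_le_sum fun x _ => ?_
  set α := u x - k with hα
  set β := u (x + Pi.single i 1) - k with hβ
  have e1 : u (x + Pi.single i 1) - u x = β - α := by rw [hα, hβ]; ring
  rw [e1, mul_assoc (c i x), mul_assoc (c i x), ← mul_add]
  refine mul_le_mul_of_nonneg_left ?_ (hc i x)
  set m := η (x + Pi.single i 1)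
  set l := η x
  -- If `α, β ≥ 0`, the claim is the identity `(mβ - lα)² = αβ(m - l)² + (β - α)(m²β - l²α)`; in the
  -- other cases a truncation vanishes. The product `αβ`, rather than squares, makes the right side
  -- a flux across the bond.
  rcases le_total α 0 with h | h <;> rcases le_total β 0 with h' | h' <;>
    simp only [max_eq_left, max_eq_right, h, h']
  · simp
  · nlinarith [sq_nonneg m, mul_nonneg (sq_nonneg m) h']
  · nlinarith [sq_nonneg l, mul_nonneg (sq_nonneg l) h]
  · nlinarith

/-! ### Good layers and the cutoff adapted to them -/

/-- Markov's inequality for two sequences: at least half of the indices are good for both. -/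
theorem exists_good_subset (I : Finset ℕ) (a b : ℕ → ℝ) (ha : ∀ t, 0 ≤ a t)
    (hb : ∀ t, 0 ≤ b t) {A B : ℝ} (hA : ∑ t ∈ I, a t ≤ A) (hB : ∑ t ∈ I, b t ≤ B) :
    ∃ G ⊆ I, (I.card : ℝ) ≤ 2 * G.card ∧
      ∀ t ∈ G, a t ≤ 4 * A / I.card ∧ b t ≤ 4 * B / I.card := by
  -- Above the threshold `4A/|I|` lies at most a quarter of the indices. Two such exceptional sets
  -- leave at least half.
  have bad : ∀ (a : ℕ → ℝ), (∀ t, 0 ≤ a t) → ∀ A, ∑ t ∈ I, a t ≤ A →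
      4 * ((I.filter fun t => 4 * A / I.card < a t).card : ℝ) ≤ I.card := by
    intro a ha A hA
    set F := I.filter fun t => 4 * A / I.card < a t with hF
    rcases F.eq_empty_or_nonempty with h | ⟨t₀, ht₀⟩
    · rw [h]; simp
    · have h1 : (F.card : ℝ) * (4 * A / I.card) ≤ A := by
        rw [← nsmul_eq_mul]
        refine (Finset.card_nsmul_le_sum F a _ fun t ht => (Finset.mem_filter.1 ht).2.le).trans ?_
        exact (Finset.sum_le_sum_of_subset_of_nonneg (Finset.filter_subset _ _)
          fun t _ _ => ha t).trans hA
      have hI : (0 : ℝ) < I.card := by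
        exact_mod_cast Finset.card_pos.2 ⟨t₀, (Finset.mem_filter.1 ht₀).1⟩
      have hA0 : 0 < A := by
        have h2 := (Finset.mem_filter.1 ht₀).2
        have h3 := (Finset.single_le_sum (fun t _ => ha t) (Finset.mem_filter.1 ht₀).1).trans hA
        have h4 : 0 ≤ A := (ha t₀).trans h3
        have h5 : 0 ≤ 4 * A / I.card := by positivity
        linarith
      rw [mul_div_assoc', div_le_iff₀ hI] at h1
      nlinarith
  refine ⟨(I.filter fun t => ¬ 4 * A / I.card < a t).filter fun t => ¬ 4 * B / I.card < b t,
    (Finset.filter_subset _ _).trans (Finset.filter_subset _ _), ?_, ?_⟩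
  · have h1 := bad a ha A hA
    have h2 := bad b hb B hB
    have h3 := Finset.card_filter_add_card_filter_not (s := I) fun t => 4 * A / I.card < a t
    have h4 := Finset.card_filter_add_card_filter_not
      (s := I.filter fun t => ¬ 4 * A / I.card < a t) fun t => 4 * B / I.card < b t
    have h5 : ((I.filter fun t => ¬ 4 * A / I.card < a t).filter
        fun t => 4 * B / I.card < b t).card ≤ (I.filter fun t => 4 * B / I.card < b t).card :=
      Finset.card_le_card (Finset.filter_subset_filter _ (Finset.filter_subset _ _))
    have h3' : ((I.filter fun t => 4 * A / I.card < a t).card : ℝ) +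
      (I.filter fun t => ¬ 4 * A / I.card < a t).card = I.card := by exact_mod_cast h3
    have h4' : (((I.filter fun t => ¬ 4 * A / I.card < a t).filter
        fun t => 4 * B / I.card < b t).card : ℝ) + ((I.filter fun t => ¬ 4 * A / I.card < a t).filter
        fun t => ¬ 4 * B / I.card < b t).card =
        (I.filter fun t => ¬ 4 * A / I.card < a t).card := by exact_mod_cast h4
    have h5' : (((I.filter fun t => ¬ 4 * A / I.card < a t).filter
        fun t => 4 * B / I.card < b t).card : ℝ) ≤
        (I.filter fun t => 4 * B / I.card < b t).card := by exact_mod_cast h5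
    linarith
  · intro t ht
    simp only [Finset.mem_filter, not_lt] at ht
    exact ⟨ht.1.2, ht.2⟩

/-- The level `t` stands for the two bonds `{t, t+1}` and `{-t-1, -t}` of a coordinate axis, whose
ends are these four layers. Each layer is met at most once by each of the four maps. -/
theorem sum_layers_le (n : ℕ) (I : Finset ℕ) (hI : ∀ t ∈ I, t < n) (h : ℤ → ℝ)
    (hh : ∀ τ, 0 ≤ h τ) :
    ∑ t ∈ I, (h t + h (t + 1) + h (-t) + h (-t - 1)) ≤
      4 * ∑ τ ∈ Finset.Icc (-(n : ℤ)) n, h τ := by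
  have key : ∀ φ : ℕ → ℤ, Function.Injective φ → (∀ t ∈ I, φ t ∈ Finset.Icc (-(n : ℤ)) n) →
      ∑ t ∈ I, h (φ t) ≤ ∑ τ ∈ Finset.Icc (-(n : ℤ)) n, h τ := by
    intro φ hφ hφI
    rw [← Finset.sum_image (g := φ) (f := h) fun x _ y _ hxy => hφ hxy]
    refine Finset.sum_le_sum_of_subset_of_nonneg ?_ fun τ _ _ => hh τ
    intro y hy
    obtain ⟨t, ht, rfl⟩ := Finset.mem_image.1 hy
    exact hφI t ht
  simp only [Finset.sum_add_distrib]
  have h1 := key (fun t => t) (fun a b hab => by simpa using hab)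
    (fun t ht => by have := hI t ht; rw [Finset.mem_Icc]; omega)
  have h2 := key (fun t => t + 1) (fun a b hab => by simpa using hab)
    (fun t ht => by have := hI t ht; rw [Finset.mem_Icc]; omega)
  have h3 := key (fun t => -t) (fun a b hab => by simpa using hab)
    (fun t ht => by have := hI t ht; rw [Finset.mem_Icc]; omega)
  have h4 := key (fun t => -t - 1) (fun a b hab => by simpa using hab)
    (fun t ht => by have := hI t ht; rw [Finset.mem_Icc]; omega)
  linarith

/-- The nonincreasing profile which drops by `1/|G|` at each element of `G`. -/
noncomputable def dropProfile (G : Finset ℕ) (m : ℕ) : ℝ :=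
  ((G.filter fun t => m ≤ t).card : ℝ) / G.card

theorem dropProfile_nonneg (G : Finset ℕ) (m : ℕ) : 0 ≤ dropProfile G m := by
  unfold dropProfile; positivity

theorem dropProfile_le_one (G : Finset ℕ) (m : ℕ) : dropProfile G m ≤ 1 := by
  unfold dropProfile
  refine div_le_one_of_le₀ ?_ (by positivity)
  exact_mod_cast Finset.card_le_card (Finset.filter_subset _ _)

theorem dropProfile_sub_succ (G : Finset ℕ) (m : ℕ) :
    dropProfile G m - dropProfile G (m + 1) = if m ∈ G then 1 / (G.card : ℝ) else 0 := by
  unfold dropProfile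
  rw [← sub_div]
  have : (G.filter fun t => m ≤ t).card =
      (G.filter fun t => m + 1 ≤ t).card + if m ∈ G then 1 else 0 := by
    have h1 : (G.filter fun t => m ≤ t) =
        (G.filter fun t => m + 1 ≤ t) ∪ (G.filter fun t => t = m) := by
      ext t; simp only [Finset.mem_filter, Finset.mem_union]; grind
    rw [h1, Finset.card_union_of_disjoint]
    · congr 1
      rw [Finset.filter_eq']
      split_ifs <;> simp
    · rw [Finset.disjoint_filter]
      intro t _ h2 h3
      omega
  rw [this]
  push_cast
  split_ifs <;> simp

theorem dropProfile_eq_one {G : Finset ℕ} (hG : G.Nonempty) {m : ℕ} (h : ∀ t ∈ G, m ≤ t) :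
    dropProfile G m = 1 := by
  unfold dropProfile
  rw [Finset.filter_true_of_mem h]
  exact div_self (by exact_mod_cast (Finset.card_pos.2 hG).ne')

theorem dropProfile_eq_zero {G : Finset ℕ} {m : ℕ} (h : ∀ t ∈ G, t < m) :
    dropProfile G m = 0 := by
  unfold dropProfile
  rw [Finset.filter_false_of_mem (fun t ht => not_le.2 (h t ht))]
  simp

/-- The smaller absolute value of the endpoints of the bond `{τ, τ + 1}` of `ℤ`. -/
def bondLevel (τ : ℤ) : ℕ := if 0 ≤ τ then τ.toNat else (-τ - 1).toNat

/-- The cutoff changes only across bonds with level in `G`. Concentrating its slope there is what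
avoids the bad layers. -/
theorem sq_dropProfile_sub (G : Finset ℕ) (τ : ℤ) :
    (dropProfile G (τ + 1).natAbs - dropProfile G τ.natAbs) ^ 2 =
      if bondLevel τ ∈ G then 1 / (G.card : ℝ) ^ 2 else 0 := by
  have key : (dropProfile G (τ + 1).natAbs - dropProfile G τ.natAbs) ^ 2 =
      (dropProfile G (bondLevel τ) - dropProfile G (bondLevel τ + 1)) ^ 2 := by
    unfold bondLevel
    split_ifs with h
    · rw [show (τ + 1).natAbs = τ.toNat + 1 by omega, show τ.natAbs = τ.toNat by omega]
      ring
    · rw [show (τ + 1).natAbs = (-τ - 1).toNat by omega,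
        show τ.natAbs = (-τ - 1).toNat + 1 by omega]
  rw [key, dropProfile_sub_succ]
  split_ifs <;> simp

/-- The cutoff function with profile `dropProfile G` in each coordinate. -/
noncomputable def cutoff {ι : Type*} [Fintype ι] (G : Finset ℕ) (x : ι → ℤ) : ℝ :=
  ∏ i, dropProfile G (x i).natAbs

theorem cutoff_eq_one {ι : Type*} [Fintype ι] [DecidableEq ι] {G : Finset ℕ} (hG : G.Nonempty)
    {m : ℕ} (h : ∀ t ∈ G, m ≤ t) {x : ι → ℤ} (hx : x ∈ cube ι m) : cutoff G x = 1 := by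
  refine Finset.prod_eq_one fun i _ => dropProfile_eq_one hG fun t ht => ?_
  have := mem_cube.1 hx i
  have := h t ht
  omega

theorem abs_lt_of_cutoff_ne_zero {ι : Type*} [Fintype ι] {G : Finset ℕ}
    {m : ℕ} (h : ∀ t ∈ G, t < m) {x : ι → ℤ} (hx : cutoff G x ≠ 0) (i : ι) : |x i| < m := by
  by_contra hi
  refine hx (Finset.prod_eq_zero (Finset.mem_univ i) (dropProfile_eq_zero fun t ht => ?_))
  have := h t ht
  rw [not_lt, Int.abs_eq_natAbs] at hi
  omega

/-- Only the `i`-th factor of the product changes, and the remaining factors lie in `[0, 1]`. -/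
theorem sq_cutoff_sub_le {ι : Type*} [Fintype ι] [DecidableEq ι] (G : Finset ℕ) (x : ι → ℤ)
    (i : ι) :
    (cutoff G (x + Pi.single i 1) - cutoff G x) ^ 2 ≤
      if bondLevel (x i) ∈ G then 1 / (G.card : ℝ) ^ 2 else 0 := by
  rw [← sq_dropProfile_sub]
  set P := ∏ j ∈ Finset.univ.erase i, dropProfile G (x j).natAbs with hP
  have h1 : cutoff G x = dropProfile G (x i).natAbs * P :=
    (Finset.mul_prod_erase _ _ (Finset.mem_univ i)).symm
  have h2 : cutoff G (x + Pi.single i 1) = dropProfile G (x i + 1).natAbs * P := by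
    unfold cutoff
    rw [← Finset.mul_prod_erase _ _ (Finset.mem_univ i)]
    congr 1
    · simp
    · refine Finset.prod_congr rfl fun j hj => ?_
      simp [Pi.single_eq_of_ne (Finset.ne_of_mem_erase hj)]
  have hP0 : 0 ≤ P := Finset.prod_nonneg fun _ _ => dropProfile_nonneg _ _
  have hP1 : P ≤ 1 := Finset.prod_le_one (fun _ _ => dropProfile_nonneg _ _)
    fun _ _ => dropProfile_le_one _ _
  rw [h1, h2, ← sub_mul, mul_pow]
  exact mul_le_of_le_one_right (sq_nonneg _) (pow_le_one₀ hP0 hP1)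

theorem layerPt_add_single {D : ℕ} (i : Fin (D + 1)) (τ : ℤ) (y : Fin D → ℤ) :
    layerPt i τ y + Pi.single i 1 = layerPt i (τ + 1) y := by
  funext j
  rcases Fin.eq_self_or_eq_succAbove i j with rfl | ⟨l, rfl⟩ <;> simp

/-- The flux term of the Caccioppoli inequality for the optimized cutoff. -/
theorem sum_flux_le {D : ℕ} (c : Fin (D + 1) → (Fin (D + 1) → ℤ) → ℝ) (hc : ∀ i x, 0 ≤ c i x)
    (v : (Fin (D + 1) → ℤ) → ℝ) (hv : ∀ x, 0 ≤ v x) (n : ℕ) (G : Finset ℕ)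
    (hG : G.Nonempty) {M : ℝ}
    (hM : ∀ i τ, bondLevel τ ∈ G → ∑ y ∈ cube (Fin D) n,
      c i (layerPt i τ y) * (v (layerPt i τ y) * v (layerPt i (τ + 1) y)) ≤ M) :
    ∑ i, ∑ x ∈ cube (Fin (D + 1)) n, c i x * (v x * v (x + Pi.single i 1)) *
      (cutoff G (x + Pi.single i 1) - cutoff G x) ^ 2 ≤ (D + 1) * (2 * M / G.card) := by
  have hcard : (0 : ℝ) < G.card := by exact_mod_cast Finset.card_pos.2 hG
  have hM0 : 0 ≤ M := by
    obtain ⟨t, ht⟩ := hG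
    refine le_trans (Finset.sum_nonneg fun y _ => ?_) (hM 0 t (by simpa [bondLevel] using ht))
    exact mul_nonneg (hc _ _) (mul_nonneg (hv _) (hv _))
  have key : ∀ i, ∑ x ∈ cube (Fin (D + 1)) n, c i x * (v x * v (x + Pi.single i 1)) *
      (cutoff G (x + Pi.single i 1) - cutoff G x) ^ 2 ≤ 2 * M / G.card := by
    intro i
    rw [sum_cube_eq_sum_layer n i]
    have h1 : ∀ τ ∈ Finset.Icc (-(n : ℤ)) n, ∑ y ∈ cube (Fin D) n,
        c i (layerPt i τ y) * (v (layerPt i τ y) * v (layerPt i τ y + Pi.single i 1)) *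
          (cutoff G (layerPt i τ y + Pi.single i 1) - cutoff G (layerPt i τ y)) ^ 2 ≤
        if bondLevel τ ∈ G then M / (G.card : ℝ) ^ 2 else 0 := by
      intro τ _
      have h2 : ∀ y, (cutoff G (layerPt i τ y + Pi.single i 1) - cutoff G (layerPt i τ y)) ^ 2 ≤
          if bondLevel τ ∈ G then 1 / (G.card : ℝ) ^ 2 else 0 := fun y => by
        simpa using sq_cutoff_sub_le G (layerPt i τ y) i
      have h3 := Finset.sum_le_sum fun y (_ : y ∈ cube (Fin D) n) => mul_le_mul_of_nonneg_left
        (h2 y) (mul_nonneg (hc i (layerPt i τ y)) (mul_nonneg (hv (layerPt i τ y))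
          (hv (layerPt i τ y + Pi.single i 1))))
      refine h3.trans ?_
      rw [← Finset.sum_mul]
      split_ifs with h
      · simp only [layerPt_add_single]
        rw [mul_one_div]
        exact div_le_div_of_nonneg_right (hM i τ h) (by positivity)
      · simp
    refine (Finset.sum_le_sum h1).trans ?_
    rw [← Finset.sum_filter, Finset.sum_const, nsmul_eq_mul]
    -- Every level in `G` belongs to two bonds of the axis, starting at `t` and at `-t - 1`.
    have h4 : ((Finset.Icc (-(n : ℤ)) n).filter fun τ => bondLevel τ ∈ G).card ≤
        2 * G.card := by
      have : ((Finset.Icc (-(n : ℤ)) n).filter fun τ => bondLevel τ ∈ G) ⊆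
          (G.image fun t : ℕ => (t : ℤ)) ∪ (G.image fun t : ℕ => -(t : ℤ) - 1) := by
        intro τ hτ
        have h := (Finset.mem_filter.1 hτ).2
        rw [Finset.mem_union, Finset.mem_image, Finset.mem_image]
        by_cases h0 : 0 ≤ τ
        · exact Or.inl ⟨_, h, by simp [bondLevel, h0]⟩
        · refine Or.inr ⟨_, h, ?_⟩
          simp only [bondLevel, h0, if_false]
          omega
      refine (Finset.card_le_card this).trans ((Finset.card_union_le _ _).trans ?_)
      have := Finset.card_image_le (s := G) (f := fun t : ℕ => (t : ℤ))
      have := Finset.card_image_le (s := G) (f := fun t : ℕ => -(t : ℤ) - 1)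
      omega
    have h5 : (((Finset.Icc (-(n : ℤ)) n).filter fun τ => bondLevel τ ∈ G).card : ℝ) ≤
        2 * G.card := by exact_mod_cast h4
    calc _ ≤ 2 * (G.card : ℝ) * (M / (G.card : ℝ) ^ 2) :=
          mul_le_mul_of_nonneg_right h5 (by positivity)
      _ = _ := by field_simp
  refine (Finset.sum_le_sum fun i _ => key i).trans_eq ?_
  simp

/-! ### Flux through the good layers -/

/-- Where `a > k`, the ratio `(a - h)/(k - h)` is at least `1`, so its power `χ - 1` may be
inserted. Raising the level thus gains a superlinear power, at the price of a negative power of the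
gap `k - h`. -/
theorem max_sub_le_rpow {a h k χ : ℝ} (hk : h < k) (hχ : 1 < χ) :
    max (a - k) 0 ≤ (k - h) ^ (1 - χ) * max (a - h) 0 ^ χ := by
  rcases le_total (a - k) 0 with h0 | h0
  · rw [max_eq_right h0]
    exact mul_nonneg (Real.rpow_nonneg (by linarith) _) (Real.rpow_nonneg (le_max_right _ _) _)
  · have h1 : 0 < a - h := by linarith
    rw [max_eq_left h0, max_eq_left h1.le]
    have h2 : (a - h) ^ χ = (a - h) * (a - h) ^ (χ - 1) := by
      rw [← Real.rpow_one_add' h1.le (by linarith)]; congr 1; ring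
    have h3 : (k - h) ^ (χ - 1) ≤ (a - h) ^ (χ - 1) :=
      Real.rpow_le_rpow (by linarith) (by linarith) (by linarith)
    rw [show 1 - χ = -(χ - 1) by ring, Real.rpow_neg (by linarith), h2]
    have h4 : 0 < (k - h) ^ (χ - 1) := Real.rpow_pos_of_pos (by linarith) _
    rw [inv_mul_eq_div, le_div_iff₀ h4]
    exact mul_le_mul (by linarith) h3 h4.le h1.le

theorem sum_sum_layer_eq {D : ℕ} (n : ℕ) (f : Fin (D + 1) → (Fin (D + 1) → ℤ) → ℝ) :
    ∑ τ ∈ Finset.Icc (-(n : ℤ)) n, ∑ i, ∑ y ∈ cube (Fin D) n, f i (layerPt i τ y) =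
      ∑ i, ∑ x ∈ cube (Fin (D + 1)) n, f i x := by
  rw [Finset.sum_comm]
  exact Finset.sum_congr rfl fun i _ => (sum_cube_eq_sum_layer n i (f i)).symm

/-- Among the layers between two cubes, at least half carry at most a multiple of the average
mass. -/
theorem exists_good_layers {D : ℕ} (f g : Fin (D + 1) → (Fin (D + 1) → ℤ) → ℝ)
    (hf : ∀ i x, 0 ≤ f i x) (hg : ∀ i x, 0 ≤ g i x) {ρ σ : ℕ} (hρσ : ρ < σ) {A B : ℝ}
    (hA : ∑ i, ∑ x ∈ cube (Fin (D + 1)) σ, f i x ≤ A)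
    (hB : ∑ i, ∑ x ∈ cube (Fin (D + 1)) σ, g i x ≤ B) :
    ∃ G : Finset ℕ, (∀ t ∈ G, ρ ≤ t) ∧ (∀ t ∈ G, t < σ) ∧ (σ : ℝ) - ρ ≤ 2 * G.card ∧
      ∀ i τ, bondLevel τ ∈ G →
        ∑ y ∈ cube (Fin D) σ, f i (layerPt i τ y) ≤ 16 * (A / (σ - ρ)) ∧
        ∑ y ∈ cube (Fin D) σ, g i (layerPt i τ y) ≤ 16 * (B / (σ - ρ)) ∧
        ∑ y ∈ cube (Fin D) σ, g i (layerPt i (τ + 1) y) ≤ 16 * (B / (σ - ρ)) := by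
  set L : ℝ := (σ : ℝ) - ρ with hL
  set I := Finset.Ico ρ σ with hI
  have hIcard : (I.card : ℝ) = L := by
    rw [hI, Nat.card_Ico, hL, Nat.cast_sub hρσ.le]
  -- Summing over all directions yields one set of levels that is good in every direction, as a
  -- product cutoff requires.
  set w1 : ℤ → ℝ := fun τ => ∑ i, ∑ y ∈ cube (Fin D) σ, f i (layerPt i τ y) with hw1
  set w2 : ℤ → ℝ := fun τ => ∑ i, ∑ y ∈ cube (Fin D) σ, g i (layerPt i τ y) with hw2
  have hw10 : ∀ τ, 0 ≤ w1 τ := fun τ => Finset.sum_nonneg fun i _ => Finset.sum_nonneg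
    fun y _ => hf _ _
  have hw20 : ∀ τ, 0 ≤ w2 τ := fun τ => Finset.sum_nonneg fun i _ => Finset.sum_nonneg
    fun y _ => hg _ _
  have hw1s : ∑ τ ∈ Finset.Icc (-(σ : ℤ)) σ, w1 τ ≤ A := (sum_sum_layer_eq σ f).trans_le hA
  have hw2s : ∑ τ ∈ Finset.Icc (-(σ : ℤ)) σ, w2 τ ≤ B := (sum_sum_layer_eq σ g).trans_le hB
  have hIlt : ∀ t ∈ I, t < σ := fun t ht => (Finset.mem_Ico.1 ht).2
  have hnn : ∀ w : ℤ → ℝ, (∀ τ, 0 ≤ w τ) → ∀ t : ℕ,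
      0 ≤ w t + w (t + 1) + w (-t) + w (-t - 1) := fun w hw t => by
    linarith [hw t, hw (t + 1), hw (-t), hw (-t - 1)]
  obtain ⟨G, hGI, hGcard, hG⟩ := exists_good_subset I
    (fun t => w1 t + w1 (t + 1) + w1 (-t) + w1 (-t - 1))
    (fun t => w2 t + w2 (t + 1) + w2 (-t) + w2 (-t - 1)) (hnn w1 hw10) (hnn w2 hw20)
    ((sum_layers_le σ I hIlt w1 hw10).trans (mul_le_mul_of_nonneg_left hw1s (by norm_num)))
    ((sum_layers_le σ I hIlt w2 hw20).trans (mul_le_mul_of_nonneg_left hw2s (by norm_num)))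
  rw [hIcard] at hGcard hG
  refine ⟨G, fun t ht => (Finset.mem_Ico.1 (hGI ht)).1,
    fun t ht => (Finset.mem_Ico.1 (hGI ht)).2, hGcard, fun i τ hτ => ?_⟩
  have hl1 : ∀ τ, ∑ y ∈ cube (Fin D) σ, f i (layerPt i τ y) ≤ w1 τ := fun τ =>
    Finset.single_le_sum (f := fun i => ∑ y ∈ cube (Fin D) σ, f i (layerPt i τ y))
      (fun i _ => Finset.sum_nonneg fun y _ => hf _ _) (Finset.mem_univ i)
  have hl2 : ∀ τ, ∑ y ∈ cube (Fin D) σ, g i (layerPt i τ y) ≤ w2 τ := fun τ =>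
    Finset.single_le_sum (f := fun i => ∑ y ∈ cube (Fin D) σ, g i (layerPt i τ y))
      (fun i _ => Finset.sum_nonneg fun y _ => hg _ _) (Finset.mem_univ i)
  suffices h : w1 τ ≤ 16 * (A / L) ∧ w2 τ ≤ 16 * (B / L) ∧ w2 (τ + 1) ≤ 16 * (B / L) from
    ⟨(hl1 τ).trans h.1, (hl2 τ).trans h.2.1, (hl2 _).trans h.2.2⟩
  clear hl1 hl2 hIlt
  obtain ⟨h1, h2⟩ := hG _ hτ
  clear_value w1 w2
  obtain ⟨m, hm⟩ : ∃ m, m = bondLevel τ := ⟨_, rfl⟩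
  rw [← hm] at h1 h2
  -- One factor `4` comes from Markov's inequality, the other from the four layers attached to a
  -- level.
  have e1 : 4 * (4 * A) / L = 16 * (A / L) := by ring
  have e2 : 4 * (4 * B) / L = 16 * (B / L) := by ring
  rw [e1] at h1
  rw [e2] at h2
  have a1 := hw10 m; have a2 := hw10 (m + 1); have a3 := hw10 (-m); have a4 := hw10 (-m - 1)
  have b1 := hw20 m; have b2 := hw20 (m + 1); have b3 := hw20 (-m); have b4 := hw20 (-m - 1)
  by_cases h0 : 0 ≤ τ
  · have : τ = m := by rw [hm]; simp [bondLevel, h0]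
    rw [this]
    exact ⟨by linarith, by linarith, by linarith⟩
  · have e3 : τ = -m - 1 := by rw [hm]; simp only [bondLevel, h0, if_false]; omega
    have e4 : τ + 1 = -m := by omega
    rw [e4, e3]
    exact ⟨by linarith, by linarith, by linarith⟩

/-- On good layers the `p`-th powers of `c` and the Sobolev energy are at most a multiple of `W / (σ
- ρ)` and `J / (σ - ρ)`. The Sobolev inequality in dimension `D`, one less than that of the cube,
and Hölder's inequality then bound the flux through each of them. -/
theorem exists_cutoff_flux_le {D : ℕ} (hD : 2 ≤ D) {p s t χ : ℝ} (hp : 1 < p) (hs : 1 < s)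
    (ht : 0 < t) (hst : 1 / t = 1 / s - 1 / D) (hχ : 2 * χ = t * (1 - 1 / p)) (hχ1 : 1 < χ) :
    ∃ C : ℝ, 0 < C ∧ ∀ (c : Fin (D + 1) → (Fin (D + 1) → ℤ) → ℝ), (∀ i x, 0 < c i x) →
      ∀ (u : (Fin (D + 1) → ℤ) → ℝ) (R ρ σ : ℕ), 1 ≤ R → ρ < σ → R ≤ σ →
      ∀ h k W J : ℝ, h < k →
      ∑ i, ∑ x ∈ cube (Fin (D + 1)) σ, c i x ^ p ≤ W →
      ∑ x ∈ cube (Fin (D + 1)) σ, sobolevDensity s σ R (fun x => max (u x - h) 0) x ≤ J →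
      ∃ G : Finset ℕ, G.Nonempty ∧ (∀ t ∈ G, ρ ≤ t) ∧ (∀ t ∈ G, t < σ) ∧
        ∑ i, ∑ x ∈ cube (Fin (D + 1)) σ,
          c i x * (max (u x - k) 0 * max (u (x + Pi.single i 1) - k) 0) *
          (cutoff G (x + Pi.single i 1) - cutoff G x) ^ 2 ≤
        C * (((k - h) ^ (1 - χ)) ^ 2 * ((W / (σ - ρ)) ^ (1 / p) *
          ((J / (σ - ρ)) ^ (t / s)) ^ (1 - 1 / p)) / (σ - ρ)) := by
  obtain ⟨CS, hCS, hsob⟩ := sobolev (ι := Fin D) (by simpa using hD) hs ht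
    (by simpa using hst)
  obtain ⟨e, he⟩ : ∃ e, e = 1 - 1 / p := ⟨_, rfl⟩
  have he0 : 0 < e := by
    have : 1 / p < 1 := by rw [div_lt_one (by linarith)]; exact hp
    linarith
  refine ⟨4 * (D + 1) * ((16 : ℝ) ^ (1 / p) * (2 * CS * (16 * (D + 1)) ^ (t / s)) ^ e),
    by positivity, ?_⟩
  intro c hc u R ρ σ hR hρσ hRσ h k W J hhk hW hJ
  have hvh0 : ∀ x, 0 ≤ max (u x - h) 0 := fun x => le_max_right _ _
  have hvk0 : ∀ x, 0 ≤ max (u x - k) 0 := fun x => le_max_right _ _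
  have hvkh : ∀ x, max (u x - k) 0 ≤ (k - h) ^ (1 - χ) * max (u x - h) 0 ^ χ := fun x =>
    max_sub_le_rpow hhk hχ1
  have hd0 : ∀ x, 0 ≤ sobolevDensity s σ R (fun x => max (u x - h) 0) x := fun x =>
    sobolevDensity_nonneg (Nat.cast_nonneg _) hvh0 x
  have hcp : ∀ i x, 0 ≤ c i x ^ p := fun i x => Real.rpow_nonneg (hc i x).le _
  have hL0 : 0 < (σ : ℝ) - ρ := by rw [sub_pos]; exact_mod_cast hρσ
  obtain ⟨G, hGρ, hGσ, hGcard, hG⟩ := exists_good_layers (fun i x => c i x ^ p)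
    (fun _ x => sobolevDensity s σ R (fun x => max (u x - h) 0) x) hcp (fun _ x => hd0 x) hρσ hW
    -- The density does not depend on the direction and is counted once for each of the `D + 1`
    -- directions.
    (B := (D + 1) * J) (by
      rw [Finset.sum_const, Finset.card_univ, Fintype.card_fin, nsmul_eq_mul]
      push_cast
      gcongr)
  obtain ⟨L, hL⟩ : ∃ L, L = (σ : ℝ) - ρ := ⟨_, rfl⟩
  simp only [← hL] at hL0 hGcard hG ⊢
  have hGpos : (0 : ℝ) < G.card := by linarith
  have hGne : G.Nonempty := Finset.card_pos.1 (by exact_mod_cast hGpos)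
  refine ⟨G, hGne, hGρ, hGσ, ?_⟩
  have hW0 : 0 ≤ W := le_trans (Finset.sum_nonneg fun i _ => Finset.sum_nonneg
    fun x _ => hcp _ _) hW
  have hJ0 : 0 ≤ J := le_trans (Finset.sum_nonneg fun x _ => hd0 _) hJ
  have hA0 : 0 ≤ (k - h) ^ (1 - χ) := Real.rpow_nonneg (by linarith) _
  have hT : ∀ i τ, ∑ y ∈ cube (Fin D) σ,
      sobolevDensity s σ R (fun x => max (u x - h) 0) (layerPt i τ y) ≤ 16 * ((D + 1) * J / L) →
      ∑ y ∈ cube (Fin D) σ, max (u (layerPt i τ y) - h) 0 ^ t ≤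
      CS * (16 * (D + 1) * (J / L)) ^ (t / s) := by
    intro i τ hτ
    refine (hsob σ (fun y => max (u (layerPt i τ y) - h) 0) fun y => hvh0 _).trans ?_
    refine mul_le_mul_of_nonneg_left (Real.rpow_le_rpow (Finset.sum_nonneg fun y _ =>
      sobolevDensity_nonneg (by positivity) (fun y => hvh0 _) y) ?_ (by positivity)) hCS.le
    refine le_trans (Finset.sum_le_sum fun y _ => ?_) (hτ.trans_eq (by ring))
    refine sobolevDensity_layer_le (by linarith) σ (by exact_mod_cast hR) ?_
      (fun x => max (u x - h) 0) hvh0 i τ y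
    have : (R : ℝ) ≤ σ := by exact_mod_cast hRσ
    linarith [(Nat.cast_nonneg σ : (0 : ℝ) ≤ σ)]
  have hflux := sum_flux_le c (fun i x => (hc i x).le) (fun x => max (u x - k) 0) hvk0 σ G hGne
    (fun i τ hτ => by
      obtain ⟨g1, g2, g3⟩ := hG i τ hτ
      exact layer_flux_le (cube (Fin D) σ) (fun y => c i (layerPt i τ y))
        (fun y => max (u (layerPt i τ y) - k) 0) (fun y => max (u (layerPt i (τ + 1) y) - k) 0)
        (fun y => max (u (layerPt i τ y) - h) 0) (fun y => max (u (layerPt i (τ + 1) y) - h) 0)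
        (fun y => (hc _ _).le) (fun y => hvk0 _) (fun y => hvk0 _) (fun y => hvh0 _)
        (fun y => hvh0 _) hp hA0 ht hχ (fun y => hvkh _)
        (fun y => hvkh _) g1 (hT i τ g2) (hT i _ g3))
  refine hflux.trans ?_
  clear hflux hT hG hsob
  rw [← he]
  obtain ⟨A, hA⟩ : ∃ A, A = (k - h) ^ (1 - χ) := ⟨_, rfl⟩
  rw [← hA] at hA0 ⊢
  obtain ⟨X, hX⟩ : ∃ X, X = (W / L) ^ (1 / p) * ((J / L) ^ (t / s)) ^ e := ⟨_, rfl⟩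
  have hX0 : 0 ≤ X := by rw [hX]; positivity
  obtain ⟨K, hK⟩ : ∃ K, K = (16 : ℝ) ^ (1 / p) * (2 * CS * (16 * (D + 1)) ^ (t / s)) ^ e :=
    ⟨_, rfl⟩
  have hK0 : 0 ≤ K := by rw [hK]; positivity
  have hM : (16 * (W / L)) ^ (1 / p) * (2 * (CS * (16 * (D + 1) * (J / L)) ^ (t / s))) ^ e =
      K * X := by
    rw [Real.mul_rpow (by norm_num) (by positivity),
      Real.mul_rpow (x := 16 * ((D : ℝ) + 1)) (by positivity) (by positivity), ← mul_assoc CS,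
      ← mul_assoc 2, ← mul_assoc 2, Real.mul_rpow (by positivity) (by positivity), hX, hK]
    ring
  rw [hM, ← hX, ← hK]
  -- The good levels are at least half of all levels: `L ≤ 2 |G|`.
  have h1 : 2 * (A ^ 2 * (K * X)) / G.card ≤ 4 * (A ^ 2 * (K * X)) / L := by
    rw [div_le_div_iff₀ hGpos hL0]
    have : 0 ≤ A ^ 2 * (K * X) := by positivity
    nlinarith
  calc _ ≤ (D + 1) * (4 * (A ^ 2 * (K * X)) / L) := by gcongr
    _ = _ := by ring

/-! ### De Giorgi iteration -/

/-- Write `|g|^s = (c g²)^{s/2} c^{-s/2}` and use Hölder's inequality with exponent `2/s`. The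
choice of `s` makes the weight appear precisely to the power `-q`. -/
theorem sum_rpow_le_weighted {ι : Type*} (S : Finset ι) (c g : ι → ℝ) (hc : ∀ x, 0 < c x)
    {q s Q V : ℝ} (hq : 0 < q) (hs : s = 2 * q / (q + 1))
    (hQ : ∑ x ∈ S, c x * g x ^ 2 ≤ Q) (hV : ∑ x ∈ S, (c x)⁻¹ ^ q ≤ V) :
    ∑ x ∈ S, |g x| ^ s ≤ (Q * V ^ (1 / q)) ^ (s / 2) := by
  have hs0 : 0 < s := by rw [hs]; positivity
  have hs2 : 1 < 2 / s := by
    rw [hs, one_lt_div (by positivity), div_lt_iff₀ (by positivity)]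
    linarith
  have h := sum_abs_mul_rpow_le S (fun x => (c x * g x ^ 2) ^ (s / 2)) (fun x => (c x)⁻¹)
    (fun x _ => Real.rpow_nonneg (mul_nonneg (hc x).le (sq_nonneg _)) _)
    (fun x _ => (inv_pos.2 (hc x)).le) (s := 2 / s) (t := q) hs2 hq (E := Q) (T := V)
    (le_trans (le_of_eq (Finset.sum_congr rfl fun x _ => by
      rw [← Real.rpow_mul (mul_nonneg (hc x).le (sq_nonneg _)),
        show s / 2 * (2 / s) = 1 by field_simp, Real.rpow_one])) hQ) hV
  have e1 : q * (1 - 1 / (2 / s)) = s / 2 := by rw [hs]; field_simp; ring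
  have e2 : 1 - 1 / (2 / s) = 1 / q * (s / 2) := by rw [hs]; field_simp; ring
  have hQ0 : 0 ≤ Q := le_trans (Finset.sum_nonneg fun x _ =>
    mul_nonneg (hc x).le (sq_nonneg _)) hQ
  have hV0 : 0 ≤ V := le_trans (Finset.sum_nonneg fun x _ =>
    Real.rpow_nonneg (inv_pos.2 (hc x)).le _) hV
  rw [e1, e2, one_div_div, Real.rpow_mul hV0, ← Real.mul_rpow hQ0 (by positivity)] at h
  refine le_trans (le_of_eq (Finset.sum_congr rfl fun x _ => ?_)) h
  rw [Real.mul_rpow (hc x).le (sq_nonneg _), Real.inv_rpow (hc x).le, mul_comm (c x ^ _), mul_assoc,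
    mul_inv_cancel₀ (Real.rpow_pos_of_pos (hc x) _).ne', mul_one, ← sq_abs, ← Real.rpow_natCast,
    ← Real.rpow_mul (abs_nonneg _)]
  congr 1
  push_cast
  ring

theorem update_succ_eq_add_single {ι : Type*} [DecidableEq ι] (x : ι → ℤ) (i : ι) :
    Function.update x i (x i + 1) = x + Pi.single i 1 := by
  funext j
  by_cases h : j = i
  · subst h; simp
  · simp [h]

/-- One step of the De Giorgi iteration. -/
theorem deGiorgi_step {D : ℕ} (hD : 2 ≤ D) {p q s t χ : ℝ} (hp : 1 < p) (hq : 1 < q)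
    (hs : s = 2 * q / (q + 1)) (ht : 0 < t) (hst : 1 / t = 1 / s - 1 / D)
    (hχ : 2 * χ = t * (1 - 1 / p)) (hχ1 : 1 < χ) :
    ∃ C : ℝ, 0 < C ∧ ∀ (c : Fin (D + 1) → (Fin (D + 1) → ℤ) → ℝ), (∀ i x, 0 < c i x) →
      ∀ (u : (Fin (D + 1) → ℤ) → ℝ), (∀ x, HarmonicAt c u x) →
      ∀ (R ρ σ : ℕ), 1 ≤ R → ρ < σ → R ≤ σ → σ ≤ 2 * R →
      ∀ h k W V J : ℝ, h < k →
      ∑ i, ∑ x ∈ cube (Fin (D + 1)) σ, c i x ^ p ≤ W →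
      ∑ i, ∑ x ∈ cube (Fin (D + 1)) σ, (c i x)⁻¹ ^ q ≤ V →
      ∑ x ∈ cube (Fin (D + 1)) σ, sobolevDensity s σ R (fun x => max (u x - h) 0) x ≤ J →
      ∑ x ∈ cube (Fin (D + 1)) ρ, sobolevDensity s ρ R (fun x => max (u x - k) 0) x ≤
        C * (((k - h) ^ (1 - χ)) ^ 2 * ((W / (σ - ρ)) ^ (1 / p) *
          ((J / (σ - ρ)) ^ (t / s)) ^ (1 - 1 / p)) / (σ - ρ) * V ^ (1 / q)) ^ (s / 2) := by
  have hs1 : 1 < s := by rw [hs, one_lt_div (by positivity)]; linarith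
  obtain ⟨C₁, hC₁, hcut⟩ := exists_cutoff_flux_le hD hp hs1 ht hst hχ hχ1
  refine ⟨(1 + 5 ^ s) * ((D + 1) * C₁ ^ (s / 2)), by positivity, ?_⟩
  intro c hc u hu R ρ σ hR hρσ hRσ hσ h k W V J hhk hW hV hJ
  obtain ⟨G, hG, hGρ, hGσ, hflux⟩ := hcut c hc u R ρ σ hR hρσ hRσ h k W J hhk hW hJ
  set Q := ((k - h) ^ (1 - χ)) ^ 2 * ((W / (σ - ρ)) ^ (1 / p) *
          ((J / (σ - ρ)) ^ (t / s)) ^ (1 - 1 / p)) / ((σ : ℝ) - ρ) with hQ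
  have hη := fun x hx i => abs_lt_of_cutoff_ne_zero (ι := Fin (D + 1)) hGσ (x := x) hx i
  have hcacc := (caccioppoli c (fun i x => (hc i x).le) u (cutoff G) k σ hu hη).trans hflux
  set w : (Fin (D + 1) → ℤ) → ℝ := fun x => cutoff G x * max (u x - k) 0 with hw
  have hV0 : 0 ≤ V := le_trans (Finset.sum_nonneg fun i _ => Finset.sum_nonneg fun x _ =>
    Real.rpow_nonneg (inv_pos.2 (hc i x)).le _) hV
  have hQ0 : 0 ≤ C₁ * Q := le_trans (Finset.sum_nonneg fun i _ => Finset.sum_nonneg fun x _ =>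
    mul_nonneg (hc i x).le (sq_nonneg _)) hcacc
  have hQ0' : 0 ≤ Q := nonneg_of_mul_nonneg_right hQ0 hC₁
  set Z := (C₁ * Q * V ^ (1 / q)) ^ (s / 2) with hZ
  -- Caccioppoli's inequality bounds the weighted energy of `w`; the moment of `c⁻¹` converts it to
  -- an unweighted `s`-energy.
  have hgrad : ∀ i, ∑ x ∈ cube (Fin (D + 1)) σ, |cubeGrad σ w i x| ^ s ≤ Z := by
    intro i
    refine le_trans (Finset.sum_le_sum fun x _ => ?_) (sum_rpow_le_weighted
      (cube (Fin (D + 1)) σ) (c i) (fun x => w (x + Pi.single i 1) - w x) (hc i)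
      (by linarith) hs ((Finset.single_le_sum (f := fun i => ∑ x ∈ cube (Fin (D + 1)) σ,
        c i x * (w (x + Pi.single i 1) - w x) ^ 2) (fun i _ => Finset.sum_nonneg fun x _ =>
        mul_nonneg (hc i x).le (sq_nonneg _)) (Finset.mem_univ i)).trans hcacc)
      ((Finset.single_le_sum (f := fun i => ∑ x ∈ cube (Fin (D + 1)) σ, (c i x)⁻¹ ^ q)
        (fun i _ => Finset.sum_nonneg fun x _ =>
          Real.rpow_nonneg (inv_pos.2 (hc i x)).le _) (Finset.mem_univ i)).trans hV))
    refine Real.rpow_le_rpow (abs_nonneg _) ?_ (by linarith)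
    unfold cubeGrad
    split_ifs
    · rw [update_succ_eq_add_single]
    · simp
  -- The zeroth-order part of the next energy: `w` vanishes on the boundary layer, and `2σ + 1 ≤
  -- 5R`.
  have hfried : ∑ x ∈ cube (Fin (D + 1)) σ, (|w x| / R) ^ s ≤ 5 ^ s * Z := by
    have h1 := friedrichs σ hs1.le w (0 : Fin (D + 1)) (fun x hx => by
      by_contra h0
      have h2 := hη x (left_ne_zero_of_mul h0) 0
      rw [hx] at h2
      simp at h2)
    have hR0 : (0 : ℝ) < R := by exact_mod_cast hR
    have h2 : (2 * (σ : ℝ) + 1) ^ s ≤ (5 * R) ^ s := by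
      refine Real.rpow_le_rpow (by positivity) ?_ (by linarith)
      have h3 : (σ : ℝ) ≤ 2 * R := by exact_mod_cast hσ
      have h4 : (1 : ℝ) ≤ R := by exact_mod_cast hR
      linarith
    rw [Real.mul_rpow (by norm_num) hR0.le] at h2
    simp only [Real.div_rpow (abs_nonneg _) hR0.le]
    rw [← Finset.sum_div, div_le_iff₀ (by positivity)]
    have h5 : 0 ≤ ∑ x ∈ cube (Fin (D + 1)) σ, |cubeGrad σ w 0 x| ^ s :=
      Finset.sum_nonneg fun x _ => Real.rpow_nonneg (abs_nonneg _) _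
    calc _ ≤ _ := h1
      _ ≤ (5 ^ s * (R : ℝ) ^ s) * Z := mul_le_mul h2 (hgrad 0) h5 (by positivity)
      _ = _ := by ring
  have hsub : cube (Fin (D + 1)) ρ ⊆ cube (Fin (D + 1)) σ := cube_mono hρσ.le
  have hone : ∀ x ∈ cube (Fin (D + 1)) ρ, w x = max (u x - k) 0 := fun x hx => by
    rw [hw]; simp [cutoff_eq_one hG hGρ hx]
  have hZ0 : 0 ≤ Z := by positivity
  calc ∑ x ∈ cube (Fin (D + 1)) ρ, sobolevDensity s ρ R (fun x => max (u x - k) 0) x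
      ≤ ∑ x ∈ cube (Fin (D + 1)) ρ, (∑ i, |cubeGrad σ w i x| ^ s + (|w x| / R) ^ s) := by
        refine Finset.sum_le_sum fun x hx => ?_
        unfold sobolevDensity
        refine add_le_add (Finset.sum_le_sum fun i _ => ?_) ?_
        · by_cases hxi : x i < ρ
          · have hxi' : x i < σ := hxi.trans (by exact_mod_cast hρσ)
            have hup : Function.update x i (x i + 1) ∈ cube (Fin (D + 1)) ρ :=
              update_mem_cube hx i (Finset.mem_Icc.2 (by have := mem_cube.1 hx i; omega))
            simp only [cubeGrad, hxi, hxi', if_true, hone x hx, hone _ hup]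
            exact le_rfl
          · simp only [cubeGrad, hxi, if_false, abs_zero]
            rw [Real.zero_rpow (by linarith)]
            exact Real.rpow_nonneg (abs_nonneg _) _
        · rw [hone x hx, abs_of_nonneg (le_max_right _ _)]
    _ ≤ ∑ x ∈ cube (Fin (D + 1)) σ, (∑ i, |cubeGrad σ w i x| ^ s + (|w x| / R) ^ s) :=
        Finset.sum_le_sum_of_subset_of_nonneg hsub fun x _ _ => by positivity
    _ ≤ (D + 1) * Z + 5 ^ s * Z := by
        rw [Finset.sum_add_distrib, Finset.sum_comm]
        refine add_le_add ((Finset.sum_le_sum fun i _ => hgrad i).trans_eq ?_) hfried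
        simp
    _ ≤ (1 + 5 ^ s) * ((D + 1) * Z) := by
        have h5 : (0 : ℝ) ≤ 5 ^ s := by positivity
        nlinarith [mul_nonneg (mul_nonneg h5 (Nat.cast_nonneg D : (0 : ℝ) ≤ D)) hZ0]
    _ = _ := by
        rw [hZ, mul_assoc C₁, Real.mul_rpow hC₁.le (by positivity)]
        ring

/-- Power counting for one step, with gap `Rδ`, width `R l` and energies per volume `M` and `H`: the
powers of `R` combine to the volume factor `R ^ (D + 1)`, and `H` enters with power `χ`. -/
theorem deGiorgi_scaling {D : ℕ} {p q s t χ : ℝ} (hp : 1 < p) (hq : 1 < q)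
    (hs : s = 2 * q / (q + 1)) (ht : 0 < t) (hst : 1 / t = 1 / s - 1 / D) (hD : 2 ≤ D)
    (hχ : 2 * χ = t * (1 - 1 / p)) {R l δ M H : ℝ} (hR : 0 < R) (hl : 0 < l) (hδ : 0 < δ)
    (hM : 0 < M) (hH : 0 < H) :
    (((R * δ) ^ (1 - χ)) ^ 2 * ((R ^ (D + 1) * M / (R * l)) ^ (1 / p) *
      ((R ^ (D + 1) * H / (R * l)) ^ (t / s)) ^ (1 - 1 / p)) / (R * l) *
      (R ^ (D + 1) * M) ^ (1 / q)) ^ (s / 2) =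
    R ^ (D + 1) * (M ^ (s / (2 * p) + s / (2 * q)) * (δ ^ ((1 - χ) * s) *
      (l ^ (-(s / (2 * p) + χ + s / 2)) * H ^ χ))) := by
  have hs0 : 0 < s := by rw [hs]; positivity
  -- All quantities become exponentials, so that the claim is a linear identity between exponents.
  obtain ⟨R, rfl⟩ : ∃ r, R = Real.exp r := ⟨Real.log R, (Real.exp_log hR).symm⟩
  obtain ⟨l, rfl⟩ : ∃ r, l = Real.exp r := ⟨Real.log l, (Real.exp_log hl).symm⟩
  obtain ⟨δ, rfl⟩ : ∃ r, δ = Real.exp r := ⟨Real.log δ, (Real.exp_log hδ).symm⟩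
  obtain ⟨M, rfl⟩ : ∃ r, M = Real.exp r := ⟨Real.log M, (Real.exp_log hM).symm⟩
  obtain ⟨H, rfl⟩ : ∃ r, H = Real.exp r := ⟨Real.log H, (Real.exp_log hH).symm⟩
  simp only [← Real.exp_nat_mul, ← Real.exp_mul, ← Real.exp_add, ← Real.exp_sub]
  congr 1
  have hD0 : (0 : ℝ) < D := by
    have : (2 : ℝ) ≤ D := by exact_mod_cast hD
    linarith
  have h1 : 1 / q = 2 / s - 1 := by rw [hs]; field_simp; ring
  have h2 : s / (2 * q) = 1 - s / 2 := by
    rw [show s / (2 * q) = s / 2 * (1 / q) by ring, h1]; field_simp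
  have h3 : t / s = 1 + t / D := by
    have : 1 / s = 1 / t + 1 / D := by linarith
    rw [div_eq_mul_one_div, this]; field_simp
  have h4 : (1 - 1 / p) = 2 * χ / t := by rw [hχ]; field_simp
  have h5 : 1 / p = 1 - 2 * χ / t := by linarith
  have h6 : s / (2 * p) = s / 2 * (1 - 2 * χ / t) := by rw [← h5]; ring
  have h7 : 1 / t = 1 / s - 1 / D := hst
  have h8 : 2 * χ / t = 2 * χ * (1 / s - 1 / D) := by rw [← h7]; ring
  have h9 : t / s * (2 * χ / t) = 2 * χ / s := by field_simp
  rw [h4, h6, h5, h2, h1]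
  push_cast
  simp only [mul_assoc, h9]
  rw [h8]
  field_simp
  ring

/-- Geometric decay in the De Giorgi iteration; the base is a large power of two. -/
theorem deGiorgi_constants (D : ℕ) {s χ e C M M₀ : ℝ} (hs : 1 < s) (hχ : 1 < χ)
    (hC : 0 < C) (hM : 0 < M) (hM₀ : 0 < M₀) (e' : ℝ) :
    ∃ (A : ℕ) (κ : ℝ), D + 1 ≤ A ∧ 0 < κ ∧ ∀ i : ℕ,
      C * (M ^ e' * ((κ * (1 / 2) ^ (i + 1)) ^ ((1 - χ) * s) *
        (((1 / 2 : ℝ) ^ (i + 2)) ^ (-e) * (M₀ * ((1 / 2 : ℝ) ^ A) ^ i) ^ χ))) ≤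
        M₀ * ((1 / 2 : ℝ) ^ A) ^ (i + 1) := by
  -- At step `i` the gaps and widths cost `2 ^ (i ((χ-1) s + e))` up to a constant, whereas `χ > 1`
  -- gains `2 ^ (-A i (χ - 1))`; a large `A` wins. `A ≥ D + 1` is kept for the end of the iteration,
  -- where `R ^ (D + 1)` must be beaten.
  obtain ⟨A₀, hA₀⟩ := exists_nat_gt (((χ - 1) * s + e) / (χ - 1))
  set A := A₀ + D + 1 with hA
  have hAb : (χ - 1) * s + e ≤ A * (χ - 1) := by
    rw [div_lt_iff₀ (by linarith)] at hA₀
    have h1 : (A : ℝ) = A₀ + D + 1 := by rw [hA]; push_cast; ring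
    have h2 : (0 : ℝ) ≤ D := Nat.cast_nonneg D
    rw [h1]
    nlinarith
  -- All factors independent of `i`. The height `κ` of the iteration is chosen with `κ ^ ((1 - χ) s)
  -- = E⁻¹`, which cancels them.
  set E := C * M ^ e' * 2 ^ ((χ - 1) * s + 2 * e + A) * M₀ ^ (χ - 1) with hE
  have hE0 : 0 < E := by positivity
  refine ⟨A, E ^ (1 / ((χ - 1) * s)), by omega, by positivity, fun i => ?_⟩
  have hχs : (χ - 1) * s ≠ 0 := by
    have : 0 < (χ - 1) * s := mul_pos (by linarith) (by linarith)
    exact this.ne'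
  have h1 : (E ^ (1 / ((χ - 1) * s)) * (1 / 2) ^ (i + 1)) ^ ((1 - χ) * s) =
      E⁻¹ * 2 ^ ((i + 1) * ((χ - 1) * s)) := by
    rw [Real.mul_rpow (by positivity) (by positivity), ← Real.rpow_mul hE0.le,
      show 1 / ((χ - 1) * s) * ((1 - χ) * s) = -1 by
        rw [show (1 - χ) * s = -((χ - 1) * s) by ring, mul_neg, one_div_mul_cancel hχs],
      Real.rpow_neg_one, one_div, inv_pow, Real.inv_rpow (by positivity), ← Real.rpow_natCast,
      ← Real.rpow_mul (by norm_num), ← Real.rpow_neg (by norm_num)]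
    congr 2
    push_cast
    ring
  have h2 : ((1 / 2 : ℝ) ^ (i + 2)) ^ (-e) = 2 ^ ((i + 2) * e) := by
    rw [one_div, inv_pow, Real.inv_rpow (by positivity), ← Real.rpow_natCast,
      ← Real.rpow_mul (by norm_num), ← Real.rpow_neg (by norm_num)]
    congr 1
    push_cast
    ring
  have h3 : ∀ n : ℕ, ((1 / 2 : ℝ) ^ A) ^ n = 2 ^ (-(A * n : ℝ)) := fun n => by
    rw [one_div, inv_pow, inv_pow, ← pow_mul, ← Real.rpow_natCast, Real.rpow_neg (by norm_num)]
    push_cast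
    rfl
  rw [h1, h2, h3, h3, Real.mul_rpow hM₀.le (by positivity), ← Real.rpow_mul (by norm_num)]
  have h4 : M₀ ^ χ = M₀ * M₀ ^ (χ - 1) := by
    rw [← Real.rpow_one_add' hM₀.le (by linarith)]; congr 1; ring
  have h5 : E⁻¹ * (C * M ^ e' * M₀ ^ (χ - 1)) = 2 ^ (-((χ - 1) * s + 2 * e + A)) := by
    rw [Real.rpow_neg (by norm_num), hE]
    field_simp
  calc _ = M₀ * (E⁻¹ * (C * M ^ e' * M₀ ^ (χ - 1))) * (2 ^ ((i + 1) * ((χ - 1) * s)) *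
        2 ^ ((i + 2) * e) * 2 ^ (-(A * i : ℝ) * χ)) := by rw [h4]; ring
    _ = M₀ * 2 ^ (-((χ - 1) * s + 2 * e + A) + ((i + 1) * ((χ - 1) * s) + (i + 2) * e +
        -(A * i : ℝ) * χ)) := by
        rw [h5, Real.rpow_add (by norm_num), Real.rpow_add (by norm_num),
          Real.rpow_add (by norm_num)]
        ring
    _ ≤ _ := by
        refine mul_le_mul_of_nonneg_left (Real.rpow_le_rpow_of_exponent_le (by norm_num) ?_) hM₀.le
        push_cast
        have := mul_le_mul_of_nonneg_left hAb (Nat.cast_nonneg i : (0 : ℝ) ≤ i)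
        nlinarith

/-- A sequence of decreasing radii between `2 R` and `R`. -/
theorem radius_sub_le {R i : ℕ} (hi : 2 ^ (i + 1) ≤ R) :
    R + R / 2 ^ (i + 1) < R + R / 2 ^ i ∧
      (R : ℝ) * (1 / 2) ^ (i + 2) ≤ ((R + R / 2 ^ i : ℕ) : ℝ) - ((R + R / 2 ^ (i + 1) : ℕ) : ℝ) := by
  obtain ⟨f, hf⟩ : ∃ f, f = R / 2 ^ i := ⟨_, rfl⟩
  have h1 : R / 2 ^ (i + 1) = f / 2 := by rw [pow_succ, ← Nat.div_div_eq_div_mul, hf]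
  have hf2 : 2 ≤ f := by
    rw [hf, Nat.le_div_iff_mul_le (by positivity)]
    rw [pow_succ] at hi
    linarith
  have h2 : R < 2 ^ i * (f + 1) := by
    rw [hf]; exact Nat.lt_mul_div_succ R (by positivity)
  rw [h1, ← hf]
  refine ⟨by omega, ?_⟩
  have h3 : ((f / 2 : ℕ) : ℝ) ≤ f / 2 := Nat.cast_div_le
  have h4 : (R : ℝ) ≤ 2 ^ i * (f + 1) := by exact_mod_cast h2.le
  have h5 : (2 : ℝ) ≤ f := by exact_mod_cast hf2
  push_cast
  -- Rounding costs at most one unit in `f`. As `f ≥ 2`, this is absorbed by asking for a quarter of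
  -- `R / 2 ^ i` instead of a half.
  have h6 : (R : ℝ) * (1 / 2) ^ i ≤ f + 1 := by
    rw [one_div, inv_pow, ← div_eq_mul_inv, div_le_iff₀ (by positivity)]
    linarith
  have h7 : (R : ℝ) * (1 / 2) ^ (i + 2) = (R : ℝ) * (1 / 2) ^ i / 4 := by ring
  rw [h7]
  linarith

theorem sobolevDensity_max_zero_le {ι : Type*} [Fintype ι] [DecidableEq ι] {s : ℝ} (hs : 0 ≤ s)
    (n : ℕ) {ℓ : ℝ} (hℓ : 0 ≤ ℓ) (u : (ι → ℤ) → ℝ) (x : ι → ℤ) :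
    sobolevDensity s n ℓ (fun x => max (u x - 0) 0) x ≤
      ∑ i, |u (x + Pi.single i 1) - u x| ^ s + (|u x| / ℓ) ^ s := by
  simp only [sub_zero]
  unfold sobolevDensity
  refine add_le_add (Finset.sum_le_sum fun i _ => Real.rpow_le_rpow (abs_nonneg _) ?_ hs)
    (Real.rpow_le_rpow (div_nonneg (le_max_right _ _) hℓ) (div_le_div_of_nonneg_right ?_ hℓ) hs)
  · unfold cubeGrad
    split_ifs
    · rw [update_succ_eq_add_single]
      exact abs_max_sub_max_le_abs _ _ _
    · simp
  · exact max_le (le_abs_self _) (abs_nonneg _)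

/-! ### Local boundedness of harmonic functions -/

/-- Local boundedness from above of harmonic functions. -/
theorem local_upper_bound {D : ℕ} (hD : 2 ≤ D) {p q s t χ : ℝ} (hp : 1 < p) (hq : 1 < q)
    (hs : s = 2 * q / (q + 1)) (ht : 0 < t) (hst : 1 / t = 1 / s - 1 / D)
    (hχ : 2 * χ = t * (1 - 1 / p)) (hχ1 : 1 < χ) {M : ℝ} (hM : 0 < M) :
    ∃ C : ℝ, 0 < C ∧ ∀ (c : Fin (D + 1) → (Fin (D + 1) → ℤ) → ℝ), (∀ i x, 0 < c i x) →
      ∀ (u : (Fin (D + 1) → ℤ) → ℝ), (∀ x, HarmonicAt c u x) → ∀ (R : ℕ), 1 ≤ R →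
      ∑ i, ∑ x ∈ cube (Fin (D + 1)) (2 * R), c i x ^ p ≤ R ^ (D + 1) * M →
      ∑ i, ∑ x ∈ cube (Fin (D + 1)) (2 * R), (c i x)⁻¹ ^ q ≤ R ^ (D + 1) * M →
      ∑ x ∈ cube (Fin (D + 1)) (2 * R), (∑ i, |u (x + Pi.single i 1) - u x| ^ s +
        (|u x| / R) ^ s) ≤ R ^ (D + 1) * M →
      ∀ x ∈ cube (Fin (D + 1)) R, u x ≤ C * R := by
  have hs1 : 1 < s := by rw [hs, one_lt_div (by positivity)]; linarith
  obtain ⟨C₁, hC₁, hstep⟩ := deGiorgi_step hD hp hq hs ht hst hχ hχ1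
  obtain ⟨A, κ, hA, hκ, hit⟩ := deGiorgi_constants D hs1 hχ1
    (e := s / (2 * p) + χ + s / 2) hC₁ hM hM
    (s / (2 * p) + s / (2 * q))
  refine ⟨κ + (M * 2 ^ A) ^ (1 / s), by positivity, ?_⟩
  intro c hc u hu R hR hW hV hJ x hx
  have hR0 : (0 : ℝ) < R := by exact_mod_cast hR
  -- On the lattice the iteration stops after `log₂ R` steps, while the radii still differ by at
  -- least one.
  set N := Nat.log 2 R with hN
  have hind : ∀ i ≤ N, ∑ x ∈ cube (Fin (D + 1)) (R + R / 2 ^ i),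
      sobolevDensity s (R + R / 2 ^ i) R
        (fun x => max (u x - κ * R * (1 - (1 / 2) ^ i)) 0) x ≤
      R ^ (D + 1) * (M * ((1 / 2) ^ A) ^ i) := by
    intro i
    induction i with
    | zero =>
      intro _
      simp only [pow_zero, Nat.div_one, sub_self, mul_zero, mul_one]
      rw [← two_mul]
      exact (Finset.sum_le_sum fun x _ => sobolevDensity_max_zero_le (by linarith) _
        hR0.le u x).trans hJ
    | succ i ih =>
      intro hi
      have hih := ih (by omega)
      have h2i : 2 ^ (i + 1) ≤ R := (Nat.pow_le_pow_right (by norm_num) hi).trans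
        (Nat.pow_log_le_self 2 (by omega))
      obtain ⟨hlt, hwidth⟩ := radius_sub_le h2i
      have hσ : R + R / 2 ^ i ≤ 2 * R := by
        have := Nat.div_le_self R (2 ^ i); omega
      have hkh : κ * R * (1 - (1 / 2) ^ (i + 1)) - κ * R * (1 - (1 / 2) ^ i) =
          R * (κ * (1 / 2) ^ (i + 1)) := by ring
      have hpos : 0 < R * (κ * (1 / 2 : ℝ) ^ (i + 1)) := by positivity
      have hsubc := cube_mono (ι := Fin (D + 1)) hσ
      have h := hstep c hc u hu R _ _ hR hlt (Nat.le_add_right _ _) hσ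
        (κ * R * (1 - (1 / 2) ^ i)) (κ * R * (1 - (1 / 2) ^ (i + 1))) (R ^ (D + 1) * M)
        (R ^ (D + 1) * M) _ (by linarith)
        (le_trans (Finset.sum_le_sum fun i _ => Finset.sum_le_sum_of_subset_of_nonneg hsubc
          fun x _ _ => Real.rpow_nonneg (hc i x).le _) hW)
        (le_trans (Finset.sum_le_sum fun i _ => Finset.sum_le_sum_of_subset_of_nonneg hsubc
          fun x _ _ => Real.rpow_nonneg (inv_pos.2 (hc i x)).le _) hV) hih
      refine h.trans ?_
      rw [hkh]
      have hwpos : 0 < (R : ℝ) * (1 / 2) ^ (i + 2) := by positivity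
      have hmono : (((R * (κ * (1 / 2 : ℝ) ^ (i + 1))) ^ (1 - χ)) ^ 2 *
          ((R ^ (D + 1) * M / (((R + R / 2 ^ i : ℕ) : ℝ) - ((R + R / 2 ^ (i + 1) : ℕ) : ℝ))) ^
            (1 / p) *
          ((R ^ (D + 1) * (M * ((1 / 2) ^ A) ^ i) /
            (((R + R / 2 ^ i : ℕ) : ℝ) - ((R + R / 2 ^ (i + 1) : ℕ) : ℝ))) ^ (t / s)) ^ (1 - 1 / p)) /
            (((R + R / 2 ^ i : ℕ) : ℝ) - ((R + R / 2 ^ (i + 1) : ℕ) : ℝ)) *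
          (R ^ (D + 1) * M) ^ (1 / q)) ^ (s / 2) ≤
        (((R * (κ * (1 / 2 : ℝ) ^ (i + 1))) ^ (1 - χ)) ^ 2 *
          ((R ^ (D + 1) * M / (R * (1 / 2) ^ (i + 2))) ^ (1 / p) *
          ((R ^ (D + 1) * (M * ((1 / 2) ^ A) ^ i) / (R * (1 / 2) ^ (i + 2))) ^ (t / s)) ^
            (1 - 1 / p)) / (R * (1 / 2) ^ (i + 2)) *
          (R ^ (D + 1) * M) ^ (1 / q)) ^ (s / 2) := by
        have : 0 ≤ 1 - 1 / p := by
          rw [sub_nonneg, div_le_one (by linarith)]; exact hp.le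
        have : 0 < ((R + R / 2 ^ i : ℕ) : ℝ) - ((R + R / 2 ^ (i + 1) : ℕ) : ℝ) :=
          hwpos.trans_le hwidth
        gcongr
      refine (mul_le_mul_of_nonneg_left hmono hC₁.le).trans ?_
      rw [deGiorgi_scaling hp hq hs ht hst hD hχ hR0 (by positivity) (by positivity) hM
        (by positivity)]
      calc _ = (R : ℝ) ^ (D + 1) * (C₁ * (M ^ (s / (2 * p) + s / (2 * q)) *
            ((κ * (1 / 2) ^ (i + 1)) ^ ((1 - χ) * s) *
            (((1 / 2 : ℝ) ^ (i + 2)) ^ (-(s / (2 * p) + χ + s / 2)) *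
            (M * ((1 / 2 : ℝ) ^ A) ^ i) ^ χ)))) := by ring
        _ ≤ _ := mul_le_mul_of_nonneg_left (hit i) (by positivity)
  have hfin := hind N le_rfl
  set v := fun x => max (u x - κ * R * (1 - (1 / 2) ^ N)) 0 with hv
  have hv0 : ∀ x, 0 ≤ v x := fun x => le_max_right _ _
  -- After `N` steps the total energy is at most `R ^ (D+1) M 2 ^ (-A N) ≤ M 2 ^ A`, so the
  -- contribution of a single point is bounded already.
  have h1 : (v x / R) ^ s ≤ M * 2 ^ A := by
    have hx' : x ∈ cube (Fin (D + 1)) (R + R / 2 ^ N) := cube_mono (Nat.le_add_right _ _) hx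
    have h2 : (v x / R) ^ s ≤ sobolevDensity s (R + R / 2 ^ N) R v x := by
      unfold sobolevDensity
      have : 0 ≤ ∑ i, |cubeGrad (R + R / 2 ^ N) v i x| ^ s :=
        Finset.sum_nonneg fun i _ => Real.rpow_nonneg (abs_nonneg _) _
      linarith
    have h3 := h2.trans ((Finset.single_le_sum (f := sobolevDensity s (R + R / 2 ^ N) R v)
      (fun x _ => sobolevDensity_nonneg hR0.le hv0 x) hx').trans hfin)
    refine h3.trans ?_
    have h4 : (R : ℝ) ≤ 2 ^ (N + 1) := by
      exact_mod_cast (Nat.lt_pow_succ_log_self (by norm_num) R).le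
    have h5 : (R : ℝ) ^ (D + 1) ≤ (2 ^ (N + 1)) ^ A :=
      (pow_le_pow_left₀ hR0.le h4 _).trans
        (pow_le_pow_right₀ (one_le_pow₀ (by norm_num)) hA)
    calc (R : ℝ) ^ (D + 1) * (M * ((1 / 2) ^ A) ^ N)
        ≤ (2 ^ (N + 1)) ^ A * (M * ((1 / 2) ^ A) ^ N) := by gcongr
      _ = M * 2 ^ A := by
        have : ((1 / 2 : ℝ) ^ A) ^ N = ((2 ^ N) ^ A)⁻¹ := by
          rw [one_div, inv_pow, inv_pow, ← pow_mul, ← pow_mul, mul_comm]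
        rw [this, pow_succ, mul_pow]
        field_simp
  have h6 : v x / R ≤ (M * 2 ^ A) ^ (1 / s) := by
    have := Real.rpow_le_rpow (Real.rpow_nonneg (div_nonneg (hv0 x) hR0.le) _) h1
      (z := 1 / s) (by positivity)
    rwa [← Real.rpow_mul (div_nonneg (hv0 x) hR0.le), mul_one_div_cancel (by linarith),
      Real.rpow_one] at this
  rw [div_le_iff₀ hR0] at h6
  have h7 : u x - κ * R * (1 - (1 / 2) ^ N) ≤ v x := le_max_left _ _
  have h8 : 0 ≤ κ * R * (1 / 2) ^ N := by positivity
  linarith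

theorem HarmonicAt.neg {ι : Type*} [Fintype ι] [DecidableEq ι] {c : ι → (ι → ℤ) → ℝ}
    {u : (ι → ℤ) → ℝ} {x : ι → ℤ} (h : HarmonicAt c u x) : HarmonicAt c (fun x => -u x) x := by
  unfold HarmonicAt at h ⊢
  rw [← neg_eq_zero, ← Finset.sum_neg_distrib, ← h]
  exact Finset.sum_congr rfl fun i _ => by ring

theorem HarmonicAt.translate {ι : Type*} [Fintype ι] [DecidableEq ι] {c : ι → (ι → ℤ) → ℝ}
    {u : (ι → ℤ) → ℝ} {x y : ι → ℤ} (h : HarmonicAt c u (y + x)) :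
    HarmonicAt (fun i x => c i (y + x)) (fun x => u (y + x)) x := by
  unfold HarmonicAt at h ⊢
  simpa only [add_assoc, add_sub_assoc] using h

/-- Local boundedness of harmonic functions under the moment condition `1/p + 1/q < 2/(d-1)`. -/
theorem local_bound {d : ℕ} (hd : 3 ≤ d) {p q s : ℝ} (hp : 1 < p) (hq : 1 < q)
    (hpq : 1 / p + 1 / q < 2 / ((d : ℝ) - 1)) (hs : s = 2 * q / (q + 1)) {M : ℝ} (hM : 0 < M) :
    ∃ C : ℝ, 0 < C ∧ ∀ (c : Fin d → (Fin d → ℤ) → ℝ), (∀ i x, 0 < c i x) →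
      ∀ (u : (Fin d → ℤ) → ℝ), (∀ x, HarmonicAt c u x) → ∀ (R : ℕ), 1 ≤ R → ∀ y : Fin d → ℤ,
      ∑ i, ∑ x ∈ cube (Fin d) (2 * R), c i (y + x) ^ p ≤ R ^ d * M →
      ∑ i, ∑ x ∈ cube (Fin d) (2 * R), (c i (y + x))⁻¹ ^ q ≤ R ^ d * M →
      ∑ x ∈ cube (Fin d) (2 * R), (∑ i, |u (y + x + Pi.single i 1) - u (y + x)| ^ s +
        (|u (y + x)| / R) ^ s) ≤ R ^ d * M →
      ∀ x ∈ cube (Fin d) R, |u (y + x)| ≤ C * R := by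
  obtain ⟨D, rfl⟩ : ∃ D, d = D + 1 := ⟨d - 1, by omega⟩
  have hD : 2 ≤ D := by omega
  have hDr : (2 : ℝ) ≤ D := by exact_mod_cast hD
  have hs1 : 1 < s := by rw [hs, one_lt_div (by positivity)]; linarith
  have hs0 : 0 < s := by linarith
  have e1 : 1 / s = 1 / 2 + 1 / (2 * q) := by rw [hs]; field_simp
  have hq0 : 0 < 1 / q := by positivity
  have hp0 : 0 < 1 / p := by positivity
  have e2 : 1 / (2 * q) = 1 / q / 2 := by field_simp
  have e3 : 2 / ((D + 1 : ℕ) - 1 : ℝ) = 2 * (1 / D) := by push_cast; ring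
  rw [e3] at hpq
  have hDinv : 1 / (D : ℝ) ≤ 1 / 2 := one_div_le_one_div_of_le (by norm_num) hDr
  have hpos : 0 < 1 / s - 1 / D := by rw [e1, e2]; linarith
  -- The Sobolev exponent of `s` on layers of dimension `D = d - 1`.
  obtain ⟨t, ht⟩ : ∃ t, t = 1 / (1 / s - 1 / D) := ⟨_, rfl⟩
  have ht0 : 0 < t := by rw [ht]; positivity
  have hst : 1 / t = 1 / s - 1 / D := by rw [ht, one_div_one_div]
  -- `t (1 - 1/p) > 2` is equivalent to `1/p + 1/q < 2/D`, because `2/s = 1 + 1/q`. The moment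
  -- condition is used here in its full strength.
  have hχ1 : 1 < t * (1 - 1 / p) / 2 := by
    rw [lt_div_iff₀ (by norm_num), one_mul]
    have : 2 * (1 / t) < 1 - 1 / p := by rw [hst, e1, e2]; linarith
    rw [mul_one_div, div_lt_iff₀ ht0] at this
    linarith
  obtain ⟨C, hC, h⟩ := local_upper_bound hD hp hq hs ht0 hst
    (χ := t * (1 - 1 / p) / 2) (by ring) hχ1 hM
  refine ⟨C, hC, fun c hc u hu R hR y hW hV hJ x hx => abs_le.2 ⟨?_, ?_⟩⟩
  · have := h (fun i x => c i (y + x)) (fun i x => hc _ _) (fun x => -u (y + x))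
      (fun x => ((hu (y + x)).translate).neg) R hR hW hV (by
        refine le_trans (le_of_eq ?_) hJ
        refine Finset.sum_congr rfl fun x _ => ?_
        rw [abs_neg]
        congr 1
        refine Finset.sum_congr rfl fun i _ => ?_
        rw [neg_sub_neg, abs_sub_comm, add_assoc]) x hx
    linarith
  · exact h (fun i x => c i (y + x)) (fun i x => hc _ _) (fun x => u (y + x))
      (fun x => (hu (y + x)).translate) R hR hW hV (by simpa only [add_assoc] using hJ) x hx

/-! ### Poincaré inequality on cubes -/

/-- Exchanging the coordinates before `i` between the two points is an involution on pairs. In the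
Poincaré inequality it turns the intermediate points of a coordinate path into free summation
variables. -/
theorem sum_pairs_exchange {d : ℕ} (n : ℕ) (i : Fin d)
    (g : (Fin d → ℤ) → (Fin d → ℤ) → ℝ) :
    ∑ x ∈ cube (Fin d) n, ∑ y ∈ cube (Fin d) n,
      g (fun j => if j < i then y j else x j) (fun j => if j < i then x j else y j) =
    ∑ x ∈ cube (Fin d) n, ∑ y ∈ cube (Fin d) n, g x y := by
  rw [← Finset.sum_product', ← Finset.sum_product']
  have hmem : ∀ a ∈ cube (Fin d) n ×ˢ cube (Fin d) n,
      ((fun j => if j < i then a.2 j else a.1 j, fun j => if j < i then a.1 j else a.2 j) :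
        (Fin d → ℤ) × (Fin d → ℤ)) ∈ cube (Fin d) n ×ˢ cube (Fin d) n := by
    intro a ha
    rw [Finset.mem_product, mem_cube, mem_cube] at ha ⊢
    refine ⟨fun j => ?_, fun j => ?_⟩ <;> simp only <;> split_ifs
    exacts [ha.2 j, ha.1 j, ha.1 j, ha.2 j]
  have hinv : ∀ a : (Fin d → ℤ) × (Fin d → ℤ),
      ((fun j => if j < i then (if j < i then a.1 j else a.2 j) else
        (if j < i then a.2 j else a.1 j)), fun j => if j < i then
        (if j < i then a.2 j else a.1 j) else (if j < i then a.1 j else a.2 j)) = a := by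
    intro a
    ext j <;> simp only <;> split_ifs <;> rfl
  exact Finset.sum_nbij'
    (fun a => (fun j => if j < i then a.2 j else a.1 j, fun j => if j < i then a.1 j else a.2 j))
    (fun a => (fun j => if j < i then a.2 j else a.1 j, fun j => if j < i then a.1 j else a.2 j))
    hmem hmem (fun a _ => hinv a) (fun a _ => hinv a) (fun a _ => rfl)

/-- The Poincaré inequality on a discrete cube. -/
theorem poincare {d : ℕ} (n : ℕ) {s : ℝ} (hs : 1 ≤ s) (u : (Fin d → ℤ) → ℝ) :
    ∑ x ∈ cube (Fin d) n, ∑ y ∈ cube (Fin d) n, |u x - u y| ^ s ≤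
      d ^ (s - 1) * (2 * n + 1) ^ s * (cube (Fin d) n).card *
        ∑ x ∈ cube (Fin d) n, ∑ i, |u (x + Pi.single i 1) - u x| ^ s := by
  have hn : (0 : ℝ) < 2 * n + 1 := by positivity
  -- The path from `x` to `y` replaces one coordinate at a time. The value `if i < i then x i else y
  -- i` is `y i`, written as the `i`-th coordinate of the exchanged second point to fit
  -- `sum_pairs_exchange`.
  have htel : ∀ x y : Fin d → ℤ, |u x - u y| ^ s ≤ d ^ (s - 1) *
      ∑ i : Fin d, |u (fun j => if j < i then y j else x j) -
        u (Function.update (fun j => if j < i then y j else x j) i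
          (if i < i then x i else y i))| ^ s := by
    intro x y
    have h1 := Finset.sum_range_sub' (fun k : ℕ =>
      u (fun j : Fin d => if (j : ℕ) < k then y j else x j)) d
    have e0 : (fun j : Fin d => if (j : ℕ) < 0 then y j else x j) = x := by funext j; simp
    have e1 : (fun j : Fin d => if (j : ℕ) < d then y j else x j) = y := by funext j; simp
    rw [e0, e1, ← Fin.sum_univ_eq_sum_range (fun k => u (fun j : Fin d =>
      if (j : ℕ) < k then y j else x j) - u (fun j : Fin d => if (j : ℕ) < k + 1 then y j else x j))]
      at h1
    rw [← h1]
    have h2 := Real.rpow_sum_le_const_mul_sum_rpow (Finset.univ : Finset (Fin d))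
      (fun i => u (fun j : Fin d => if (j : ℕ) < i then y j else x j) -
        u (fun j : Fin d => if (j : ℕ) < i + 1 then y j else x j)) hs
    rw [Finset.card_univ, Fintype.card_fin] at h2
    refine (Real.rpow_le_rpow (abs_nonneg _) (Finset.abs_sum_le_sum_abs _ _)
      (by linarith)).trans (h2.trans_eq ?_)
    congr 1
    refine Finset.sum_congr rfl fun i _ => ?_
    congr 4
    funext j
    by_cases hj : j = i
    · subst hj; simp
    · have : (j : ℕ) ≠ i := fun h => hj (Fin.ext h)
      rw [Function.update_of_ne hj]
      simp only [Fin.lt_def]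
      grind
  calc ∑ x ∈ cube (Fin d) n, ∑ y ∈ cube (Fin d) n, |u x - u y| ^ s
      ≤ ∑ x ∈ cube (Fin d) n, ∑ y ∈ cube (Fin d) n, d ^ (s - 1) *
      ∑ i : Fin d, |u (fun j => if j < i then y j else x j) -
        u (Function.update (fun j => if j < i then y j else x j) i
          (if i < i then x i else y i))| ^ s :=
        Finset.sum_le_sum fun x _ => Finset.sum_le_sum fun y _ => htel x y
    _ = d ^ (s - 1) * ∑ i : Fin d, ∑ x ∈ cube (Fin d) n, ∑ y ∈ cube (Fin d) n,
        |u x - u (Function.update x i (y i))| ^ s := by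
        simp only [← Finset.mul_sum]
        congr 1
        rw [Finset.sum_congr rfl fun x _ => Finset.sum_comm, Finset.sum_comm]
        exact Finset.sum_congr rfl fun i _ => sum_pairs_exchange n i
          (fun x y => |u x - u (Function.update x i (y i))| ^ s)
    _ ≤ d ^ (s - 1) * ∑ i : Fin d, (2 * n + 1) ^ s * (cube (Fin d) n).card *
          ∑ x ∈ cube (Fin d) n, |u (x + Pi.single i 1) - u x| ^ s := by
        refine mul_le_mul_of_nonneg_left (Finset.sum_le_sum fun i _ => ?_) (by positivity)
        calc _ ≤ ∑ x ∈ cube (Fin d) n, ∑ _y ∈ cube (Fin d) n, (2 * n + 1 : ℝ) ^ (s - 1) *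
              ∑ t ∈ Finset.Icc (-(n : ℤ)) n, |cubeGrad n u i (Function.update x i t)| ^ s := by
              refine Finset.sum_le_sum fun x hx => Finset.sum_le_sum fun y hy => ?_
              exact (Real.rpow_le_rpow (abs_nonneg _) (abs_sub_update_le_sum_cubeGrad n u hx i
                (Finset.mem_Icc.2 (mem_cube.1 hy i))) (by linarith)).trans
                (sum_Icc_rpow_le n hs _ fun _ => abs_nonneg _)
          _ = (2 * n + 1 : ℝ) ^ s * (cube (Fin d) n).card *
                ∑ x ∈ cube (Fin d) n, |cubeGrad n u i x| ^ s := by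
              simp only [Finset.sum_const, nsmul_eq_mul, ← Finset.mul_sum]
              rw [sum_cube_sum_update n i (fun x => |cubeGrad n u i x| ^ s),
                Real.rpow_sub hn, Real.rpow_one]
              field_simp
          _ ≤ _ := by
              refine mul_le_mul_of_nonneg_left (Finset.sum_le_sum fun x _ => ?_) (by positivity)
              refine Real.rpow_le_rpow (abs_nonneg _) ?_ (by linarith)
              unfold cubeGrad
              split_ifs
              · rw [update_succ_eq_add_single]
              · simp
    _ = _ := by
        rw [← Finset.mul_sum, Finset.sum_comm]
        ring

/-! ### Vitali covering and the maximal inequality -/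

theorem card_cube_mul_le (d k R : ℕ) (hk : 1 ≤ k) :
    (cube (Fin d) (k * R)).card ≤ k ^ d * (cube (Fin d) R).card := by
  simp only [card_cube, Fintype.card_fin]
  rw [← mul_pow]
  refine Nat.pow_le_pow_left ?_ d
  nlinarith

/-- Cubes are balls of the sup metric, so the metric form of Vitali's lemma applies to them. -/
theorem mem_closedBall_iff_sub_mem_cube {d n : ℕ} {x y : Fin d → ℤ} :
    y ∈ Metric.closedBall x (n : ℝ) ↔ y - x ∈ cube (Fin d) n := by
  rw [Metric.mem_closedBall, dist_pi_le_iff (by positivity), mem_cube]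
  refine forall_congr' fun i => ?_
  rw [Int.dist_eq, abs_le, Pi.sub_apply]
  constructor
  · rintro ⟨h1, h2⟩
    constructor
    · exact_mod_cast h1
    · exact_mod_cast h2
  · rintro ⟨h1, h2⟩
    constructor
    · exact_mod_cast h1
    · exact_mod_cast h2

theorem sum_cube_add_le_sum {d : ℕ} (F : (Fin d → ℤ) → ℝ≥0∞) (n : ℕ) (x : Fin d → ℤ)
    (U : Finset (Fin d → ℤ)) (hU : ∀ y ∈ cube (Fin d) n, x + y ∈ U) :
    ∑ y ∈ cube (Fin d) n, F (x + y) ≤ ∑ y ∈ U, F y := by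
  rw [← Finset.sum_image (g := fun y => x + y) (f := F)
    (fun a _ b _ h => add_left_cancel h)]
  refine Finset.sum_le_sum_of_subset fun y hy => ?_
  obtain ⟨a, ha, rfl⟩ := Finset.mem_image.1 hy
  exact hU a ha

/-- The counting estimate behind the maximal inequality, from Vitali's covering lemma. -/
theorem mul_card_le_of_large_sums {d : ℕ} (F : (Fin d → ℤ) → ℝ≥0∞) (t U : Finset (Fin d → ℤ))
    (r : (Fin d → ℤ) → ℕ) (c : ℝ≥0∞)
    (hr : ∀ x ∈ t, c * (cube (Fin d) (r x)).card ≤ ∑ y ∈ cube (Fin d) (r x), F (x + y))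
    (hU : ∀ x ∈ t, ∀ y ∈ cube (Fin d) (r x), x + y ∈ U) :
    c * t.card ≤ 5 ^ d * ∑ y ∈ U, F y := by
  classical
  obtain ⟨u, hut, hdisj, hcov⟩ := Vitali.exists_disjoint_subfamily_covering_enlargement_closedBall
    (t : Set (Fin d → ℤ)) id (fun x => (r x : ℝ)) ((t.sup r : ℕ) : ℝ)
    (fun a ha => by exact_mod_cast Finset.le_sup (f := r) ha) 5 (by norm_num)
  have hufin : u.Finite := t.finite_toSet.subset hut
  obtain ⟨v, rfl⟩ := hufin.exists_finset_coe
  have hvt : v ⊆ t := by exact_mod_cast hut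
  -- The fivefold enlargements of the selected disjoint cubes cover `t`; this gives the constant `5
  -- ^ d`.
  have h1 : t.card ≤ ∑ b ∈ v, (cube (Fin d) (5 * r b)).card := by
    have hsub : t ⊆ v.biUnion fun b => (cube (Fin d) (5 * r b)).image fun y => b + y := by
      intro a ha
      obtain ⟨b, hb, hab⟩ := hcov a ha
      have h2 : a ∈ Metric.closedBall (id b) (5 * (r b : ℝ)) :=
        hab (Metric.mem_closedBall_self (by positivity))
      rw [Finset.mem_biUnion]
      refine ⟨b, by exact_mod_cast hb, Finset.mem_image.2 ⟨a - b, ?_, by simp⟩⟩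
      rw [← mem_closedBall_iff_sub_mem_cube]
      simpa using h2
    refine (Finset.card_le_card hsub).trans (Finset.card_biUnion_le.trans ?_)
    exact Finset.sum_le_sum fun b _ => Finset.card_image_le
  have h3 : ∑ b ∈ v, ∑ y ∈ cube (Fin d) (r b), F (b + y) ≤ ∑ y ∈ U, F y := by
    have e1 : ∀ b ∈ v, ∑ y ∈ cube (Fin d) (r b), F (b + y) =
        ∑ y ∈ (cube (Fin d) (r b)).image (fun y => b + y), F y := fun b _ =>
      (Finset.sum_image (fun a _ a' _ h => add_left_cancel h)).symm
    rw [Finset.sum_congr rfl e1, ← Finset.sum_biUnion]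
    · refine Finset.sum_le_sum_of_subset fun y hy => ?_
      obtain ⟨b, hb, hy⟩ := Finset.mem_biUnion.1 hy
      obtain ⟨a, ha, rfl⟩ := Finset.mem_image.1 hy
      exact hU b (hvt hb) a ha
    · intro b hb b' hb' hbb'
      have h4 := hdisj hb hb' hbb'
      simp only [Function.onFun, id] at h4 ⊢
      rw [Finset.disjoint_left]
      intro y hy hy'
      obtain ⟨a, ha, rfl⟩ := Finset.mem_image.1 hy
      obtain ⟨a', ha', h5⟩ := Finset.mem_image.1 hy'
      refine Set.disjoint_left.1 h4 (mem_closedBall_iff_sub_mem_cube.2 (?_ : b + a - b ∈ _))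
        (mem_closedBall_iff_sub_mem_cube.2 (?_ : b + a - b' ∈ _))
      · simpa using ha
      · rw [← h5]
        simpa using ha'
  calc c * t.card ≤ c * ∑ b ∈ v, ((cube (Fin d) (5 * r b)).card : ℝ≥0∞) := by
        gcongr
        exact_mod_cast h1
    _ ≤ c * ∑ b ∈ v, (5 ^ d * ((cube (Fin d) (r b)).card : ℝ≥0∞)) := by
        gcongr with b hb
        exact_mod_cast card_cube_mul_le d 5 (r b) (by norm_num)
    _ = 5 ^ d * ∑ b ∈ v, c * (cube (Fin d) (r b)).card := by
        rw [Finset.mul_sum, Finset.mul_sum]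
        exact Finset.sum_congr rfl fun b _ => by ring
    _ ≤ 5 ^ d * ∑ b ∈ v, ∑ y ∈ cube (Fin d) (r b), F (b + y) := by
        gcongr with b hb
        exact hr b (hvt hb)
    _ ≤ _ := by gcongr

theorem Bond.shift_shift {d : ℕ} (z w : Fin d → ℤ) (e : Bond d) :
    Bond.shift z (Bond.shift w e) = Bond.shift (w + z) e := by
  apply Subtype.ext
  simp only [Bond.shift, Sym2.map_map]
  congr 1
  funext x
  simp [add_assoc]

theorem shift_shift {d : ℕ} (z w : Fin d → ℤ) (ω : Env d) :
    shift z (shift w ω) = shift (z + w) ω := by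
  funext e
  simp only [shift, Bond.shift_shift]

@[simp] theorem shift_zero {d : ℕ} (ω : Env d) : shift 0 ω = ω := by
  funext e
  have : Bond.shift 0 e = e := by
    apply Subtype.ext
    simp [Bond.shift]
  simp [shift, this]

/-- The sum of `f` over the translates of the environment by the points of a cube. -/
noncomputable def cubeSum {d : ℕ} (f : Env d → ℝ≥0∞) (R : ℕ) (ω : Env d) : ℝ≥0∞ :=
  ∑ x ∈ cube (Fin d) R, f (shift x ω)

theorem cubeSum_shift {d : ℕ} (f : Env d → ℝ≥0∞) (R : ℕ) (z : Fin d → ℤ) (ω : Env d) :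
    cubeSum f R (shift z ω) = ∑ x ∈ cube (Fin d) R, f (shift (z + x) ω) := by
  simp only [cubeSum, shift_shift]
  exact Finset.sum_congr rfl fun x _ => by rw [add_comm]

theorem cubeSum_shift_le {d : ℕ} (f : Env d → ℝ≥0∞) {n R m : ℕ} {z : Fin d → ℤ}
    (hz : z ∈ cube (Fin d) n) (h : n + R ≤ m) (ω : Env d) :
    cubeSum f R (shift z ω) ≤ cubeSum f m ω := by
  rw [cubeSum_shift]
  refine sum_cube_add_le_sum (fun x => f (shift x ω)) R z _ fun y hy => ?_
  rw [mem_cube] at hz hy ⊢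
  intro i
  have := hz i
  have := hy i
  simp only [Pi.add_apply]
  omega

theorem measurable_cubeSum {d : ℕ} {P : Measure (Env d)} (hstat : IsStationary P)
    {f : Env d → ℝ≥0∞} (hf : Measurable f) (R : ℕ) : Measurable (cubeSum f R) :=
  Finset.measurable_sum _ fun x _ => hf.comp (hstat x).measurable

theorem lintegral_cubeSum {d : ℕ} {P : Measure (Env d)} (hstat : IsStationary P)
    {f : Env d → ℝ≥0∞} (hf : Measurable f) (R : ℕ) :
    ∫⁻ ω, cubeSum f R ω ∂P = (cube (Fin d) R).card * ∫⁻ ω, f ω ∂P := by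
  simp only [cubeSum]
  rw [lintegral_finsetSum (f := fun x ω => f (shift x ω)) _
    fun x _ => hf.comp (hstat x).measurable]
  rw [Finset.sum_congr rfl fun x _ => (hstat x).lintegral_comp hf, Finset.sum_const,
    nsmul_eq_mul]

/-- The maximal inequality for averages over cubes. -/
theorem maximal_inequality {d : ℕ} {P : Measure (Env d)} (hstat : IsStationary P)
    {f : Env d → ℝ≥0∞} (hf : Measurable f) (c : ℝ≥0∞) :
    c * P {ω | ∃ R, c * (cube (Fin d) R).card < cubeSum f R ω} ≤ 10 ^ d * ∫⁻ ω, f ω ∂P := by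
  set E : ℕ → Set (Env d) := fun N =>
    {ω | ∃ R ≤ N, c * (cube (Fin d) R).card < cubeSum f R ω} with hE
  have hEmeas : ∀ N, MeasurableSet (E N) := fun N => by
    have : E N = ⋃ R ∈ Finset.range (N + 1), {ω | c * (cube (Fin d) R).card < cubeSum f R ω} := by
      ext ω
      simp [hE]
    rw [this]
    exact Finset.measurableSet_biUnion _ fun R _ =>
      measurableSet_lt measurable_const (measurable_cubeSum hstat hf R)
  have hEmono : Monotone E := fun N N' h ω ⟨R, hR, hω⟩ => ⟨R, hR.trans h, hω⟩
  have hUnion : {ω | ∃ R, c * (cube (Fin d) R).card < cubeSum f R ω} = ⋃ N, E N := by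
    ext ω
    simp only [hE, Set.mem_ofPred_eq, Set.mem_iUnion]
    exact ⟨fun ⟨R, h⟩ => ⟨R, R, le_rfl, h⟩, fun ⟨_, R, _, h⟩ => ⟨R, h⟩⟩
  rw [hUnion, hEmono.measure_iUnion, ENNReal.mul_iSup]
  refine iSup_le fun N => ?_
  classical
  -- Transference: the translates that lie in the event are counted in a cube of radius `N`. Their
  -- cubes have radii at most `N`, so only values of `f` in the cube of radius `2 N` matter, which
  -- costs `2 ^ d` after integration.
  have hpt : ∀ ω, c * cubeSum ((E N).indicator 1) N ω ≤ 5 ^ d * cubeSum f (2 * N) ω := by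
    intro ω
    have hcard : cubeSum ((E N).indicator 1) N ω =
        (((cube (Fin d) N).filter fun x => shift x ω ∈ E N).card : ℝ≥0∞) := by
      rw [cubeSum, Finset.card_filter]
      push_cast
      refine Finset.sum_congr rfl fun x _ => ?_
      simp [Set.indicator_apply]
    rw [hcard]
    have hch : ∀ x : Fin d → ℤ, ∃ R, shift x ω ∈ E N → R ≤ N ∧
        c * (cube (Fin d) R).card < cubeSum f R (shift x ω) := by
      intro x
      by_cases h : shift x ω ∈ E N
      · obtain ⟨R, hR⟩ := h
        exact ⟨R, fun _ => hR⟩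
      · exact ⟨0, fun h' => absurd h' h⟩
    choose r hr using hch
    refine mul_card_le_of_large_sums (fun x => f (shift x ω)) _ (cube (Fin d) (2 * N)) r c ?_ ?_
    · intro x hx
      have := (hr x (Finset.mem_filter.1 hx).2).2.le
      rwa [cubeSum_shift] at this
    · intro x hx y hy
      have h1 := (hr x (Finset.mem_filter.1 hx).2).1
      have h2 := (Finset.mem_filter.1 hx).1
      rw [mem_cube] at h2 hy ⊢
      intro i
      have := h2 i
      have := hy i
      simp only [Pi.add_apply]
      omega
  have hint := lintegral_mono (μ := P) hpt
  have hind : Measurable ((E N).indicator (1 : Env d → ℝ≥0∞)) :=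
    measurable_one.indicator (hEmeas N)
  rw [lintegral_const_mul _ (measurable_cubeSum hstat hind N),
    lintegral_const_mul _ (measurable_cubeSum hstat hf _), lintegral_cubeSum hstat hind,
    lintegral_cubeSum hstat hf, lintegral_indicator_one (hEmeas N)] at hint
  have hc0 : ((cube (Fin d) N).card : ℝ≥0∞) ≠ 0 := by
    rw [card_cube]; positivity
  have hct : ((cube (Fin d) N).card : ℝ≥0∞) ≠ ∞ := ENNReal.natCast_ne_top _
  have hle : ((cube (Fin d) (2 * N)).card : ℝ≥0∞) ≤ 2 ^ d * (cube (Fin d) N).card := by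
    exact_mod_cast card_cube_mul_le d 2 N (by norm_num)
  have h10 : (10 : ℝ≥0∞) ^ d = 5 ^ d * 2 ^ d := by rw [← mul_pow]; norm_num
  rw [← ENNReal.mul_le_mul_iff_right hc0 hct]
  calc _ = c * ((cube (Fin d) N).card * P (E N)) := by ring
    _ ≤ 5 ^ d * ((cube (Fin d) (2 * N)).card * ∫⁻ ω, f ω ∂P) := hint
    _ ≤ 5 ^ d * (2 ^ d * (cube (Fin d) N).card * ∫⁻ ω, f ω ∂P) := by gcongr
    _ = _ := by rw [h10]; ring

/-! ### Almost sure bounds for spatial averages -/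

/-- Ergodicity: the averages over centred cubes are eventually bounded by a multiple of the
mean. -/
theorem eventually_cubeSum_le {d : ℕ} {P : Measure (Env d)}
    (hstat : IsStationary P) (herg : IsErgodic P) {f : Env d → ℝ≥0∞} (hf : Measurable f)
    {c : ℝ≥0∞} (hc : 20 ^ d * ∫⁻ ω, f ω ∂P < c) :
    ∀ᵐ ω ∂P, ∀ᶠ R in atTop, cubeSum f R ω ≤ c * (cube (Fin d) R).card := by
  -- The quantifier over `z` makes the event strictly invariant, as `IsErgodic` requires.
  set A : Set (Env d) :=
    {ω | ∃ z : Fin d → ℤ, ∃ᶠ R in atTop, c * (cube (Fin d) R).card < cubeSum f R (shift z ω)}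
    with hA
  have hAmeas : MeasurableSet A := by
    have : A = ⋃ z : Fin d → ℤ, ⋂ N : ℕ, ⋃ R : ℕ, ⋃ _ : N ≤ R,
        {ω | c * (cube (Fin d) R).card < cubeSum f R (shift z ω)} := by
      ext ω
      simp [hA, frequently_atTop]
    rw [this]
    exact MeasurableSet.iUnion fun z => MeasurableSet.iInter fun N => MeasurableSet.iUnion fun R =>
      MeasurableSet.iUnion fun _ => measurableSet_lt measurable_const
        ((measurable_cubeSum hstat hf R).comp (hstat z).measurable)
  have hAsub : ∀ z : Fin d → ℤ, ∀ ω ∈ A, shift z ω ∈ A := by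
    rintro z ω ⟨w, hw⟩
    refine ⟨w - z, ?_⟩
    simpa [shift_shift] using hw
  have hAinv : ∀ z : Fin d → ℤ, shift z '' A = A := by
    intro z
    ext ω
    constructor
    · rintro ⟨ω', h, rfl⟩
      exact hAsub z _ h
    · intro h
      exact ⟨shift (-z) ω, hAsub _ _ h, by simp [shift_shift]⟩
  -- Recentring: for large `R` the cube of radius `R` around `z` lies in the centred cube of radius
  -- `2 R`. The lost `2 ^ d` and the `10 ^ d` of the maximal inequality make up `20 ^ d`; if `P A =
  -- 1`, they contradict `hc`.
  have hAE : A ⊆ {ω | ∃ R, c / 2 ^ d * (cube (Fin d) R).card < cubeSum f R ω} := by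
    rintro ω ⟨z, hz⟩
    obtain ⟨n, hn⟩ : ∃ n : ℕ, z ∈ cube (Fin d) n := by
      refine ⟨Finset.univ.sup fun i => (z i).natAbs, mem_cube.2 fun i => ?_⟩
      have := Finset.le_sup (f := fun i => (z i).natAbs) (Finset.mem_univ i)
      omega
    obtain ⟨R, hR, hnR⟩ := (hz.and_eventually (eventually_ge_atTop n)).exists
    refine ⟨2 * R, ?_⟩
    refine lt_of_le_of_lt ?_ (hR.trans_le (cubeSum_shift_le f hn (by omega) ω))
    calc c / 2 ^ d * (cube (Fin d) (2 * R)).card ≤ c / 2 ^ d * (2 ^ d * (cube (Fin d) R).card) := by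
          gcongr
          exact_mod_cast card_cube_mul_le d 2 R (by norm_num)
      _ = c * (cube (Fin d) R).card := by
          rw [← mul_assoc, ENNReal.div_mul_cancel (by positivity) (by simp)]
  have hA0 : P A = 0 := by
    rcases herg A hAmeas hAinv with h | h
    · exact h
    · exfalso
      have h1 := maximal_inequality hstat hf (c / 2 ^ d)
      have h2 : c / 2 ^ d * P A ≤ 10 ^ d * ∫⁻ ω, f ω ∂P :=
        le_trans (by gcongr) h1
      rw [h, mul_one, ENNReal.div_le_iff (by positivity) (by simp)] at h2
      refine absurd hc (not_lt.2 (h2.trans_eq ?_))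
      have : (20 : ℝ≥0∞) ^ d = 10 ^ d * 2 ^ d := by rw [← mul_pow]; norm_num
      rw [this]; ring
  rw [ae_iff]
  refine measure_mono_null ?_ hA0
  intro ω hω
  refine ⟨0, ?_⟩
  rw [shift_zero]
  exact fun h => hω (h.mono fun R hR => not_lt.1 hR)

theorem exists_mem_cube {d : ℕ} (z : Fin d → ℤ) : ∃ n : ℕ, z ∈ cube (Fin d) n := by
  refine ⟨Finset.univ.sup fun i => (z i).natAbs, mem_cube.2 fun i => ?_⟩
  have := Finset.le_sup (f := fun i => (z i).natAbs) (Finset.mem_univ i)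
  omega

theorem smul_mem_cube {d n : ℕ} {z : Fin d → ℤ} (hz : z ∈ cube (Fin d) n) (R : ℕ) :
    (R : ℤ) • z ∈ cube (Fin d) (n * R) := by
  rw [mem_cube] at hz ⊢
  intro i
  have := hz i
  simp only [Pi.smul_apply, smul_eq_mul]
  push_cast
  constructor <;> nlinarith

/-- Averages over cubes with moving centres `R z` are eventually at most a `z`-dependent multiple
of the mean. -/
theorem eventually_cubeSum_shift_smul_le {d : ℕ} {P : Measure (Env d)}
    (hstat : IsStationary P) (herg : IsErgodic P) {f : Env d → ℝ≥0∞} (hf : Measurable f)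
    {n k m : ℕ} (hm : n + k ≤ m) (hm0 : 1 ≤ m) {z : Fin d → ℤ} (hz : z ∈ cube (Fin d) n)
    (hc : 20 ^ d * ∫⁻ ω, f ω ∂P < 1 / m ^ d) :
    ∀ᵐ ω ∂P, ∀ᶠ R : ℕ in atTop,
      cubeSum f (k * R) (shift ((R : ℤ) • z) ω) ≤ (cube (Fin d) R).card := by
  filter_upwards [eventually_cubeSum_le hstat herg hf hc] with ω hω
  have htend : Tendsto (fun R : ℕ => m * R) atTop atTop :=
    tendsto_id.const_mul_atTop' (by omega)
  filter_upwards [htend.eventually hω] with R hR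
  refine (cubeSum_shift_le f (smul_mem_cube hz R) (m := m * R) (by nlinarith) ω).trans
    (hR.trans ?_)
  calc 1 / (m : ℝ≥0∞) ^ d * (cube (Fin d) (m * R)).card
      ≤ 1 / (m : ℝ≥0∞) ^ d * (m ^ d * (cube (Fin d) R).card) := by
        gcongr
        exact_mod_cast card_cube_mul_le d m R hm0
    _ = _ := by
        rw [← mul_assoc, ENNReal.div_mul_cancel (by positivity)
          (ENNReal.pow_ne_top (ENNReal.natCast_ne_top m)), one_mul]

/-- A sum over a cube is bounded by the sum of spatial averages over a larger cube. -/
theorem card_mul_cubeSum_le {d : ℕ} (f : Env d → ℝ≥0∞) (N R m : ℕ) (hm : N + R ≤ m) (ω : Env d) :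
    (cube (Fin d) N).card * cubeSum f R ω ≤ cubeSum (cubeSum f N) m ω := by
  have h1 : cubeSum (cubeSum f N) m ω =
      ∑ w ∈ cube (Fin d) N, ∑ x ∈ cube (Fin d) m, f (shift (w + x) ω) := by
    simp only [cubeSum, shift_shift]
    exact Finset.sum_comm
  rw [h1, ← nsmul_eq_mul]
  refine Finset.card_nsmul_le_sum _ _ _ fun w hw => ?_
  -- For each `w` in the cube of radius `N`, the shift by `-w` keeps the cube of radius `R` inside
  -- that of radius `m`, so the inner sum over `x` dominates the whole cube sum.
  have h2 := sum_cube_add_le_sum (fun x => f (shift (w + x) ω)) R (-w) (cube (Fin d) m)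
    (fun y hy => by
      rw [mem_cube] at hw hy ⊢
      intro i
      have := hw i
      have := hy i
      simp only [Pi.add_apply, Pi.neg_apply]
      omega)
  simpa [cubeSum] using h2

theorem cubeSum_mono {d : ℕ} {f g : Env d → ℝ≥0∞} (h : ∀ ω, f ω ≤ g ω) (R : ℕ) (ω : Env d) :
    cubeSum f R ω ≤ cubeSum g R ω := Finset.sum_le_sum fun _ _ => h _

theorem cubeSum_add {d : ℕ} (f g : Env d → ℝ≥0∞) (R : ℕ) (ω : Env d) :
    cubeSum (fun ω => f ω + g ω) R ω = cubeSum f R ω + cubeSum g R ω := Finset.sum_add_distrib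

theorem cubeSum_const {d : ℕ} (c : ℝ≥0∞) (R : ℕ) (ω : Env d) :
    cubeSum (fun _ : Env d => c) R ω = (cube (Fin d) R).card * c := by
  simp [cubeSum]

/-- For bounded functions the excess of the averages over large cubes above a multiple of the
mean tends to zero in the mean. -/
theorem exists_lintegral_excess_lt {d : ℕ} {P : Measure (Env d)} [IsProbabilityMeasure P]
    (hstat : IsStationary P) (herg : IsErgodic P) {f : Env d → ℝ≥0∞} (hf : Measurable f)
    {B : ℝ≥0∞} (hB : B ≠ ∞) (hfB : ∀ ω, f ω ≤ B)
    {c ε : ℝ≥0∞} (hc : 20 ^ d * ∫⁻ ω, f ω ∂P < c) (hε : 0 < ε) :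
    ∃ N : ℕ, ∫⁻ ω, (cubeSum f N ω / (cube (Fin d) N).card - c) ∂P < ε := by
  have hcard : ∀ N, ((cube (Fin d) N).card : ℝ≥0∞) ≠ 0 := fun N => by
    rw [card_cube]; positivity
  have hlim : Tendsto (fun N => ∫⁻ ω, (cubeSum f N ω / (cube (Fin d) N).card - c) ∂P) atTop
      (𝓝 (∫⁻ _, 0 ∂P)) := by
    refine tendsto_lintegral_of_dominated_convergence (fun _ => B) (fun N => ?_) (fun N => ?_) ?_ ?_
    · exact ((measurable_cubeSum hstat hf N).div_const _).sub_const _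
    · refine Eventually.of_forall fun ω => tsub_le_self.trans ?_
      rw [ENNReal.div_le_iff (hcard N) (ENNReal.natCast_ne_top _), mul_comm, ← cubeSum_const B N ω]
      exact cubeSum_mono hfB N ω
    · simpa using hB
    · filter_upwards [eventually_cubeSum_le hstat herg hf hc] with ω hω
      refine tendsto_const_nhds.congr' ?_
      filter_upwards [hω] with N hN
      rw [eq_comm, tsub_eq_zero_iff_le, ENNReal.div_le_iff (hcard N) (ENNReal.natCast_ne_top _)]
      exact hN
  rw [lintegral_zero] at hlim
  exact (hlim.eventually (gt_mem_nhds hε)).exists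

/-- Dominated convergence for the excess over high levels. A small mean can later be traded against
a constant that grows with the distance of the centre. -/
theorem exists_lintegral_tail_lt {d : ℕ} {P : Measure (Env d)} {f : Env d → ℝ≥0∞}
    (hf : Measurable f) (hfi : ∫⁻ ω, f ω ∂P ≠ ∞) {ε : ℝ≥0∞} (hε : 0 < ε) :
    ∃ B : ℕ, ∫⁻ ω, (f ω - B) ∂P < ε := by
  have hlim : Tendsto (fun B : ℕ => ∫⁻ ω, (f ω - B) ∂P) atTop (𝓝 (∫⁻ _, 0 ∂P)) := by
    refine tendsto_lintegral_of_dominated_convergence f (fun B => hf.sub_const _)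
      (fun B => Eventually.of_forall fun ω => tsub_le_self) hfi ?_
    filter_upwards [ae_lt_top hf hfi] with ω hω
    refine tendsto_const_nhds.congr' ?_
    obtain ⟨B₀, hB₀⟩ := ENNReal.exists_nat_gt hω.ne
    filter_upwards [eventually_ge_atTop B₀] with B hB
    rw [eq_comm, tsub_eq_zero_iff_le]
    exact hB₀.le.trans (by exact_mod_cast hB)
  rw [lintegral_zero] at hlim
  exact (hlim.eventually (gt_mem_nhds hε)).exists

/-- The averages over the cubes with centres `R z` and radii `2 R` are, for all `z`, eventually
bounded by a constant which does not depend on `z`. -/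
theorem eventually_cubeSum_offcentre_le {d : ℕ} {P : Measure (Env d)} [IsProbabilityMeasure P]
    (hstat : IsStationary P) (herg : IsErgodic P) {f : Env d → ℝ≥0∞} (hf : Measurable f)
    (hfi : ∫⁻ ω, f ω ∂P ≠ ∞) :
    ∃ C : ℝ, 0 < C ∧ ∀ᵐ ω ∂P, ∀ z : Fin d → ℤ, ∀ᶠ R : ℕ in atTop,
      cubeSum f (2 * R) (shift ((R : ℤ) • z) ω) ≤ ENNReal.ofReal (R ^ d * C) := by
  have h20 : 20 ^ d * ∫⁻ ω, f ω ∂P < ∞ :=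
    ENNReal.mul_lt_top (by simp) (lt_top_iff_ne_top.2 hfi)
  obtain ⟨c, hc⟩ := ENNReal.exists_nat_gt h20.ne
  refine ⟨3 ^ d * (2 + 3 ^ d * c), by positivity, ae_all_iff.2 fun z => ?_⟩
  obtain ⟨n, hn⟩ := exists_mem_cube z
  -- Small enough to pay the volume ratio `(n + 3) ^ d` between the enclosing centred cube and a
  -- cube of radius `R`, so that the final constant does not depend on `n`.
  have hε : (0 : ℝ≥0∞) < 1 / (n + 3 : ℕ) ^ d / 20 ^ d := by
    refine ENNReal.div_pos (ENNReal.div_pos one_ne_zero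
      (ENNReal.pow_ne_top (ENNReal.natCast_ne_top _))).ne' (by simp)
  have hto : ∀ a : ℝ≥0∞, a < 1 / (n + 3 : ℕ) ^ d / 20 ^ d → 20 ^ d * a < 1 / (n + 3 : ℕ) ^ d := by
    intro a ha
    rw [ENNReal.lt_div_iff_mul_lt (by simp) (by simp)] at ha
    rwa [mul_comm]
  -- Split `f` into a tail of small mean and a bounded part. The bounded part is replaced by its
  -- averages over cubes of a fixed radius `N`, which are at most `c` plus an excess of small mean.
  obtain ⟨B, hB⟩ := exists_lintegral_tail_lt hf hfi hε
  have hfb : Measurable fun ω => min (f ω) B := hf.min measurable_const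
  obtain ⟨N, hN⟩ := exists_lintegral_excess_lt hstat herg hfb (ENNReal.natCast_ne_top B)
    (fun ω => min_le_right _ _) (c := c)
    (lt_of_le_of_lt (by gcongr with ω; exact min_le_left _ _) hc) hε
  have hft : Measurable fun ω => f ω - B := hf.sub_const _
  have hg : Measurable fun ω =>
      cubeSum (fun ω => min (f ω) B) N ω / (cube (Fin d) N).card - c :=
    ((measurable_cubeSum hstat hfb N).div_const _).sub_const _
  filter_upwards [eventually_cubeSum_shift_smul_le hstat herg hft (k := 2) (m := n + 3) (by omega)
      (by omega) hn (hto _ hB), eventually_cubeSum_shift_smul_le hstat herg hg (k := 3)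
      (m := n + 3) (by omega) (by omega) hn (hto _ hN)] with ω h1 h2
  filter_upwards [h1, h2, eventually_ge_atTop N, eventually_ge_atTop 1] with R h1 h2 hR hR1
  set ω' := shift ((R : ℤ) • z) ω
  have hsplit : ∀ ω, f ω ≤ min (f ω) B + (f ω - B) := fun ω => by
    rcases le_total (f ω) B with h | h
    · rw [min_eq_left h]; exact le_self_add
    · rw [min_eq_right h, add_tsub_cancel_of_le h]
  have hcard : ((cube (Fin d) N).card : ℝ≥0∞) ≠ 0 := by
    rw [card_cube]; positivity
  have h3 : cubeSum (fun ω => min (f ω) B) (2 * R) ω' ≤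
      cubeSum (fun ω => cubeSum (fun ω => min (f ω) B) N ω / (cube (Fin d) N).card) (3 * R) ω' := by
    have h4 := card_mul_cubeSum_le (fun ω => min (f ω) B) N (2 * R) (3 * R) (by omega) ω'
    rw [mul_comm, ← ENNReal.le_div_iff_mul_le (Or.inl hcard)
      (Or.inl (ENNReal.natCast_ne_top _))] at h4
    refine h4.trans_eq ?_
    simp only [cubeSum, div_eq_mul_inv, Finset.sum_mul]
  have h5 : cubeSum (fun ω => cubeSum (fun ω => min (f ω) B) N ω / (cube (Fin d) N).card)
      (3 * R) ω' ≤ (cube (Fin d) R).card + 3 ^ d * (cube (Fin d) R).card * c := by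
    refine (cubeSum_mono (g := fun ω => (cubeSum (fun ω => min (f ω) B) N ω /
      (cube (Fin d) N).card - c) + c) (fun ω => le_tsub_add) (3 * R) ω').trans ?_
    rw [cubeSum_add _ (fun _ => (c : ℝ≥0∞)), cubeSum_const]
    gcongr
    exact_mod_cast card_cube_mul_le d 3 R (by norm_num)
  have h6 : ((cube (Fin d) R).card : ℝ≥0∞) ≤ 3 ^ d * R ^ d := by
    rw [card_cube, Fintype.card_fin, ← mul_pow]
    have : 2 * R + 1 ≤ 3 * R := by omega
    exact_mod_cast Nat.pow_le_pow_left this d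
  calc cubeSum f (2 * R) ω' ≤ cubeSum (fun ω => min (f ω) B) (2 * R) ω' +
        cubeSum (fun ω => f ω - B) (2 * R) ω' := by
        rw [← cubeSum_add]; exact cubeSum_mono hsplit _ _
    _ ≤ ((cube (Fin d) R).card + 3 ^ d * (cube (Fin d) R).card * c) + (cube (Fin d) R).card :=
        add_le_add (h3.trans h5) h1
    _ = (cube (Fin d) R).card * (2 + 3 ^ d * c) := by ring
    _ ≤ 3 ^ d * R ^ d * (2 + 3 ^ d * c) := by gcongr
    _ = ENNReal.ofReal (R ^ d * (3 ^ d * (2 + 3 ^ d * c))) := by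
        rw [show (R : ℝ) ^ d * (3 ^ d * (2 + 3 ^ d * c)) =
          ((3 ^ d * R ^ d * (2 + 3 ^ d * c) : ℕ) : ℝ) by push_cast; ring, ENNReal.ofReal_natCast]
        push_cast
        ring

/-! ### Conductances at the origin and the `L²` space of edges -/

theorem adj_zero_iff {d : ℕ} (x : Fin d → ℤ) :
    (lattice d).Adj 0 x ↔ ∃ i, x = Pi.single i 1 ∨ x = -Pi.single i 1 := by
  have h : (lattice d).Adj 0 x ↔ ∑ i, x i ^ 2 = 1 := by simp [lattice]
  rw [h]
  constructor
  · intro hx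
    obtain ⟨i, hi⟩ : ∃ i, x i ≠ 0 := by
      by_contra hcon
      push Not at hcon
      simp [hcon] at hx
    rw [← Finset.add_sum_erase _ _ (Finset.mem_univ i)] at hx
    have h1 : 0 ≤ ∑ j ∈ Finset.univ.erase i, x j ^ 2 := Finset.sum_nonneg fun j _ => sq_nonneg _
    have h2 : 0 < x i ^ 2 := by positivity
    have h3 : x i ^ 2 = 1 := by omega
    have h4 : ∑ j ∈ Finset.univ.erase i, x j ^ 2 = 0 := by omega
    rw [Finset.sum_eq_zero_iff_of_nonneg fun j _ => sq_nonneg _] at h4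
    have h5 : ∀ j, j ≠ i → x j = 0 := fun j hj => by
      have := h4 j (Finset.mem_erase.2 ⟨hj, Finset.mem_univ j⟩)
      exact pow_eq_zero_iff (two_ne_zero) |>.1 this
    refine ⟨i, ?_⟩
    rcases (sq_eq_sq_iff_eq_or_eq_neg (b := (1 : ℤ))).1 (by rw [h3]; norm_num) with h6 | h6
    · left
      funext j
      by_cases hj : j = i
      · subst hj; simp [h6]
      · simp [h5 j hj, hj]
    · right
      funext j
      by_cases hj : j = i
      · subst hj; simp [h6]
      · simp [h5 j hj, hj]
  · rintro ⟨i, rfl | rfl⟩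
    · rw [Finset.sum_eq_single i] <;> simp +contextual
    · rw [Finset.sum_eq_single i] <;> simp +contextual

theorem adj_iff_adj_zero_sub {d : ℕ} (x y : Fin d → ℤ) :
    (lattice d).Adj x y ↔ (lattice d).Adj 0 (y - x) := by
  simp only [lattice, Pi.zero_apply, Pi.sub_apply]
  rw [Finset.sum_congr rfl fun i _ => show (x i - y i) ^ 2 = (0 - (y i - x i)) ^ 2 by ring]

theorem conductance_nonneg {d : ℕ} (ω : Env d) (x y : Fin d → ℤ) : 0 ≤ conductance ω x y := by
  unfold conductance
  split_ifs with h
  · exact (ω ⟨s(x, y), h⟩).2.le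
  · exact le_rfl

theorem conductance_pos {d : ℕ} (ω : Env d) {x y : Fin d → ℤ} (h : (lattice d).Adj x y) :
    0 < conductance ω x y := by
  rw [conductance, dif_pos h]
  exact (ω ⟨s(x, y), h⟩).2

theorem conductance_eq_shift {d : ℕ} (ω : Env d) (x y : Fin d → ℤ) :
    conductance ω x y = conductance (shift x ω) 0 (y - x) := by
  unfold conductance
  by_cases h : (lattice d).Adj x y
  · have h' := (adj_iff_adj_zero_sub x y).1 h
    rw [dif_pos h, dif_pos h']
    simp only [shift]
    congr 2
    apply Subtype.ext
    simp [Bond.shift]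
  · have h' : ¬ (lattice d).Adj 0 (y - x) := fun h' => h ((adj_iff_adj_zero_sub x y).2 h')
    rw [dif_neg h, dif_neg h']

theorem conductance_comm {d : ℕ} (ω : Env d) (x y : Fin d → ℤ) :
    conductance ω x y = conductance ω y x := by
  unfold conductance
  by_cases h : (lattice d).Adj x y
  · rw [dif_pos h, dif_pos h.symm]
    congr 2
    exact Subtype.ext Sym2.eq_swap
  · rw [dif_neg h, dif_neg fun h' => h h'.symm]

theorem measurable_conductance {d : ℕ} (x y : Fin d → ℤ) :
    Measurable fun ω : Env d => conductance ω x y := by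
  unfold conductance
  by_cases h : (lattice d).Adj x y
  · simp only [h, dif_pos]
    exact measurable_subtype_coe.comp (measurable_pi_apply _)
  · simp only [h, dif_neg, not_false_eq_true]
    exact measurable_const

theorem adj_zero_single {d : ℕ} (i : Fin d) : (lattice d).Adj 0 (Pi.single i 1) :=
  (adj_zero_iff _).2 ⟨i, Or.inl rfl⟩

/-- The bond `{0, eᵢ}`. -/
def unitBond {d : ℕ} (i : Fin d) : Bond d := ⟨s(0, Pi.single i 1), adj_zero_single i⟩

/-- The conductance of the bond `{0, eᵢ}`. -/
def unitCond {d : ℕ} (i : Fin d) (ω : Env d) : ℝ := ω (unitBond i)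

theorem unitCond_pos {d : ℕ} (i : Fin d) (ω : Env d) : 0 < unitCond i ω := (ω (unitBond i)).2

theorem measurable_unitCond {d : ℕ} (i : Fin d) : Measurable (unitCond i) :=
  measurable_subtype_coe.comp (measurable_pi_apply _)

theorem conductance_zero_single {d : ℕ} (i : Fin d) (ω : Env d) :
    conductance ω 0 (Pi.single i 1) = unitCond i ω := by
  rw [conductance, dif_pos (adj_zero_single i)]
  rfl

theorem conductance_zero_neg_single {d : ℕ} (i : Fin d) (ω : Env d) :
    conductance ω 0 (-Pi.single i 1) = unitCond i (shift (-Pi.single i 1) ω) := by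
  rw [conductance_comm, conductance_eq_shift, zero_sub, neg_neg, conductance_zero_single]

theorem tsum_eq_sum_neighbours {d : ℕ} {M : Type*} [AddCommMonoid M] [TopologicalSpace M]
    (F : (Fin d → ℤ) → M) (hF : ∀ x, ¬ (lattice d).Adj 0 x → F x = 0) :
    ∑' x, F x = ∑ i, (F (Pi.single i 1) + F (-Pi.single i 1)) := by
  classical
  set S : Finset (Fin d → ℤ) := Finset.univ.image fun i : Fin d => Pi.single i 1 with hS
  set T : Finset (Fin d → ℤ) := Finset.univ.image fun i : Fin d => -Pi.single i 1 with hT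
  have hinj : Function.Injective fun i : Fin d => (Pi.single i 1 : Fin d → ℤ) := by
    intro i j hij
    by_contra h
    have := congrFun hij i
    simp [Pi.single_eq_of_ne h] at this
  have hdisj : Disjoint S T := by
    rw [Finset.disjoint_left]
    intro x hx hx'
    obtain ⟨i, _, rfl⟩ := Finset.mem_image.1 hx
    obtain ⟨j, _, hj⟩ := Finset.mem_image.1 hx'
    have h1 := congrFun hj i
    simp only [Pi.neg_apply, Pi.single_eq_same] at h1
    by_cases h : i = j
    · subst h; simp at h1
    · simp [Pi.single_eq_of_ne h] at h1
  rw [tsum_eq_sum (s := S ∪ T), Finset.sum_union hdisj, hS, hT,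
    Finset.sum_image fun i _ j _ h => hinj h,
    Finset.sum_image fun i _ j _ h => hinj (neg_injective h), Finset.sum_add_distrib]
  intro x hx
  refine hF x fun hadj => hx ?_
  obtain ⟨i, rfl | rfl⟩ := (adj_zero_iff x).1 hadj
  · exact Finset.mem_union_left _ (Finset.mem_image_of_mem _ (Finset.mem_univ i))
  · exact Finset.mem_union_right _ (Finset.mem_image.2 ⟨i, Finset.mem_univ i, rfl⟩)

theorem conductance_of_not_adj {d : ℕ} {ω : Env d} {x y : Fin d → ℤ}
    (h : ¬ (lattice d).Adj x y) : conductance ω x y = 0 := by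
  rw [conductance, dif_neg h]

/-- The measure on pairs (environment, point) whose `L²` space contains `L²_cov`. -/
noncomputable def edgeMeasure {d : ℕ} (P : Measure (Env d)) : Measure (Env d × (Fin d → ℤ)) :=
  (P.prod Measure.count).withDensity fun a => ENNReal.ofReal (conductance a.1 0 a.2)

theorem measurable_edgeDensity {d : ℕ} :
    Measurable fun a : Env d × (Fin d → ℤ) => ENNReal.ofReal (conductance a.1 0 a.2) :=
  measurable_from_prod_countable_left fun x => (measurable_conductance 0 x).ennreal_ofReal

theorem lintegral_edgeMeasure {d : ℕ} (P : Measure (Env d)) [SFinite P]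
    {F : Env d × (Fin d → ℤ) → ℝ≥0∞} (hF : Measurable F) :
    ∫⁻ a, F a ∂(edgeMeasure P) =
      ∫⁻ ω, ∑' x, ENNReal.ofReal (conductance ω 0 x) * F (ω, x) ∂P := by
  rw [edgeMeasure, lintegral_withDensity_eq_lintegral_mul _ measurable_edgeDensity hF,
    lintegral_prod _ (measurable_edgeDensity.mul hF).aemeasurable]
  refine lintegral_congr fun ω => ?_
  rw [lintegral_count]
  rfl

theorem measurable_uncurry {d : ℕ} {Ψ : Env d → (Fin d → ℤ) → ℝ}
    (h : ∀ x, Measurable fun ω => Ψ ω x) : Measurable (Function.uncurry Ψ) :=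
  measurable_from_prod_countable_left h

theorem covNormSq_eq_lintegral {d : ℕ} (P : Measure (Env d)) [SFinite P]
    {Ψ : Env d → (Fin d → ℤ) → ℝ} (h : ∀ x, Measurable fun ω => Ψ ω x) :
    covNormSq P Ψ = ∫⁻ a, ‖Function.uncurry Ψ a‖ₑ ^ (2 : ℝ) ∂(edgeMeasure P) := by
  rw [lintegral_edgeMeasure P ((measurable_uncurry h).enorm.pow_const _)]
  refine lintegral_congr fun ω => tsum_congr fun x => ?_
  rw [ENNReal.ofReal_mul (conductance_nonneg _ _ _)]
  congr 1
  rw [Function.uncurry_apply_pair, Real.enorm_eq_ofReal_abs, ENNReal.ofReal_rpow_of_nonneg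
    (abs_nonneg _) (by norm_num), ← sq_abs, Real.rpow_two]

theorem covNormSq_eq_eLpNorm {d : ℕ} (P : Measure (Env d)) [SFinite P]
    {Ψ : Env d → (Fin d → ℤ) → ℝ} (h : ∀ x, Measurable fun ω => Ψ ω x) :
    covNormSq P Ψ = eLpNorm (Function.uncurry Ψ) 2 (edgeMeasure P) ^ (2 : ℝ) := by
  rw [covNormSq_eq_lintegral P h, eLpNorm_eq_lintegral_rpow_enorm_toReal (by norm_num)
    (by norm_num)]
  simp only [ENNReal.toReal_ofNat]
  rw [← ENNReal.rpow_mul]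
  norm_num

theorem memLp_iff_covNormSq_lt_top {d : ℕ} (P : Measure (Env d)) [SFinite P]
    {Ψ : Env d → (Fin d → ℤ) → ℝ} (h : ∀ x, Measurable fun ω => Ψ ω x) :
    MemLp (Function.uncurry Ψ) 2 (edgeMeasure P) ↔ covNormSq P Ψ < ∞ := by
  rw [covNormSq_eq_eLpNorm P h, ENNReal.rpow_lt_top_iff_of_pos (by norm_num)]
  exact ⟨fun h => h.2, fun h' => ⟨(measurable_uncurry h).aestronglyMeasurable, h'⟩⟩

theorem MemL2cov.memLp {d : ℕ} {P : Measure (Env d)} [SFinite P]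
    {Ψ : Env d → (Fin d → ℤ) → ℝ} (h : MemL2cov P Ψ) :
    MemLp (Function.uncurry Ψ) 2 (edgeMeasure P) :=
  (memLp_iff_covNormSq_lt_top P h.measurable).2 h.norm_lt_top

theorem covInner_eq_integral {d : ℕ} (P : Measure (Env d)) [SFinite P]
    {Ψ Θ : Env d → (Fin d → ℤ) → ℝ} (hΨ : MemLp (Function.uncurry Ψ) 2 (edgeMeasure P))
    (hΘ : MemLp (Function.uncurry Θ) 2 (edgeMeasure P)) :
    covInner P Ψ Θ = ∫ a, Function.uncurry Ψ a * Function.uncurry Θ a ∂(edgeMeasure P) := by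
  have hint : Integrable (fun a => Function.uncurry Ψ a * Function.uncurry Θ a) (edgeMeasure P) :=
    hΨ.integrable_mul hΘ
  have hfin : ∀ᵐ a ∂(P.prod Measure.count),
      ENNReal.ofReal (conductance (d := d) a.1 0 a.2) < ∞ :=
    Eventually.of_forall fun _ => ENNReal.ofReal_lt_top
  rw [edgeMeasure] at hint ⊢
  rw [integrable_withDensity_iff_integrable_smul' measurable_edgeDensity hfin] at hint
  rw [integral_withDensity_eq_integral_toReal_smul measurable_edgeDensity hfin,
    integral_prod _ hint, covInner]
  refine integral_congr_ae ?_
  filter_upwards [hint.prod_right_ae] with ω hω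
  rw [integral_countable hω]
  refine tsum_congr fun x => ?_
  simp [Measure.real, ENNReal.toReal_ofReal (conductance_nonneg _ _ _), mul_assoc]

end RandomConductance

/-! ### Existence of the corrector by orthogonal projection -/

namespace RandomConductance

variable {d : ℕ} {P : Measure (Env d)}

theorem MemL2cov.add [SFinite P] {Ψ Θ : Env d → (Fin d → ℤ) → ℝ} (hΨ : MemL2cov P Ψ)
    (hΘ : MemL2cov P Θ) : MemL2cov P (fun ω x => Ψ ω x + Θ ω x) := by
  have hm : ∀ x, Measurable fun ω => Ψ ω x + Θ ω x := fun x =>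
    (hΨ.measurable x).add (hΘ.measurable x)
  refine ⟨hm, ?_, ?_⟩
  · filter_upwards [hΨ.cocycle, hΘ.cocycle] with ω h1 h2 x y
    rw [h1, h2]; ring
  · exact (memLp_iff_covNormSq_lt_top P hm).1 (hΨ.memLp.add hΘ.memLp)

theorem MemL2cov.const_mul [SFinite P] {Ψ : Env d → (Fin d → ℤ) → ℝ} (c : ℝ)
    (hΨ : MemL2cov P Ψ) : MemL2cov P (fun ω x => c * Ψ ω x) := by
  have hm : ∀ x, Measurable fun ω => c * Ψ ω x := fun x => (hΨ.measurable x).const_mul c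
  refine ⟨hm, ?_, ?_⟩
  · filter_upwards [hΨ.cocycle] with ω h1 x y
    rw [h1]; ring
  · exact (memLp_iff_covNormSq_lt_top P hm).1 (hΨ.memLp.const_mul c)

theorem MemL2cov.sub [SFinite P] {Ψ Θ : Env d → (Fin d → ℤ) → ℝ} (hΨ : MemL2cov P Ψ)
    (hΘ : MemL2cov P Θ) : MemL2cov P (fun ω x => Ψ ω x - Θ ω x) := by
  have := hΨ.add (hΘ.const_mul (-1))
  simpa only [neg_one_mul, ← sub_eq_add_neg] using this

theorem IsLocal.add {φ ψ : Env d → ℝ} (hφ : IsLocal φ) (hψ : IsLocal ψ) :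
    IsLocal (fun ω => φ ω + ψ ω) := by
  classical
  obtain ⟨hm, S, hS⟩ := hφ
  obtain ⟨hm', T, hT⟩ := hψ
  refine ⟨hm.add hm', S ∪ T, fun ω ω' h => ?_⟩
  have h1 : φ ω = φ ω' := hS fun e he => h e (by push_cast; exact Or.inl he)
  have h2 : ψ ω = ψ ω' := hT fun e he => h e (by push_cast; exact Or.inr he)
  simp only [h1, h2]

theorem IsLocal.comp {φ : Env d → ℝ} (hφ : IsLocal φ) {g : ℝ → ℝ} (hg : Measurable g) :
    IsLocal (fun ω => g (φ ω)) := by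
  obtain ⟨hm, S, hS⟩ := hφ
  exact ⟨hg.comp hm, S, fun ω ω' h => congrArg g (hS h)⟩

/-- The gradients of local functions in `L²`. -/
noncomputable def gradSubmodule (P : Measure (Env d)) [SFinite P] :
    Submodule ℝ (Lp ℝ 2 (edgeMeasure P)) where
  carrier := {f | ∃ φ : Env d → ℝ, IsLocal φ ∧ MemL2cov P (horizDeriv φ) ∧
    f =ᵐ[edgeMeasure P] Function.uncurry (horizDeriv φ)}
  add_mem' := by
    rintro f g ⟨φ, hφ, hφ', hf⟩ ⟨ψ, hψ, hψ', hg⟩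
    have e : horizDeriv (fun ω => φ ω + ψ ω) = fun ω x => horizDeriv φ ω x + horizDeriv ψ ω x := by
      funext ω x
      simp only [horizDeriv]; ring
    refine ⟨fun ω => φ ω + ψ ω, hφ.add hψ, by rw [e]; exact hφ'.add hψ', ?_⟩
    rw [e]
    filter_upwards [Lp.coeFn_add f g, hf, hg] with a h1 h2 h3
    rw [h1, Pi.add_apply, h2, h3]
    rfl
  zero_mem' := by
    have e : horizDeriv (fun _ : Env d => (0 : ℝ)) = fun _ _ => 0 := by
      funext ω x
      simp [horizDeriv]
    refine ⟨fun _ => 0, ⟨measurable_const, ∅, fun _ _ _ => rfl⟩, ?_, ?_⟩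
    · rw [e]
      exact ⟨fun _ => measurable_const, Eventually.of_forall fun _ _ _ => by simp,
        by simp [covNormSq]⟩
    · rw [e]
      exact Lp.coeFn_zero ℝ 2 (edgeMeasure P)
  smul_mem' := by
    rintro c f ⟨φ, hφ, hφ', hf⟩
    have e : horizDeriv (fun ω => c * φ ω) = fun ω x => c * horizDeriv φ ω x := by
      funext ω x
      simp only [horizDeriv]; ring
    refine ⟨fun ω => c * φ ω, hφ.comp (measurable_const_mul c), by rw [e]; exact hφ'.const_mul c, ?_⟩
    rw [e]
    filter_upwards [Lp.coeFn_smul c f, hf] with a h1 h2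
    rw [h1, Pi.smul_apply, h2]
    rfl

theorem covNormSq_sub_eq [SFinite P] {Ψ Θ : Env d → (Fin d → ℤ) → ℝ}
    (hΨ : MemL2cov P Ψ) (hΘ : MemL2cov P Θ) :
    covNormSq P (fun ω x => Ψ ω x - Θ ω x) =
      ‖hΨ.memLp.toLp _ - hΘ.memLp.toLp _‖ₑ ^ (2 : ℝ) := by
  rw [covNormSq_eq_eLpNorm P (hΨ.sub hΘ).measurable, ← MemLp.toLp_sub, Lp.enorm_toLp]
  rfl

/-- Translates the definition by approximation into membership in a closed subspace of a Hilbert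
space; the tolerances differ by a square root, as `covNormSq` is the squared norm. -/
theorem memL2pot_iff [SFinite P] {Ψ : Env d → (Fin d → ℤ) → ℝ} (hΨ : MemL2cov P Ψ) :
    MemL2pot P Ψ ↔ hΨ.memLp.toLp _ ∈ (gradSubmodule P).topologicalClosure := by
  rw [← SetLike.mem_coe, Submodule.topologicalClosure_coe, EMetric.mem_closure_iff]
  constructor
  · rintro ⟨_, h⟩ ε hε
    obtain ⟨φ, hφ, hφ', hlt⟩ := h (ε ^ (2 : ℝ)) (ENNReal.rpow_pos_of_nonneg hε (by norm_num))
    refine ⟨hφ'.memLp.toLp _, ⟨φ, hφ, hφ', MemLp.coeFn_toLp _⟩, ?_⟩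
    rw [covNormSq_sub_eq hΨ hφ', ENNReal.rpow_lt_rpow_iff (by norm_num)] at hlt
    rwa [edist_eq_enorm_sub]
  · intro h
    refine ⟨hΨ, fun ε hε => ?_⟩
    obtain ⟨f, ⟨φ, hφ, hφ', hf⟩, hlt⟩ := h (ε ^ (1 / 2 : ℝ))
      (ENNReal.rpow_pos_of_nonneg hε (by norm_num))
    refine ⟨φ, hφ, hφ', ?_⟩
    have e : f = hφ'.memLp.toLp _ := Lp.ext (hf.trans (MemLp.coeFn_toLp _).symm)
    rw [e, edist_eq_enorm_sub] at hlt
    rw [covNormSq_sub_eq hΨ hφ']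
    have := ENNReal.rpow_lt_rpow hlt (z := 2) (by norm_num)
    rwa [← ENNReal.rpow_mul, show (1 / 2 : ℝ) * 2 = 1 by norm_num, ENNReal.rpow_one] at this

theorem covInner_eq_inner [SFinite P] {Ψ Θ : Env d → (Fin d → ℤ) → ℝ}
    (hΨ : MemL2cov P Ψ) (hΘ : MemL2cov P Θ) :
    covInner P Ψ Θ = inner ℝ (hΨ.memLp.toLp _) (hΘ.memLp.toLp _) := by
  rw [covInner_eq_integral P hΨ.memLp hΘ.memLp, L2.inner_def]
  refine integral_congr_ae ?_
  filter_upwards [hΨ.memLp.coeFn_toLp, hΘ.memLp.coeFn_toLp] with a h1 h2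
  rw [h1, h2]
  simp [mul_comm]

/-- If increments of a sequence of functions along unit vectors converge everywhere, then so do
all increments. -/
theorem exists_tendsto_sub {f : ℕ → (Fin d → ℤ) → ℝ}
    (h : ∀ z i, ∃ l, Tendsto (fun k => f k (z + Pi.single i 1) - f k z) atTop (𝓝 l))
    (y : Fin d → ℤ) : ∃ l, Tendsto (fun k => f k y - f k 0) atTop (𝓝 l) := by
  -- The directions along which increments from every base point converge form a subgroup, and the
  -- unit vectors generate `ℤ^d`.
  let G : AddSubgroup (Fin d → ℤ) :=
    { carrier := {y | ∀ z, ∃ l, Tendsto (fun k => f k (z + y) - f k z) atTop (𝓝 l)}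
      add_mem' := by
        intro a b ha hb z
        obtain ⟨l, hl⟩ := ha z
        obtain ⟨l', hl'⟩ := hb (z + a)
        refine ⟨l + l', (hl.add hl').congr fun k => ?_⟩
        rw [← add_assoc]; ring
      zero_mem' := fun z => ⟨0, by simp⟩
      neg_mem' := by
        intro a ha z
        obtain ⟨l, hl⟩ := ha (z + -a)
        refine ⟨-l, hl.neg.congr fun k => ?_⟩
        rw [neg_add_cancel_right]; ring }
  have hG : y ∈ G := by
    rw [pi_eq_sum_univ' y]
    exact sum_mem fun i _ => zsmul_mem (show Pi.single i 1 ∈ G from fun z => h z i) _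
  simpa using hG 0

theorem ae_forall_shift (hstat : IsStationary P) {p : Env d → Prop} (h : ∀ᵐ ω ∂P, p ω) :
    ∀ᵐ ω ∂P, ∀ z, p (shift z ω) :=
  ae_all_iff.2 fun z => (hstat z).quasiMeasurePreserving.tendsto_ae.eventually h

/-- The edge measure has positive density at the neighbours of the origin, so its null sets are
visible there for almost every environment. -/
theorem ae_of_ae_edgeMeasure [SFinite P] {p : Env d × (Fin d → ℤ) → Prop}
    (h : ∀ᵐ a ∂(edgeMeasure P), p a) :
    ∀ᵐ ω ∂P, ∀ x, (lattice d).Adj 0 x → p (ω, x) := by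
  rw [edgeMeasure, ae_withDensity_iff measurable_edgeDensity] at h
  filter_upwards [Measure.ae_ae_of_ae_prod h] with ω hω x hx
  rw [Measure.ae_count_iff] at hω
  exact hω x (by simpa using conductance_pos ω hx)

/-- Every element of the closure of the gradients is represented by a cocycle. -/
theorem exists_memL2cov_of_mem_closure [SFinite P] (hstat : IsStationary P)
    {g : Lp ℝ 2 (edgeMeasure P)} (hg : g ∈ (gradSubmodule P).topologicalClosure) :
    ∃ χ, MemL2cov P χ ∧ Function.uncurry χ =ᵐ[edgeMeasure P] g := by
  rw [← SetLike.mem_coe, Submodule.topologicalClosure_coe, mem_closure_iff_seq_limit] at hg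
  obtain ⟨f, hf, hlim⟩ := hg
  obtain ⟨ns, -, hns⟩ := (tendstoInMeasure_of_tendsto_Lp hlim).exists_seq_tendsto_ae
  choose φ hφ hφ' hfφ using hf
  set D : ℕ → Env d → (Fin d → ℤ) → ℝ := fun k => horizDeriv (φ (ns k)) with hD
  have hconv : ∀ᵐ a ∂(edgeMeasure P), Tendsto (fun k => Function.uncurry (D k) a) atTop
      (𝓝 (g a)) := by
    have h1 : ∀ᵐ a ∂(edgeMeasure P), ∀ k, f (ns k) a = Function.uncurry (D k) a :=
      ae_all_iff.2 fun k => hfφ (ns k)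
    filter_upwards [hns, h1] with a h2 h3
    simpa only [h3] using h2
  have hDm : ∀ k x, Measurable fun ω => D k ω x := fun k => (hφ' (ns k)).measurable
  -- The `limsup` is measurable and defined everywhere. Convergence on the bonds at the origin,
  -- applied at all translates of the environment, shows that it is a genuine limit at every `x`,
  -- and the cocycle property passes to the limit.
  set χ : Env d → (Fin d → ℤ) → ℝ := fun ω x => limsup (fun k => D k ω x) atTop with hχ
  have hχm : ∀ x, Measurable fun ω => χ ω x := fun x => Measurable.limsup fun k => hDm k x
  have hχg : Function.uncurry χ =ᵐ[edgeMeasure P] g := by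
    filter_upwards [hconv] with a ha
    exact ha.limsup_eq
  refine ⟨χ, ⟨hχm, ?_, ?_⟩, hχg⟩
  · filter_upwards [ae_forall_shift hstat (ae_of_ae_edgeMeasure hconv)] with ω hω
    have hinc : ∀ z i, ∃ l, Tendsto (fun k => φ (ns k) (shift (z + Pi.single i 1) ω) -
        φ (ns k) (shift z ω)) atTop (𝓝 l) := fun z i => by
      refine ⟨_, (hω z _ (adj_zero_single i)).congr fun k => ?_⟩
      simp only [Function.uncurry_apply_pair, hD, horizDeriv, shift_shift]
      rw [add_comm]
    have hall : ∀ y, Tendsto (fun k => D k ω y) atTop (𝓝 (χ ω y)) := fun y => by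
      obtain ⟨l, hl⟩ := exists_tendsto_sub (f := fun k z => φ (ns k) (shift z ω)) hinc y
      have h2 : Tendsto (fun k => D k ω y) atTop (𝓝 l) := by
        refine hl.congr fun k => ?_
        simp only [shift_zero, hD, horizDeriv]
      have h3 : χ ω y = l := h2.limsup_eq
      rwa [h3]
    intro x y
    refine Tendsto.limsup_eq (((hall y).sub (hall x)).congr fun k => ?_)
    simp only [hD, horizDeriv, shift_shift, sub_add_cancel]
    ring
  · rw [← memLp_iff_covNormSq_lt_top P hχm]
    exact (memLp_congr_ae hχg).2 (Lp.memLp g)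

theorem covNormSq_lt_top_of_bounded [SFinite P] (hstat : IsStationary P)
    (hint : ∀ i, Integrable (unitCond i) P) {Ψ : Env d → (Fin d → ℤ) → ℝ} {B : ℝ}
    (hB : ∀ ω x, (lattice d).Adj 0 x → |Ψ ω x| ≤ B) : covNormSq P Ψ < ∞ := by
  have h : ∀ ω : Env d, ∑' x : Fin d → ℤ, ENNReal.ofReal (conductance ω 0 x * Ψ ω x ^ 2) ≤
      ∑ i, (ENNReal.ofReal (unitCond i ω * B ^ 2) +
        ENNReal.ofReal (unitCond i (shift (-Pi.single i 1) ω) * B ^ 2)) := by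
    intro ω
    rw [tsum_eq_sum_neighbours _ fun x hx => by simp [conductance_of_not_adj hx]]
    refine Finset.sum_le_sum fun i _ => ?_
    rw [conductance_zero_single, conductance_zero_neg_single]
    refine add_le_add (ENNReal.ofReal_le_ofReal ?_) (ENNReal.ofReal_le_ofReal ?_)
    · exact mul_le_mul_of_nonneg_left (sq_le_sq' (abs_le.1 (hB ω _ (adj_zero_single i))).1
        (abs_le.1 (hB ω _ (adj_zero_single i))).2) (unitCond_pos i _).le
    · have hadj : (lattice d).Adj 0 (-Pi.single i 1) := (adj_zero_iff _).2 ⟨i, Or.inr rfl⟩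
      exact mul_le_mul_of_nonneg_left (sq_le_sq' (abs_le.1 (hB ω _ hadj)).1
        (abs_le.1 (hB ω _ hadj)).2) (unitCond_pos i _).le
  refine (lintegral_mono h).trans_lt ?_
  have hm : ∀ i, Measurable fun ω : Env d => ENNReal.ofReal (unitCond i ω * B ^ 2) := fun i =>
    ((measurable_unitCond i).mul_const _).ennreal_ofReal
  rw [lintegral_finsetSum (f := fun i ω => ENNReal.ofReal (unitCond i ω * B ^ 2) +
    ENNReal.ofReal (unitCond i (shift (-Pi.single i 1) ω) * B ^ 2)) _
    fun i _ => (hm i).add ((hm i).comp (hstat _).measurable)]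
  refine ENNReal.sum_lt_top.2 fun i _ => ?_
  have h2 := (hstat (-Pi.single i 1)).lintegral_comp (hm i)
  rw [lintegral_add_left (hm i), h2]
  have h3 : ∫⁻ ω, ENNReal.ofReal (unitCond i ω * B ^ 2) ∂P < ∞ := by
    refine lt_of_le_of_lt (lintegral_mono fun ω => ?_) ((hint i).mul_const (B ^ 2)).2
    rw [Real.enorm_eq_ofReal_abs]
    exact ENNReal.ofReal_le_ofReal (le_abs_self _)
  exact ENNReal.add_lt_top.2 ⟨h3, h3⟩

theorem memL2cov_position [SFinite P] (hstat : IsStationary P)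
    (hint : ∀ i, Integrable (unitCond i) P) (j : Fin d) :
    MemL2cov P (fun _ x => (x j : ℝ)) := by
  refine ⟨fun x => measurable_const, Eventually.of_forall fun ω x y => by simp,
    covNormSq_lt_top_of_bounded hstat hint (B := 1) fun ω x hx => ?_⟩
  obtain ⟨i, rfl | rfl⟩ := (adj_zero_iff x).1 hx <;>
  · by_cases hij : j = i
    · subst hij; simp
    · simp [hij]

theorem exists_isCorrector [SFinite P] (hstat : IsStationary P)
    (hint : ∀ i, Integrable (unitCond i) P) (j : Fin d) :
    ∃ χ : Env d → (Fin d → ℤ) → ℝ, IsCorrector P j χ := by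
  have hpos := memL2cov_position hstat hint j
  set K := (gradSubmodule P).topologicalClosure with hK
  have : CompleteSpace K := (Submodule.isClosed_topologicalClosure _).completeSpace_coe
  set π := hpos.memLp.toLp _ with hπ
  have hmem : K.starProjection π ∈ K := Submodule.starProjection_apply_mem K π
  obtain ⟨χ, hχ, hχg⟩ := exists_memL2cov_of_mem_closure hstat hmem
  have e : hχ.memLp.toLp _ = K.starProjection π :=
    Lp.ext ((MemLp.coeFn_toLp _).trans hχg)
  refine ⟨χ, (memL2pot_iff hχ).2 (by rw [e]; exact hmem), hpos.sub hχ, fun Θ hΘ => ?_⟩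
  rw [covInner_eq_inner (hpos.sub hχ) hΘ.1]
  -- The class of `Π_j - χ` is the component of `Π_j` orthogonal to the closure of the gradients.
  have e2 : (hpos.sub hχ).memLp.toLp _ = π - K.starProjection π := by
    rw [← e, hπ, ← MemLp.toLp_sub]
    rfl
  rw [e2]
  exact Submodule.inner_left_of_mem_orthogonal ((memL2pot_iff hΘ.1).1 hΘ)
    (Submodule.sub_starProjection_mem_orthogonal π)

end RandomConductance

/-! ### Solenoidal fields are harmonic -/

namespace RandomConductance

variable {d : ℕ} {P : Measure (Env d)}

theorem memL2cov_horizDeriv_of_bounded [SFinite P] (hstat : IsStationary P)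
    (hint : ∀ i, Integrable (unitCond i) P) {φ : Env d → ℝ} (hφ : Measurable φ) {B : ℝ}
    (hB : ∀ ω, |φ ω| ≤ B) : MemL2cov P (horizDeriv φ) := by
  refine ⟨fun x => (hφ.comp (hstat x).measurable).sub hφ, Eventually.of_forall fun ω x y => ?_,
    covNormSq_lt_top_of_bounded hstat hint (B := B + B) fun ω x _ => ?_⟩
  · simp only [horizDeriv, shift_shift, sub_add_cancel]
    ring
  · exact (abs_sub _ _).trans (add_le_add (hB _) (hB _))

theorem memL2pot_horizDeriv [SFinite P] {φ : Env d → ℝ} (hφ : IsLocal φ)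
    (h : MemL2cov P (horizDeriv φ)) : MemL2pot P (horizDeriv φ) :=
  ⟨h, fun ε hε => ⟨φ, hφ, h, by simpa [covNormSq] using hε⟩⟩

theorem lintegral_unitCond_mul_sq_le {Ψ : Env d → (Fin d → ℤ) → ℝ} (i : Fin d) :
    ∫⁻ ω, ENNReal.ofReal (unitCond i ω * Ψ ω (Pi.single i 1) ^ 2) ∂P ≤ covNormSq P Ψ := by
  refine lintegral_mono fun ω => ?_
  rw [← conductance_zero_single]
  exact ENNReal.le_tsum (f := fun x => ENNReal.ofReal (conductance ω 0 x * Ψ ω x ^ 2)) _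

/-- From `a |t| ≤ a + a t²` with `a` the conductance: both terms on the right are integrable. -/
theorem MemL2cov.integrable_flux {Ψ : Env d → (Fin d → ℤ) → ℝ} (h : MemL2cov P Ψ)
    (hint : ∀ i, Integrable (unitCond i) P) (i : Fin d) :
    Integrable (fun ω => unitCond i ω * Ψ ω (Pi.single i 1)) P := by
  have h1 : Integrable (fun ω => unitCond i ω * Ψ ω (Pi.single i 1) ^ 2) P := by
    refine ⟨((measurable_unitCond i).mul ((h.measurable _).pow_const 2)).aestronglyMeasurable, ?_⟩
    refine lt_of_le_of_lt (lintegral_mono fun ω => ?_)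
      ((lintegral_unitCond_mul_sq_le (P := P) (Ψ := Ψ) i).trans_lt h.norm_lt_top)
    rw [Real.enorm_of_nonneg (mul_nonneg (unitCond_pos i ω).le (sq_nonneg _))]
  refine ((hint i).add h1).mono'
    ((measurable_unitCond i).mul (h.measurable _)).aestronglyMeasurable
    (Eventually.of_forall fun ω => ?_)
  rw [Real.norm_eq_abs, abs_mul, abs_of_pos (unitCond_pos i ω), Pi.add_apply, ← sq_abs (Ψ ω _)]
  have := unitCond_pos i ω
  nlinarith [sq_nonneg (|Ψ ω (Pi.single i 1)| - 1), abs_nonneg (Ψ ω (Pi.single i 1))]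

theorem IsCocycle.ae_zero {Ψ : Env d → (Fin d → ℤ) → ℝ} (h : IsCocycle P Ψ) :
    ∀ᵐ ω ∂P, Ψ ω 0 = 0 := by
  filter_upwards [h] with ω hω
  simpa using hω 0 0

theorem IsCocycle.ae_neg_single {Ψ : Env d → (Fin d → ℤ) → ℝ} (h : IsCocycle P Ψ) :
    ∀ᵐ ω ∂P, ∀ i, Ψ ω (-Pi.single i 1) = -Ψ (shift (-Pi.single i 1) ω) (Pi.single i 1) := by
  filter_upwards [h, h.ae_zero] with ω hω h0 i
  have := hω (-Pi.single i 1) 0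
  rw [zero_sub, neg_neg, h0] at this
  rw [this]; ring

theorem integral_comp_shift (hstat : IsStationary P) (z : Fin d → ℤ) {f : Env d → ℝ}
    (hf : Integrable f P) : ∫ ω, f (shift z ω) ∂P = ∫ ω, f ω ∂P := by
  conv_rhs => rw [← (hstat z).map_eq]
  refine (integral_map (hstat z).measurable.aemeasurable ?_).symm
  rw [(hstat z).map_eq]
  exact hf.1

/-- The divergence at the origin of a field on oriented bonds. -/
noncomputable def divergence (Φ : Env d → (Fin d → ℤ) → ℝ) (ω : Env d) : ℝ :=
  ∑ i, (unitCond i ω * Φ ω (Pi.single i 1) -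
    unitCond i (shift (-Pi.single i 1) ω) * Φ (shift (-Pi.single i 1) ω) (Pi.single i 1))

theorem integrable_divergence (hstat : IsStationary P)
    (hint : ∀ i, Integrable (unitCond i) P) {Φ : Env d → (Fin d → ℤ) → ℝ} (hΦ : MemL2cov P Φ) :
    Integrable (divergence Φ) P := by
  unfold divergence
  exact integrable_finsetSum _ fun i _ => (hΦ.integrable_flux hint i).sub
    ((hstat _).integrable_comp_of_integrable (hΦ.integrable_flux hint i))

/-- Weak form of harmonicity: the divergence of a solenoidal field is orthogonal to bounded local
functions. -/
theorem integral_divergence_mul_eq_zero [IsProbabilityMeasure P] (hstat : IsStationary P)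
    (hint : ∀ i, Integrable (unitCond i) P) {Φ : Env d → (Fin d → ℤ) → ℝ} (hΦ : MemL2sol P Φ)
    {φ : Env d → ℝ} (hφ : IsLocal φ) {B : ℝ} (hB : ∀ ω, |φ ω| ≤ B) :
    ∫ ω, divergence Φ ω * φ ω ∂P = 0 := by
  set g : Fin d → Env d → ℝ := fun i ω => unitCond i ω * Φ ω (Pi.single i 1) with hg
  have hgi : ∀ i, Integrable (g i) P := fun i => hΦ.1.integrable_flux hint i
  set S : Fin d → Env d → Env d := fun i => shift (-Pi.single i 1) with hS
  have hSm : ∀ i, MeasurePreserving (S i) P P := fun i => hstat _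
  have hgS : ∀ i, Integrable (fun ω => g i (S i ω)) P := fun i =>
    (hSm i).integrable_comp_of_integrable (hgi i)
  have hbd : ∀ {f : Env d → ℝ} (z), Integrable f P → Integrable (fun ω => f ω * φ (shift z ω)) P :=
    fun {f} z hf => hf.mul_bdd (c := B) (hφ.1.comp (hstat z).measurable).aestronglyMeasurable
      (Eventually.of_forall fun ω => by rw [Real.norm_eq_abs]; exact hB _)
  have hbd0 : ∀ {f : Env d → ℝ}, Integrable f P → Integrable (fun ω => f ω * φ ω) P :=
    fun {f} hf => by simpa only [shift_zero] using hbd 0 hf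
  have hI1 : ∀ i, ∫ ω, g i (S i ω) * φ (S i ω) ∂P = ∫ ω, g i ω * φ ω ∂P := fun i =>
    integral_comp_shift hstat _ (hbd0 (hgi i))
  have hI2 : ∀ i, ∫ ω, g i ω * φ (shift (Pi.single i 1) ω) ∂P = ∫ ω, g i (S i ω) * φ ω ∂P := by
    intro i
    rw [← integral_comp_shift hstat (-Pi.single i 1) (hbd (Pi.single i 1) (hgi i))]
    refine integral_congr_ae (Eventually.of_forall fun ω => ?_)
    simp only [hS, shift_shift, add_neg_cancel, shift_zero]
  have key : covInner P Φ (horizDeriv φ) = ∫ ω, ∑ i, (g i ω * φ (shift (Pi.single i 1) ω) -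
      g i ω * φ ω - (g i (S i ω) * φ (S i ω) - g i (S i ω) * φ ω)) ∂P := by
    refine integral_congr_ae ?_
    filter_upwards [hΦ.1.cocycle.ae_neg_single] with ω hω
    rw [tsum_eq_sum_neighbours _ fun x hx => by simp [conductance_of_not_adj hx]]
    refine Finset.sum_congr rfl fun i _ => ?_
    rw [conductance_zero_single, conductance_zero_neg_single, hω]
    simp only [horizDeriv, hg, hS]
    ring
  have hA : ∀ i, Integrable (fun ω => g i ω * φ (shift (Pi.single i 1) ω) - g i ω * φ ω) P :=
    fun i => (hbd _ (hgi i)).sub (hbd0 (hgi i))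
  have hD : ∀ i, Integrable (fun ω => g i (S i ω) * φ (S i ω) - g i (S i ω) * φ ω) P :=
    fun i => (hbd _ (hgS i)).sub (hbd0 (hgS i))
  have hdiv : ∫ ω, divergence Φ ω * φ ω ∂P =
      ∑ i, (∫ ω, g i ω * φ ω ∂P - ∫ ω, g i (S i ω) * φ ω ∂P) := by
    simp only [divergence, Finset.sum_mul, sub_mul]
    rw [integral_finsetSum (f := fun i ω => g i ω * φ ω - g i (S i ω) * φ ω) _
      fun i _ => (hbd0 (hgi i)).sub (hbd0 (hgS i))]
    exact Finset.sum_congr rfl fun i _ => integral_sub (hbd0 (hgi i)) (hbd0 (hgS i))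
  have horth := hΦ.2 _ (memL2pot_horizDeriv hφ (memL2cov_horizDeriv_of_bounded hstat hint hφ.1 hB))
  rw [key, integral_finsetSum (f := fun i ω => g i ω * φ (shift (Pi.single i 1) ω) -
      g i ω * φ ω - (g i (S i ω) * φ (S i ω) - g i (S i ω) * φ ω)) _
    fun i _ => (hA i).sub (hD i)] at horth
  -- By stationarity the two bonds at the origin in direction `±eᵢ` contribute equally to the scalar
  -- product; this explains the factor `2`.
  have hterm : ∀ i, ∫ ω, (g i ω * φ (shift (Pi.single i 1) ω) -
      g i ω * φ ω - (g i (S i ω) * φ (S i ω) - g i (S i ω) * φ ω)) ∂P =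
      -2 * (∫ ω, g i ω * φ ω ∂P - ∫ ω, g i (S i ω) * φ ω ∂P) := by
    intro i
    rw [integral_sub (hA i) (hD i), integral_sub (hbd _ (hgi i)) (hbd0 (hgi i)),
      integral_sub (hbd _ (hgS i)) (hbd0 (hgS i)), hI1, hI2]
    ring
  rw [Finset.sum_congr rfl fun i _ => hterm i, ← Finset.mul_sum, ← hdiv] at horth
  linarith

theorem isLocal_indicator {A : Set (Env d)} (hA : A ∈ measurableCylinders fun _ : Bond d => Set.Ioi (0 : ℝ)) :
    IsLocal (A.indicator fun _ => (1 : ℝ)) := by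
  classical
  obtain ⟨s, S, hS, rfl⟩ := (mem_measurableCylinders A).1 hA
  refine ⟨measurable_const.indicator (hS.cylinder s), s, fun ω ω' h => ?_⟩
  have : s.restrict ω = s.restrict ω' := by
    funext e
    exact h e.1 e.2
  simp only [Set.indicator, mem_cylinder, this]

theorem ae_divergence_eq_zero [IsProbabilityMeasure P] (hstat : IsStationary P)
    (hint : ∀ i, Integrable (unitCond i) P) {Φ : Env d → (Fin d → ℤ) → ℝ} (hΦ : MemL2sol P Φ) :
    ∀ᵐ ω ∂P, divergence Φ ω = 0 := by
  have hdi := integrable_divergence hstat hint hΦ.1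
  have hcyl : ∀ A ∈ measurableCylinders fun _ : Bond d => Set.Ioi (0 : ℝ),
      ∫ ω in A, divergence Φ ω ∂P = 0 := by
    intro A hA
    rw [← integral_indicator (MeasurableSet.of_mem_measurableCylinders hA)]
    refine Eq.trans ?_ (integral_divergence_mul_eq_zero hstat hint hΦ (isLocal_indicator hA)
      (B := 1) fun ω => by by_cases h : ω ∈ A <;> simp [h])
    refine integral_congr_ae (Eventually.of_forall fun ω => ?_)
    by_cases h : ω ∈ A <;> simp [h]
  have htot : ∫ ω, divergence Φ ω ∂P = 0 := by
    simpa using hcyl _ (univ_mem_measurableCylinders _)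
  refine hdi.ae_eq_zero_of_forall_setIntegral_eq_zero fun A hA _ => ?_
  induction A, hA using MeasurableSpace.induction_on_inter
      (generateFrom_measurableCylinders (α := fun _ : Bond d => Set.Ioi (0 : ℝ))).symm isPiSystem_measurableCylinders with
  | empty => simp
  | basic A hA => exact hcyl A hA
  | compl A hA ih =>
    have := integral_add_compl hA hdi
    rw [ih (measure_lt_top P A), htot] at this
    linarith
  | iUnion f hd hf ih =>
    rw [integral_iUnion hf hd hdi.integrableOn]
    simp [ih, measure_lt_top]

/-- Solenoidal cocycles are harmonic. -/
theorem ae_harmonicAt [IsProbabilityMeasure P] (hstat : IsStationary P)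
    (hint : ∀ i, Integrable (unitCond i) P) {Φ : Env d → (Fin d → ℤ) → ℝ} (hΦ : MemL2sol P Φ) :
    ∀ᵐ ω ∂P, ∀ x, HarmonicAt (fun i x => unitCond i (shift x ω)) (Φ ω) x := by
  filter_upwards [ae_forall_shift hstat (ae_divergence_eq_zero hstat hint hΦ), hΦ.1.cocycle]
    with ω h1 h2 x
  have h3 : ∀ z i, Φ (shift z ω) (Pi.single i 1) = Φ ω (z + Pi.single i 1) - Φ ω z := fun z i => by
    rw [← h2, add_sub_cancel_left]
  have h4 := h1 x
  rw [divergence] at h4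
  rw [HarmonicAt, ← h4]
  refine Finset.sum_congr rfl fun i _ => ?_
  rw [shift_shift, h3, h3, neg_add_eq_sub, sub_add_cancel]
  ring

end RandomConductance

namespace RandomConductance

variable {d : ℕ} {P : Measure (Env d)}

theorem covNormSq_add_le [SFinite P] {Ψ Θ : Env d → (Fin d → ℤ) → ℝ}
    (hΨ : ∀ x, Measurable fun ω => Ψ ω x) (hΘ : ∀ x, Measurable fun ω => Θ ω x) :
    covNormSq P (fun ω x => Ψ ω x + Θ ω x) ≤ 2 * covNormSq P Ψ + 2 * covNormSq P Θ := by
  have hm : ∀ x, Measurable fun ω => Ψ ω x + Θ ω x := fun x => (hΨ x).add (hΘ x)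
  rw [covNormSq_eq_lintegral P hm, covNormSq_eq_lintegral P hΨ,
    covNormSq_eq_lintegral P hΘ,
    ← lintegral_const_mul _ ((measurable_uncurry hΨ).enorm.pow_const _),
    ← lintegral_const_mul _ ((measurable_uncurry hΘ).enorm.pow_const _),
    ← lintegral_add_left (((measurable_uncurry hΨ).enorm.pow_const _).const_mul _)]
  refine lintegral_mono fun a => ?_
  have h1 : ‖Function.uncurry (fun ω x => Ψ ω x + Θ ω x) a‖ₑ ≤
      ‖Function.uncurry Ψ a‖ₑ + ‖Function.uncurry Θ a‖ₑ := enorm_add_le _ _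
  refine (ENNReal.rpow_le_rpow h1 (by norm_num)).trans ?_
  refine (ENNReal.rpow_add_le_mul_rpow_add_rpow _ _ (by norm_num)).trans_eq ?_
  rw [mul_add]
  norm_num

/-- Truncation at level `M`. -/
noncomputable def clamp (M t : ℝ) : ℝ := max (-M) (min t M)

theorem abs_clamp_le {M : ℝ} (hM : 0 ≤ M) (t : ℝ) : |clamp M t| ≤ M := by
  rw [clamp, abs_le]
  exact ⟨le_max_left _ _, max_le (by linarith) (min_le_right _ _)⟩

theorem clamp_of_abs_le {M t : ℝ} (h : |t| ≤ M) : clamp M t = t := by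
  rw [clamp, min_eq_left (abs_le.1 h).2, max_eq_right (abs_le.1 h).1]

theorem abs_sub_clamp_sub_le {M : ℝ} (hM : 0 ≤ M) (a b : ℝ) :
    |(a - b) - (clamp M a - clamp M b)| ≤ |a - b| := by
  unfold clamp
  grind

theorem measurable_clamp (M : ℝ) : Measurable (clamp M) := by
  unfold clamp
  fun_prop

theorem MemL2pot.exists_bounded [IsProbabilityMeasure P] (hstat : IsStationary P)
    (hint : ∀ i, Integrable (unitCond i) P) {χ : Env d → (Fin d → ℤ) → ℝ} (hχ : MemL2pot P χ)
    {ε : ℝ≥0∞} (hε : 0 < ε) : ∃ φ : Env d → ℝ, (∃ B, ∀ ω, |φ ω| ≤ B) ∧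
      MemL2cov P (horizDeriv φ) ∧ covNormSq P (fun ω x => χ ω x - horizDeriv φ ω x) < ε := by
  have h4 : 0 < ε / 4 := ENNReal.div_pos hε.ne' (by norm_num)
  obtain ⟨φ, hφ, hφ', hlt⟩ := hχ.2 _ h4
  set φM : ℕ → Env d → ℝ := fun M ω => clamp M (φ ω) with hφM
  have hbdd : ∀ M ω, |φM M ω| ≤ M := fun M ω => abs_clamp_le (Nat.cast_nonneg M) _
  have hmem : ∀ M, MemL2cov P (horizDeriv (φM M)) := fun M =>
    memL2cov_horizDeriv_of_bounded hstat hint ((measurable_clamp _).comp hφ.1) (hbdd M)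
  have htend : Tendsto (fun M => covNormSq P fun ω x => horizDeriv φ ω x - horizDeriv (φM M) ω x)
      atTop (𝓝 0) := by
    simp only [covNormSq_eq_lintegral P ((hφ'.sub (hmem _)).measurable)]
    rw [← lintegral_zero (μ := edgeMeasure P)]
    refine tendsto_lintegral_of_dominated_convergence
      (fun a => ‖Function.uncurry (horizDeriv φ) a‖ₑ ^ (2 : ℝ))
      (fun M => (measurable_uncurry (hφ'.sub (hmem M)).measurable).enorm.pow_const _)
      (fun M => Eventually.of_forall fun a => ?_) ?_ (Eventually.of_forall fun a => ?_)
    · refine ENNReal.rpow_le_rpow (enorm_le_iff_norm_le.2 ?_) (by norm_num)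
      simp only [Real.norm_eq_abs, Function.uncurry, horizDeriv, hφM]
      exact abs_sub_clamp_sub_le (Nat.cast_nonneg M) _ _
    · rw [← covNormSq_eq_lintegral P hφ'.measurable]
      exact hφ'.norm_lt_top.ne
    · refine tendsto_const_nhds.congr' ?_
      filter_upwards [eventually_ge_atTop ⌈max |φ (shift a.2 a.1)| |φ a.1|⌉₊] with M hM
      have h := Nat.ceil_le.1 hM
      simp [Function.uncurry, horizDeriv, hφM, clamp_of_abs_le ((le_max_left _ _).trans h),
        clamp_of_abs_le ((le_max_right _ _).trans h)]
  obtain ⟨M, hM⟩ := (htend.eventually_lt_const h4).exists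
  refine ⟨φM M, ⟨M, hbdd M⟩, hmem M, ?_⟩
  have hsum := covNormSq_add_le (P := P) (hχ.1.sub hφ').measurable (hφ'.sub (hmem M)).measurable
  simp only [sub_add_sub_cancel] at hsum
  refine hsum.trans_lt ?_
  have h5 : 2 * (ε / 4) + 2 * (ε / 4) ≤ ε := by
    rw [← two_mul, ← mul_assoc, show (2 : ℝ≥0∞) * 2 = 4 by norm_num]
    exact ENNReal.mul_div_le
  refine lt_of_lt_of_le ?_ h5
  exact ENNReal.add_lt_add (ENNReal.mul_lt_mul_right (by norm_num) (by norm_num) hlt)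
    (ENNReal.mul_lt_mul_right (by norm_num) (by norm_num) hM)

theorem abs_rpow_eq_mul_rpow {a : ℝ} (ha : 0 < a) (t q : ℝ) :
    |t| ^ (2 * q / (q + 1)) = (a * t ^ 2) ^ (q / (q + 1)) * (a⁻¹ ^ q) ^ (1 / (q + 1)) := by
  rw [Real.mul_rpow ha.le (sq_nonneg _), ← Real.rpow_mul (by positivity), ← sq_abs t,
    ← Real.rpow_two, ← Real.rpow_mul (abs_nonneg _), Real.inv_rpow ha.le, mul_one_div,
    mul_comm (a ^ _), mul_assoc, mul_inv_cancel₀ (Real.rpow_pos_of_pos ha _).ne', mul_one,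
    mul_div_assoc]

theorem lintegral_increment_rpow_le {Ψ : Env d → (Fin d → ℤ) → ℝ}
    (hΨ : ∀ x, Measurable fun ω => Ψ ω x) {q : ℝ} (hq : 0 < q) (i : Fin d) :
    ∫⁻ ω, ENNReal.ofReal (|Ψ ω (Pi.single i 1)| ^ (2 * q / (q + 1))) ∂P ≤
      covNormSq P Ψ ^ (q / (q + 1)) *
        (∫⁻ ω, ENNReal.ofReal ((unitCond i ω)⁻¹ ^ q) ∂P) ^ (1 / (q + 1)) := by
  have hq1 : 0 < q + 1 := by linarith
  have hf : Measurable fun ω => ENNReal.ofReal (unitCond i ω * Ψ ω (Pi.single i 1) ^ 2) :=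
    ((measurable_unitCond i).mul ((hΨ _).pow_const 2)).ennreal_ofReal
  have hg : Measurable fun ω => ENNReal.ofReal ((unitCond i ω)⁻¹ ^ q) :=
    ((measurable_unitCond i).inv.pow_const q).ennreal_ofReal
  have h := ENNReal.lintegral_mul_norm_pow_le (μ := P) hf.aemeasurable hg.aemeasurable
    (p := q / (q + 1)) (q := 1 / (q + 1)) (by positivity) (by positivity) (by field_simp)
  refine le_trans (lintegral_mono fun ω => ?_) (h.trans ?_)
  · have ha := unitCond_pos i ω
    have h1 : 0 ≤ (unitCond i ω)⁻¹ ^ q := Real.rpow_nonneg (inv_nonneg.2 ha.le) _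
    have h2 : 0 ≤ unitCond i ω * Ψ ω (Pi.single i 1) ^ 2 := mul_nonneg ha.le (sq_nonneg _)
    rw [ENNReal.ofReal_rpow_of_nonneg h2 (by positivity),
      ENNReal.ofReal_rpow_of_nonneg h1 (by positivity),
      ← ENNReal.ofReal_mul (Real.rpow_nonneg h2 _)]
    exact ENNReal.ofReal_le_ofReal (abs_rpow_eq_mul_rpow ha _ q).le
  · exact mul_le_mul_left (ENNReal.rpow_le_rpow (lintegral_unitCond_mul_sq_le i) (by positivity)) _

/-- The sum over the directions of the `s`-th powers of the increments. -/
noncomputable def increments (Ψ : Env d → (Fin d → ℤ) → ℝ) (s : ℝ) (ω : Env d) : ℝ≥0∞ :=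
  ∑ i, ENNReal.ofReal (|Ψ ω (Pi.single i 1)| ^ s)

theorem measurable_increments {Ψ : Env d → (Fin d → ℤ) → ℝ}
    (hΨ : ∀ x, Measurable fun ω => Ψ ω x) (s : ℝ) : Measurable (increments Ψ s) := by
  unfold increments
  refine Finset.measurable_fun_sum _ fun i _ => ENNReal.measurable_ofReal.comp ?_
  exact (continuous_abs.measurable.comp (hΨ _)).pow_const s

theorem lintegral_increments_le {Ψ : Env d → (Fin d → ℤ) → ℝ}
    (hΨ : ∀ x, Measurable fun ω => Ψ ω x) {q : ℝ} (hq : 0 < q) :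
    ∫⁻ ω, increments Ψ (2 * q / (q + 1)) ω ∂P ≤ covNormSq P Ψ ^ (q / (q + 1)) *
      ∑ i, (∫⁻ ω, ENNReal.ofReal ((unitCond i ω)⁻¹ ^ q) ∂P) ^ (1 / (q + 1)) := by
  unfold increments
  rw [lintegral_finsetSum (f := fun i ω => ENNReal.ofReal (|Ψ ω (Pi.single i 1)| ^ (2 * q / (q + 1))))
    _ fun i _ => ((continuous_abs.measurable.comp (hΨ _)).pow_const _).ennreal_ofReal,
    Finset.mul_sum]
  exact Finset.sum_le_sum fun i _ => lintegral_increment_rpow_le hΨ hq i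

theorem cubeSum_increments {Ψ : Env d → (Fin d → ℤ) → ℝ} {ω : Env d}
    (hω : ∀ x y : Fin d → ℤ, Ψ (shift x ω) (y - x) = Ψ ω y - Ψ ω x) (s : ℝ) (R : ℕ)
    (z : Fin d → ℤ) : cubeSum (increments Ψ s) R (shift z ω) =
      ENNReal.ofReal (∑ x ∈ cube (Fin d) R, ∑ i,
        |Ψ ω (z + x + Pi.single i 1) - Ψ ω (z + x)| ^ s) := by
  rw [cubeSum_shift, ENNReal.ofReal_sum_of_nonneg fun x _ => Finset.sum_nonneg fun i _ =>
    Real.rpow_nonneg (abs_nonneg _) _]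
  refine Finset.sum_congr rfl fun x _ => ?_
  rw [increments, ENNReal.ofReal_sum_of_nonneg fun i _ => Real.rpow_nonneg (abs_nonneg _) _]
  refine Finset.sum_congr rfl fun i _ => ?_
  rw [← hω, add_sub_cancel_left]

theorem abs_add_rpow_le {s : ℝ} (hs : 0 ≤ s) (a b : ℝ) :
    |a + b| ^ s ≤ 2 ^ s * (|a| ^ s + |b| ^ s) := by
  have h1 : |a + b| ≤ 2 * max |a| |b| := by
    have := abs_add_le a b
    have := le_max_left |a| |b|
    have := le_max_right |a| |b|
    linarith
  refine (Real.rpow_le_rpow (abs_nonneg _) h1 hs).trans ?_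
  rw [Real.mul_rpow (by norm_num) (le_max_of_le_left (abs_nonneg _))]
  refine mul_le_mul_of_nonneg_left ?_ (by positivity)
  have ha := Real.rpow_nonneg (abs_nonneg a) s
  have hb := Real.rpow_nonneg (abs_nonneg b) s
  rcases max_choice |a| |b| with h | h <;> rw [h] <;> linarith

/-- Functions in the closure of gradients have sublinear oscillation on average. -/
theorem MemL2pot.eventually_oscillation_le [IsProbabilityMeasure P] (hstat : IsStationary P)
    (herg : IsErgodic P) (hint : ∀ i, Integrable (unitCond i) P) {q : ℝ} (hq : 1 < q)
    (hinv : ∀ i, ∫⁻ ω, ENNReal.ofReal ((unitCond i ω)⁻¹ ^ q) ∂P ≠ ∞)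
    {χ : Env d → (Fin d → ℤ) → ℝ} (hχ : MemL2pot P χ) {δ : ℝ} (hδ : 0 < δ) :
    ∀ᵐ ω ∂P, ∀ᶠ n : ℕ in atTop, ∑ x ∈ cube (Fin d) n, ∑ y ∈ cube (Fin d) n,
      |χ ω x - χ ω y| ^ (2 * q / (q + 1)) ≤
        δ * n ^ (2 * q / (q + 1)) * (cube (Fin d) n).card ^ 2 := by
  have hq0 : 0 < q := by linarith
  set s : ℝ := 2 * q / (q + 1) with hs
  have hs1 : 1 ≤ s := by rw [hs, le_div_iff₀ (by linarith)]; linarith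
  have hs0 : 0 < s := by linarith
  set K : ℝ≥0∞ := ∑ i, (∫⁻ ω, ENNReal.ofReal ((unitCond i ω)⁻¹ ^ q) ∂P) ^ (1 / (q + 1)) with hK
  have hKtop : K ≠ ∞ := ENNReal.sum_ne_top.2 fun i _ =>
    ENNReal.rpow_ne_top_of_nonneg (by positivity) (hinv i)
  set A : ℝ := 2 ^ s * ((d : ℝ) ^ (s - 1) * 3 ^ s) with hA
  have hA0 : 0 ≤ A := by positivity
  set c : ℝ := δ / (2 * (A + 1)) with hc
  have hc0 : 0 < c := by positivity
  have hAc : A * c ≤ δ / 2 := by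
    rw [hc, mul_div_assoc', div_le_div_iff₀ (by positivity) (by norm_num)]
    nlinarith
  obtain ⟨ε, hε, hεc⟩ : ∃ ε : ℝ≥0∞, 0 < ε ∧ 20 ^ d * (ε ^ (q / (q + 1)) * K) <
      ENNReal.ofReal c := by
    have hlim : Tendsto (fun ε : ℝ≥0∞ => 20 ^ d * (ε ^ (q / (q + 1)) * K)) (𝓝[>] 0) (𝓝 0) := by
      have h1 : Tendsto (fun ε : ℝ≥0∞ => ε ^ (q / (q + 1))) (𝓝[>] 0) (𝓝 0) := by
        have := (ENNReal.continuous_rpow_const (y := q / (q + 1))).tendsto 0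
        rw [ENNReal.zero_rpow_of_pos (by positivity)] at this
        exact this.mono_left nhdsWithin_le_nhds
      have h2 := ENNReal.Tendsto.const_mul (a := 20 ^ d)
        (ENNReal.Tendsto.mul_const h1 (Or.inr hKtop)) (Or.inr (by simp))
      simpa using h2
    exact ((eventually_mem_nhdsWithin (a := (0 : ℝ≥0∞)) (s := Set.Ioi 0)).and
      (hlim.eventually_lt_const (ENNReal.ofReal_pos.2 hc0))).exists
  obtain ⟨φ, ⟨B, hB⟩, hφ, hlt⟩ := hχ.exists_bounded hstat hint hε
  have hΨ := hχ.1.sub hφ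
  have hB0 : ∀ᵐ ω ∂P, 0 ≤ B := Eventually.of_forall fun ω => (abs_nonneg _).trans (hB ω)
  have hmean : 20 ^ d * ∫⁻ ω, increments (fun ω x => χ ω x - horizDeriv φ ω x) s ω ∂P <
      ENNReal.ofReal c := by
    refine lt_of_le_of_lt ?_ hεc
    gcongr
    refine (lintegral_increments_le hΨ.measurable hq0).trans ?_
    gcongr
  filter_upwards [eventually_cubeSum_le hstat herg (measurable_increments hΨ.measurable s) hmean,
    hΨ.cocycle, hB0] with ω hω hcoc hB0
  have hlarge : ∀ᶠ n : ℕ in atTop, 2 ^ s * (2 * B) ^ s ≤ δ / 2 * (n : ℝ) ^ s :=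
    ((tendsto_rpow_atTop hs0).comp tendsto_natCast_atTop_atTop).const_mul_atTop (half_pos hδ)
      |>.eventually_ge_atTop _
  filter_upwards [hω, hlarge, eventually_ge_atTop 1] with n hn hnB hn1
  have hcard : (0 : ℝ) ≤ (cube (Fin d) n).card := Nat.cast_nonneg _
  have hn1' : (1 : ℝ) ≤ n := by exact_mod_cast hn1
  have hsum : ∑ x ∈ cube (Fin d) n, ∑ i, |(χ ω (x + Pi.single i 1) -
      horizDeriv φ ω (x + Pi.single i 1)) - (χ ω x - horizDeriv φ ω x)| ^ s ≤
      c * (cube (Fin d) n).card := by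
    have h := cubeSum_increments (Ψ := fun ω x => χ ω x - horizDeriv φ ω x) hcoc s n 0
    simp only [shift_zero, zero_add] at h
    rw [h, ← ENNReal.ofReal_natCast, ← ENNReal.ofReal_mul hc0.le,
      ENNReal.ofReal_le_ofReal_iff (by positivity)] at hn
    exact hn
  have hpoin := poincare n hs1 fun x => χ ω x - horizDeriv φ ω x
  have hpt : ∀ x y, |χ ω x - χ ω y| ^ s ≤ 2 ^ s * (|(χ ω x - horizDeriv φ ω x) -
      (χ ω y - horizDeriv φ ω y)| ^ s + (2 * B) ^ s) := by
    intro x y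
    have e : χ ω x - χ ω y = ((χ ω x - horizDeriv φ ω x) - (χ ω y - horizDeriv φ ω y)) +
        (φ (shift x ω) - φ (shift y ω)) := by
      simp only [horizDeriv]; ring
    refine (e ▸ abs_add_rpow_le hs0.le _ _).trans ?_
    gcongr
    have h1 := abs_sub (φ (shift x ω)) (φ (shift y ω))
    linarith [hB (shift x ω), hB (shift y ω)]
  calc ∑ x ∈ cube (Fin d) n, ∑ y ∈ cube (Fin d) n, |χ ω x - χ ω y| ^ s
      ≤ ∑ x ∈ cube (Fin d) n, ∑ y ∈ cube (Fin d) n, 2 ^ s * (|(χ ω x - horizDeriv φ ω x) -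
          (χ ω y - horizDeriv φ ω y)| ^ s + (2 * B) ^ s) :=
        Finset.sum_le_sum fun x _ => Finset.sum_le_sum fun y _ => hpt x y
    _ = 2 ^ s * ∑ x ∈ cube (Fin d) n, ∑ y ∈ cube (Fin d) n, |(χ ω x - horizDeriv φ ω x) -
          (χ ω y - horizDeriv φ ω y)| ^ s + 2 ^ s * (2 * B) ^ s * (cube (Fin d) n).card ^ 2 := by
        simp only [← Finset.mul_sum, Finset.sum_add_distrib, Finset.sum_const, nsmul_eq_mul]
        ring
    _ ≤ 2 ^ s * (d ^ (s - 1) * (3 * n) ^ s * (cube (Fin d) n).card *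
          (c * (cube (Fin d) n).card)) + δ / 2 * n ^ s * (cube (Fin d) n).card ^ 2 := by
        gcongr
        refine hpoin.trans ?_
        gcongr
        linarith
    _ = (A * c) * n ^ s * (cube (Fin d) n).card ^ 2 +
          δ / 2 * n ^ s * (cube (Fin d) n).card ^ 2 := by
        rw [Real.mul_rpow (by norm_num) (by positivity), hA]
        ring
    _ ≤ δ / 2 * n ^ s * (cube (Fin d) n).card ^ 2 +
          δ / 2 * n ^ s * (cube (Fin d) n).card ^ 2 := by gcongr
    _ = δ * n ^ s * (cube (Fin d) n).card ^ 2 := by ring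

theorem exists_sum_le_of_double_sum_le {α : Type*} {S : Finset α} (hS : S.Nonempty)
    {f : α → α → ℝ} {B : ℝ} (h : ∑ x ∈ S, ∑ y ∈ S, f x y ≤ B * S.card) :
    ∃ y ∈ S, ∑ x ∈ S, f x y ≤ B := by
  refine Finset.exists_le_of_sum_le hS (f := fun y => ∑ x ∈ S, f x y) (g := fun _ => B) ?_
  rw [Finset.sum_comm, Finset.sum_const, nsmul_eq_mul, mul_comm]
  exact h

theorem exists_mem_cube_decomposition {d k R : ℕ} (hR : 1 ≤ R) {w : Fin d → ℤ}
    (hw : w ∈ cube (Fin d) (k * R)) :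
    ∃ z ∈ cube (Fin d) k, ∃ x ∈ cube (Fin d) R, w = (R : ℤ) • z + x := by
  have hR' : (0 : ℤ) < R := by exact_mod_cast hR
  rw [mem_cube] at hw
  refine ⟨fun i => w i / R, mem_cube.2 fun i => ⟨?_, ?_⟩, fun i => w i % R,
    mem_cube.2 fun i => ⟨?_, ?_⟩, ?_⟩
  · rw [Int.le_ediv_iff_mul_le hR']
    have := (hw i).1
    push_cast at this
    linarith
  · have := (hw i).2
    push_cast at this
    exact Int.ediv_le_of_le_mul hR' this
  · have := Int.emod_nonneg (w i) hR'.ne'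
    omega
  · exact (Int.emod_lt_of_pos _ hR').le
  · funext i
    simp [Int.mul_ediv_add_emod]

theorem card_cube_le_pow {d R : ℕ} (hR : 1 ≤ R) (k : ℕ) :
    ((cube (Fin d) (k * R)).card : ℝ) ≤ (2 * k + 1) ^ d * (R : ℝ) ^ d := by
  rw [card_cube, Fintype.card_fin, ← mul_pow]
  push_cast
  have : (1 : ℝ) ≤ R := by exact_mod_cast hR
  gcongr
  nlinarith

/-- A sublinearly oscillating perturbation of a coordinate function that makes it harmonic is
bounded on large cubes by a multiple of the radius of the small cubes in which the conductances
and the energy are controlled. -/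
theorem exists_abs_le_mul {d : ℕ} (hd : 3 ≤ d) {p q s : ℝ} (hp : 1 < p) (hq : 1 < q)
    (hpq : 1 / p + 1 / q < 2 / ((d : ℝ) - 1)) (hs : s = 2 * q / (q + 1)) {M : ℝ} (hM : 0 < M)
    (j : Fin d) :
    ∃ K : ℝ, 0 < K ∧ ∀ (c : Fin d → (Fin d → ℤ) → ℝ), (∀ i x, 0 < c i x) →
      ∀ v : (Fin d → ℤ) → ℝ, (∀ x, HarmonicAt c (fun x => (x j : ℝ) - v x) x) → v 0 = 0 →
      ∀ k R : ℕ, 1 ≤ R →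
      (∀ z ∈ cube (Fin d) k,
        ∑ x ∈ cube (Fin d) (2 * R), ∑ i, c i ((R : ℤ) • z + x) ^ p ≤ R ^ d * M ∧
        ∑ x ∈ cube (Fin d) (2 * R), ∑ i, (c i ((R : ℤ) • z + x))⁻¹ ^ q ≤ R ^ d * M ∧
        ∑ x ∈ cube (Fin d) (2 * R), ∑ i,
          |v ((R : ℤ) • z + x + Pi.single i 1) - v ((R : ℤ) • z + x)| ^ s ≤ R ^ d * M) →
      ∑ x ∈ cube (Fin d) ((k + 2) * R), ∑ y ∈ cube (Fin d) ((k + 2) * R), |v x - v y| ^ s ≤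
        1 / (((k + 2 : ℕ) : ℝ) ^ s * (2 * (k + 2 : ℕ) + 1) ^ d) * (((k + 2) * R : ℕ) : ℝ) ^ s *
          (cube (Fin d) ((k + 2) * R)).card ^ 2 →
      ∀ w ∈ cube (Fin d) (k * R), |v w| ≤ K * R := by
  have hs0 : 0 < s := by rw [hs]; positivity
  set M' : ℝ := M + 2 ^ s * (d * 5 ^ d + M + 2 ^ s * 5 ^ d + 1) with hM'
  have hM'0 : 0 < M' := by positivity
  have hMM' : M ≤ M' := le_add_of_nonneg_right (by positivity)
  obtain ⟨C, hC, hbound⟩ := local_bound hd hp hq hpq hs hM'0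
  refine ⟨2 * (C + 1), by positivity, fun c hc v hv hv0 k R hR hsums hosc => ?_⟩
  have hR0 : (0 : ℝ) < R := by exact_mod_cast hR
  set S := cube (Fin d) ((k + 2) * R) with hS
  have h0S : (0 : Fin d → ℤ) ∈ S := mem_cube.2 fun i => by simp; positivity
  obtain ⟨a, -, ha⟩ : ∃ a ∈ S, ∑ x ∈ S, |v x - v a| ^ s ≤ R ^ s * R ^ d := by
    refine exists_sum_le_of_double_sum_le ⟨0, h0S⟩ (hosc.trans ?_)
    have hk : (0 : ℝ) < ((k + 2 : ℕ) : ℝ) ^ s := by positivity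
    have hcard := card_cube_le_pow (d := d) hR (k + 2)
    rw [Nat.cast_mul, Real.mul_rpow (by positivity) hR0.le]
    rw [show 1 / (((k + 2 : ℕ) : ℝ) ^ s * (2 * (k + 2 : ℕ) + 1) ^ d) *
      (((k + 2 : ℕ) : ℝ) ^ s * (R : ℝ) ^ s) * (S.card : ℝ) ^ 2 =
      (R : ℝ) ^ s * (S.card / (2 * (k + 2 : ℕ) + 1) ^ d) * S.card by field_simp]
    gcongr
    rw [div_le_iff₀ (by positivity), mul_comm]
    exact hcard
  have hcell : ∀ z ∈ cube (Fin d) k, ∀ x ∈ cube (Fin d) R,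
      |v ((R : ℤ) • z + x) - v a| ≤ (C + 1) * R := by
    intro z hz x hx
    obtain ⟨h1, h2, h3⟩ := hsums z hz
    set y : Fin d → ℤ := (R : ℤ) • z with hy
    have hyk : y ∈ cube (Fin d) (k * R) := smul_mem_cube hz R
    set u : (Fin d → ℤ) → ℝ := fun x => (x j : ℝ) - v x - ((y j : ℝ) - v a) with hu
    have hharm : ∀ x, HarmonicAt c u x := fun x => by
      have := hv x
      simpa only [HarmonicAt, hu, sub_sub_sub_cancel_right] using this
    have hRd : (R : ℝ) ^ d * M ≤ R ^ d * M' := by gcongr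
    have hcard : ((cube (Fin d) (2 * R)).card : ℝ) ≤ 5 ^ d * (R : ℝ) ^ d := by
      have := card_cube_le_pow (d := d) hR 2
      norm_num at this
      exact this
    have hgrad : ∀ x i, |u (y + x + Pi.single i 1) - u (y + x)| ^ s ≤
        2 ^ s * (1 + |v (y + x + Pi.single i 1) - v (y + x)| ^ s) := by
      intro x i
      have e : u (y + x + Pi.single i 1) - u (y + x) = ((Pi.single i 1 : Fin d → ℤ) j : ℝ) +
          -(v (y + x + Pi.single i 1) - v (y + x)) := by
        simp only [hu, Pi.add_apply]; push_cast; ring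
      refine (e ▸ abs_add_rpow_le hs0.le _ _).trans ?_
      rw [abs_neg]
      gcongr
      refine Real.rpow_le_one (abs_nonneg _) ?_ hs0.le
      by_cases hij : j = i
      · subst hij; simp
      · simp [hij]
    have hval : ∀ x ∈ cube (Fin d) (2 * R), (|u (y + x)| / R) ^ s ≤
        2 ^ s * (2 ^ s + |v (y + x) - v a| ^ s / R ^ s) := by
      intro x hx
      have e : u (y + x) = (x j : ℝ) + -(v (y + x) - v a) := by
        simp only [hu, Pi.add_apply]; push_cast; ring
      rw [Real.div_rpow (abs_nonneg _) hR0.le, div_le_iff₀ (by positivity), e]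
      refine (abs_add_rpow_le hs0.le _ _).trans ?_
      rw [abs_neg, mul_assoc, add_mul, div_mul_cancel₀ _ (by positivity),
        ← Real.mul_rpow (by norm_num) hR0.le]
      gcongr
      have := mem_cube.1 hx j
      rw [← Int.cast_abs]
      have h' : |x j| ≤ 2 * R := abs_le.2 (by push_cast at this; exact this)
      exact_mod_cast h'
    have hshift : ∑ x ∈ cube (Fin d) (2 * R), |v (y + x) - v a| ^ s ≤ R ^ s * R ^ d := by
      refine le_trans ?_ ha
      rw [← Finset.sum_image (f := fun x => |v x - v a| ^ s) (g := fun x => y + x)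
        fun x _ x' _ h => add_left_cancel h]
      refine Finset.sum_le_sum_of_subset_of_nonneg (fun w hw => ?_)
        fun _ _ _ => Real.rpow_nonneg (abs_nonneg _) _
      obtain ⟨x, hx, rfl⟩ := Finset.mem_image.1 hw
      rw [mem_cube] at hx hyk ⊢
      intro i
      have h1 := hx i
      have h2 := hyk i
      push_cast at h1 h2 ⊢
      rw [Pi.add_apply]
      constructor <;> linarith
    have hsum : ∑ x ∈ cube (Fin d) (2 * R), (∑ i, |u (y + x + Pi.single i 1) - u (y + x)| ^ s +
        (|u (y + x)| / R) ^ s) ≤ R ^ d * M' := by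
      calc _ ≤ ∑ x ∈ cube (Fin d) (2 * R),
            (∑ i, 2 ^ s * (1 + |v (y + x + Pi.single i 1) - v (y + x)| ^ s) +
              2 ^ s * (2 ^ s + |v (y + x) - v a| ^ s / R ^ s)) :=
            Finset.sum_le_sum fun x hx => add_le_add
              (Finset.sum_le_sum fun i _ => hgrad x i) (hval x hx)
        _ = 2 ^ s * (d * (cube (Fin d) (2 * R)).card + ∑ x ∈ cube (Fin d) (2 * R), ∑ i,
              |v (y + x + Pi.single i 1) - v (y + x)| ^ s +
              2 ^ s * (cube (Fin d) (2 * R)).card +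
              (∑ x ∈ cube (Fin d) (2 * R), |v (y + x) - v a| ^ s) / R ^ s) := by
            simp only [← Finset.mul_sum, Finset.sum_add_distrib, Finset.sum_const, nsmul_eq_mul,
              Finset.card_univ, Fintype.card_fin, Finset.sum_div]
            ring
        _ ≤ 2 ^ s * (d * (5 ^ d * (R : ℝ) ^ d) + R ^ d * M + 2 ^ s * (5 ^ d * (R : ℝ) ^ d) +
              (R ^ s * R ^ d) / R ^ s) := by gcongr
        _ = R ^ d * (2 ^ s * (d * 5 ^ d + M + 2 ^ s * 5 ^ d + 1)) := by
            rw [mul_div_cancel_left₀ _ (by positivity)]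
            ring
        _ ≤ R ^ d * M' := by
            gcongr
            exact le_add_of_nonneg_left hM.le
    rw [Finset.sum_comm] at h1 h2
    have hfin := hbound c hc u hharm R hR y (h1.trans hRd) (h2.trans hRd) hsum x hx
    have e : v (y + x) - v a = (x j : ℝ) - u (y + x) := by
      simp only [hu, Pi.add_apply]; push_cast; ring
    have hxj : |(x j : ℝ)| ≤ R := by
      rw [← Int.cast_abs]
      exact_mod_cast abs_le.2 (mem_cube.1 hx j)
    rw [e]
    refine (abs_sub _ _).trans ?_
    linarith
  have h0 : |v a| ≤ (C + 1) * R := by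
    have := hcell 0 (mem_cube.2 fun i => by simp) 0 (mem_cube.2 fun i => by simp)
    simpa [hv0] using this
  intro w hw
  obtain ⟨z, hz, x, hx, rfl⟩ := exists_mem_cube_decomposition hR hw
  have h1 := hcell z hz x hx
  have h2 := abs_add_le (v ((R : ℤ) • z + x) - v a) (v a)
  rw [sub_add_cancel] at h2
  linarith

theorem cubeSum_sum_ofReal {d : ℕ} {g : Fin d → Env d → ℝ} (hg : ∀ i ω, 0 ≤ g i ω) (R : ℕ)
    (z : Fin d → ℤ) (ω : Env d) :
    cubeSum (fun ω => ∑ i, ENNReal.ofReal (g i ω)) R (shift z ω) =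
      ENNReal.ofReal (∑ x ∈ cube (Fin d) R, ∑ i, g i (shift (z + x) ω)) := by
  rw [cubeSum_shift, ENNReal.ofReal_sum_of_nonneg fun x _ => Finset.sum_nonneg fun i _ => hg _ _]
  exact Finset.sum_congr rfl fun x _ => (ENNReal.ofReal_sum_of_nonneg fun i _ => hg _ _).symm

theorem eventually_sum_offcentre_le {d : ℕ} {P : Measure (Env d)} [IsProbabilityMeasure P]
    (hstat : IsStationary P) (herg : IsErgodic P) {g : Fin d → Env d → ℝ}
    (hg : ∀ i ω, 0 ≤ g i ω) (hgm : ∀ i, Measurable (g i))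
    (hgi : ∀ i, ∫⁻ ω, ENNReal.ofReal (g i ω) ∂P ≠ ∞) :
    ∃ C : ℝ, 0 < C ∧ ∀ᵐ ω ∂P, ∀ z : Fin d → ℤ, ∀ᶠ R : ℕ in atTop,
      ∑ x ∈ cube (Fin d) (2 * R), ∑ i, g i (shift ((R : ℤ) • z + x) ω) ≤ R ^ d * C := by
  have hm : ∀ i ∈ Finset.univ, Measurable fun ω => ENNReal.ofReal (g i ω) := fun i _ =>
    (hgm i).ennreal_ofReal
  obtain ⟨C, hC, h⟩ := eventually_cubeSum_offcentre_le hstat herg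
    (f := fun ω => ∑ i, ENNReal.ofReal (g i ω)) (Finset.measurable_fun_sum _ hm)
    (by rw [lintegral_finsetSum (f := fun i ω => ENNReal.ofReal (g i ω)) _ hm]
        exact ENNReal.sum_ne_top.2 fun i _ => hgi i)
  refine ⟨C, hC, ?_⟩
  filter_upwards [h] with ω hω z
  filter_upwards [hω z] with R hR
  rwa [cubeSum_sum_ofReal hg, ENNReal.ofReal_le_ofReal_iff (by positivity)] at hR

theorem tendsto_boxMax_div {d : ℕ} {v : (Fin d → ℤ) → ℝ} {K : ℝ} (hK : 0 < K) (L : ℕ)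
    (h : ∀ m : ℕ, 1 ≤ m → ∀ᶠ R : ℕ in atTop, ∀ w ∈ cube (Fin d) (L * m * R), |v w| ≤ K * R) :
    Tendsto (fun n : ℕ => (1 / (n : ℝ)) * boxMax (L * n) v) atTop (𝓝 0) := by
  have hnn : ∀ n, 0 ≤ boxMax n v := fun n =>
    (abs_nonneg (v (box_nonempty d n).choose)).trans
      (Finset.le_sup' (fun x => |v x|) (box_nonempty d n).choose_spec)
  rw [Metric.tendsto_atTop']
  intro ε hε
  obtain ⟨m, hm⟩ := exists_nat_gt (2 * K / ε)
  have hm0 : (0 : ℝ) < m := lt_trans (by positivity) hm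
  have hm1 : 1 ≤ m := by exact_mod_cast hm0
  have htend : Tendsto (fun n : ℕ => n / m + 1) atTop atTop :=
    (tendsto_add_atTop_nat 1).comp (Nat.tendsto_div_const_atTop (by omega))
  obtain ⟨N, hN⟩ := eventually_atTop.1 (htend.eventually (h m hm1))
  refine ⟨max N m, fun n hn => ?_⟩
  have hnN : N ≤ n := by omega
  have hnm : m ≤ n := by omega
  have hn0 : (0 : ℝ) < n := by exact_mod_cast (by omega : 0 < n)
  have hcover : L * n ≤ L * m * (n / m + 1) := by
    rw [mul_assoc]
    refine Nat.mul_le_mul_left L ?_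
    have := Nat.div_add_mod n m
    have := Nat.mod_lt n hm1
    nlinarith
  have hmax : boxMax (L * n) v ≤ K * (n / m + 1 : ℕ) := by
    refine Finset.sup'_le _ _ fun w hw => hN n hnN w ?_
    rw [box_eq_cube] at hw
    exact cube_mono hcover hw
  have hR : ((n / m + 1 : ℕ) : ℝ) ≤ 2 * (n / m) := by
    have h1 : ((n / m : ℕ) : ℝ) ≤ n / m := Nat.cast_div_le
    have h2 : (1 : ℝ) ≤ n / m := by
      rw [le_div_iff₀ hm0, one_mul]
      exact_mod_cast hnm
    push_cast
    linarith
  rw [Real.dist_eq, sub_zero, abs_of_nonneg (mul_nonneg (by positivity) (hnn _))]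
  calc 1 / (n : ℝ) * boxMax (L * n) v ≤ 1 / n * (K * (2 * (n / m))) := by
        gcongr
        exact hmax.trans (by gcongr)
    _ = 2 * K / m := by field_simp
    _ < ε := by
        rw [div_lt_iff₀ hε] at hm
        rw [div_lt_iff₀ hm0]
        linarith

/-- Sublinearity of the corrector under finite moments with real exponents. -/
theorem IsCorrector.ae_tendsto_boxMax {d : ℕ} (hd : 3 ≤ d) {P : Measure (Env d)}
    [IsProbabilityMeasure P] (hstat : IsStationary P) (herg : IsErgodic P) {p q : ℝ} (hp : 1 < p)
    (hq : 1 < q) (hpq : 1 / p + 1 / q < 2 / ((d : ℝ) - 1))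
    (hint : ∀ i, Integrable (unitCond i) P)
    (hmom : ∀ i, ∫⁻ ω, ENNReal.ofReal (unitCond i ω ^ p) ∂P ≠ ∞)
    (hinv : ∀ i, ∫⁻ ω, ENNReal.ofReal ((unitCond i ω)⁻¹ ^ q) ∂P ≠ ∞)
    {j : Fin d} {χ : Env d → (Fin d → ℤ) → ℝ} (hχ : IsCorrector P j χ) (L : ℕ) :
    ∀ᵐ ω ∂P, Tendsto (fun n : ℕ => (1 / (n : ℝ)) * boxMax (L * n) (χ ω)) atTop (𝓝 0) := by
  have hq0 : 0 < q := by linarith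
  have hq1 : 0 < q + 1 := by linarith
  set s : ℝ := 2 * q / (q + 1) with hs
  have hχm := hχ.1.1.measurable
  have hinc : ∀ i, ∫⁻ ω, ENNReal.ofReal (|χ ω (Pi.single i 1)| ^ s) ∂P ≠ ∞ := fun i =>
    ((lintegral_increment_rpow_le hχm hq0 i).trans_lt (ENNReal.mul_lt_top
      (ENNReal.rpow_lt_top_of_nonneg (by positivity) hχ.1.1.norm_lt_top.ne)
      (ENNReal.rpow_lt_top_of_nonneg (by positivity) (hinv i)))).ne
  obtain ⟨C₁, hC₁, h₁⟩ := eventually_sum_offcentre_le hstat herg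
    (g := fun i ω => unitCond i ω ^ p) (fun i ω => Real.rpow_nonneg (unitCond_pos i ω).le _)
    (fun i => (measurable_unitCond i).pow_const p) hmom
  obtain ⟨C₂, hC₂, h₂⟩ := eventually_sum_offcentre_le hstat herg
    (g := fun i ω => (unitCond i ω)⁻¹ ^ q)
    (fun i ω => Real.rpow_nonneg (inv_nonneg.2 (unitCond_pos i ω).le) _)
    (fun i => (measurable_unitCond i).inv.pow_const q) hinv
  obtain ⟨C₃, hC₃, h₃⟩ := eventually_sum_offcentre_le hstat herg
    (g := fun i ω => |χ ω (Pi.single i 1)| ^ s) (fun i ω => Real.rpow_nonneg (abs_nonneg _) _)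
    (fun i => (continuous_abs.measurable.comp (hχm _)).pow_const s) hinc
  obtain ⟨K, hK, hbound⟩ := exists_abs_le_mul hd hp hq hpq hs
    (M := C₁ + C₂ + C₃) (by positivity) j
  have hosc := ae_all_iff.2 fun m : ℕ => hχ.1.eventually_oscillation_le hstat herg hint hq hinv
    (δ := 1 / (((L * m + 2 : ℕ) : ℝ) ^ s * (2 * (L * m + 2 : ℕ) + 1) ^ d)) (by positivity)
  filter_upwards [h₁, h₂, h₃, hosc, ae_harmonicAt hstat hint hχ.2, hχ.1.1.cocycle,
    hχ.1.1.cocycle.ae_zero] with ω h₁ h₂ h₃ hosc hharm hcoc h0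
  refine tendsto_boxMax_div hK L fun m _ => ?_
  have htend : Tendsto (fun R : ℕ => (L * m + 2) * R) atTop atTop :=
    tendsto_id.const_mul_atTop' (by omega)
  filter_upwards [eventually_ge_atTop 1, htend.eventually (hosc m),
    (Filter.eventually_all_finset (cube (Fin d) (L * m))).2 fun z _ => h₁ z,
    (Filter.eventually_all_finset (cube (Fin d) (L * m))).2 fun z _ => h₂ z,
    (Filter.eventually_all_finset (cube (Fin d) (L * m))).2 fun z _ => h₃ z]
    with R hR hoscR h₁ h₂ h₃
  have hRd : (0 : ℝ) ≤ (R : ℝ) ^ d := by positivity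
  refine hbound _ (fun i x => unitCond_pos i (shift x ω)) (χ ω) hharm h0 (L * m) R hR
    (fun z hz => ⟨(h₁ z hz).trans ?_, (h₂ z hz).trans ?_, ?_⟩) hoscR
  · exact mul_le_mul_of_nonneg_left (by linarith) hRd
  · exact mul_le_mul_of_nonneg_left (by linarith) hRd
  · refine le_trans (le_of_eq ?_) ((h₃ z hz).trans (mul_le_mul_of_nonneg_left (by linarith) hRd))
    refine Finset.sum_congr rfl fun x _ => Finset.sum_congr rfl fun i _ => ?_
    rw [← hcoc, add_sub_cancel_left]

theorem exists_real_exponents {d : ℕ} (hd : 3 ≤ d) {p q : ℝ≥0∞}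
    (hpq : p⁻¹ + q⁻¹ < 2 / ((d : ℝ≥0∞) - 1)) :
    ∃ p' q' : ℝ, 1 < p' ∧ 1 < q' ∧ ENNReal.ofReal p' ≤ p ∧ ENNReal.ofReal q' ≤ q ∧
      1 / p' + 1 / q' < 2 / ((d : ℝ) - 1) := by
  have hd' : (3 : ℝ) ≤ d := by exact_mod_cast hd
  have hcast : (2 : ℝ≥0∞) / ((d : ℝ≥0∞) - 1) = ENNReal.ofReal (2 / ((d : ℝ) - 1)) := by
    rw [ENNReal.ofReal_div_of_pos (by linarith), ENNReal.ofReal_sub _ zero_le_one]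
    simp
  rw [hcast] at hpq
  have hp0 : p⁻¹ ≠ ∞ := ((le_self_add.trans_lt hpq).trans ENNReal.ofReal_lt_top).ne
  have hq0 : q⁻¹ ≠ ∞ := ((le_add_self.trans_lt hpq).trans ENNReal.ofReal_lt_top).ne
  obtain ⟨a, ha⟩ : ∃ a, a = (p⁻¹).toReal := ⟨_, rfl⟩
  obtain ⟨b, hb⟩ : ∃ b, b = (q⁻¹).toReal := ⟨_, rfl⟩
  have ha0 : 0 ≤ a := ha ▸ ENNReal.toReal_nonneg
  have hb0 : 0 ≤ b := hb ▸ ENNReal.toReal_nonneg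
  have hab : a + b < 2 / ((d : ℝ) - 1) := by
    rw [ha, hb, ← ENNReal.toReal_add hp0 hq0, ← ENNReal.lt_ofReal_iff_toReal_lt]
    · exact hpq
    · exact ENNReal.add_ne_top.2 ⟨hp0, hq0⟩
  have h1 : 2 / ((d : ℝ) - 1) ≤ 1 := by
    rw [div_le_one (by linarith)]; linarith
  obtain ⟨ε, hε⟩ : ∃ ε, ε = (2 / ((d : ℝ) - 1) - (a + b)) / 3 := ⟨_, rfl⟩
  have hε0 : 0 < ε := by rw [hε]; linarith
  have hle : ∀ {r : ℝ≥0∞} {t : ℝ}, r⁻¹ ≠ ∞ → t = (r⁻¹).toReal → 0 ≤ t →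
      ENNReal.ofReal (1 / (t + ε)) ≤ r := by
    intro r t hr ht ht0
    rw [one_div, ENNReal.ofReal_inv_of_pos (by linarith), ENNReal.inv_le_iff_inv_le,
      ← ENNReal.ofReal_toReal hr]
    exact ENNReal.ofReal_le_ofReal (by linarith)
  refine ⟨1 / (a + ε), 1 / (b + ε), ?_, ?_, hle hp0 ha ha0, hle hq0 hb hb0, ?_⟩
  · rw [lt_div_iff₀ (by linarith)]; linarith
  · rw [lt_div_iff₀ (by linarith)]; linarith
  · rw [one_div_one_div, one_div_one_div]; linarith

theorem lintegral_rpow_ne_top_of_memLp {Ω : Type*} [MeasurableSpace Ω] {P : Measure Ω}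
    [IsFiniteMeasure P] {f : Ω → ℝ} (hf0 : ∀ ω, 0 ≤ f ω) {p : ℝ≥0∞} (hf : MemLp f p P) {r : ℝ}
    (hr : 0 < r) (hrp : ENNReal.ofReal r ≤ p) : ∫⁻ ω, ENNReal.ofReal (f ω ^ r) ∂P ≠ ∞ := by
  have h := lintegral_rpow_enorm_lt_top_of_eLpNorm_lt_top (by simpa using hr)
    ENNReal.ofReal_ne_top (hf.mono_exponent hrp).2
  rw [ENNReal.toReal_ofReal hr.le] at h
  refine ne_of_lt (lt_of_eq_of_lt (lintegral_congr fun ω => ?_) h)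
  rw [Real.enorm_of_nonneg (hf0 ω), ENNReal.ofReal_rpow_of_nonneg (hf0 ω) hr.le]

end RandomConductance

theorem proposition2p3 (d : ℕ) (hd : 3 ≤ d)
    (P : Measure (RandomConductance.Env d)) [IsProbabilityMeasure P]
    (hstat : RandomConductance.IsStationary P) (herg : RandomConductance.IsErgodic P)
    (p q : ℝ≥0∞) (hp : 1 < p) (hq : 1 < q) (hpq : p⁻¹ + q⁻¹ < 2 / ((d : ℝ≥0∞) - 1))
    (hmomp : ∀ e : RandomConductance.Bond d, MemLp (fun ω : RandomConductance.Env d => (ω e : ℝ)) p P)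
    (hmomq : ∀ e : RandomConductance.Bond d,
      MemLp (fun ω : RandomConductance.Env d => (ω e : ℝ)⁻¹) q P)
    (j : Fin d) :
    (∃ χ : RandomConductance.Env d → (Fin d → ℤ) → ℝ, RandomConductance.IsCorrector P j χ) ∧
    ∀ χ : RandomConductance.Env d → (Fin d → ℤ) → ℝ, RandomConductance.IsCorrector P j χ →
      ∀ L : ℕ, ∀ᵐ ω ∂P, Tendsto
        (fun n : ℕ => (1 / (n : ℝ)) * RandomConductance.boxMax (L * n) (χ ω)) atTop (𝓝 0) := by
  have hint : ∀ i, Integrable (RandomConductance.unitCond i) P := fun i =>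
    (hmomp (RandomConductance.unitBond i)).integrable hp.le
  obtain ⟨p', q', hp', hq', hpp, hqq, hpq'⟩ := RandomConductance.exists_real_exponents hd hpq
  refine ⟨RandomConductance.exists_isCorrector hstat hint j, fun χ hχ L => ?_⟩
  exact hχ.ae_tendsto_boxMax hd hstat herg hp' hq' hpq' hint
    (fun i => RandomConductance.lintegral_rpow_ne_top_of_memLp
      (fun ω => (RandomConductance.unitCond_pos i ω).le)
      (hmomp (RandomConductance.unitBond i)) (by linarith) hpp)
    (fun i => RandomConductance.lintegral_rpow_ne_top_of_memLp
      (fun ω => inv_nonneg.2 (RandomConductance.unitCond_pos i ω).le)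
      (hmomq (RandomConductance.unitBond i)) (by linarith) hqq) L
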